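/- **Setting.** Let $a:\mathbb{CP}^1\to\mathbb{CP}^1$, $a(\zeta)=-1/\bar\zeta$, be the antipodal map. A *smooth space over $\mathbb{CP}^1$ with a real structure* is a (pure-dimensional, Hausdorff) complex manifold $Z$ with a surjective holomorphic submersion $Z\to\mathbb{CP}^1$ and an antiholomorphic involution $\tau$ of $Z$ covering $a$. A *twistor group* is a group object $\mathcal G$ in the category of such spaces: multiplication $\mathcal G\times_{\mathbb{CP}^1}\mathcal G\to\mathcal G$, inverse and identity section are holomorphic, make each fibre a group, and are compatible with $\tau$. A *homogeneous $\mathcal G$-space* is a smooth space $W$ over $\mathbb{CP}^1$ with a real structure and a holomorphic action $\mathcal G\times_{\mathbb{CP}^1}W\to W$ over $\mathbb{CP}^1$ with $\tau(g\cdot w)=\tau(g)\cdot\tau(w)$, which is transitive on each fibre. Isomorphisms of homogeneous $\mathcal G$-spaces are $\mathcal G$-equivariant biholomorphic maps over $\mathbb{CP}^1$ which commute with the real structures. A *closed twistor subgroup* $\mathcal H\subset\mathcal G$ is a closed, $\tau$-invariant complex submanifold (of constant dimension), on which the projection to $\mathbb{CP}^1$ is a submersion, and which is a subgroup in each fibre.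 $\mathcal G/\mathcal H$ is the space of fibrewise left cosets with the quotient topology, a function on an open subset being holomorphic if its pull-back to $\mathcal G$ is. $W$ is *locally isomorphic to $\mathcal G/\mathcal H$* if each point of $\mathbb{CP}^1$ has an open neighbourhood $U$ over which there is a $\mathcal G$-equivariant isomorphism $(\mathcal G/\mathcal H)|_U\cong W|_U$ (of ringed spaces over $U$). Let $N(\mathcal H)\subset\mathcal G$ be the fibrewise normalizer of $\mathcal H$, and let $\mathcal O(N(\mathcal H)/\mathcal H)$ be the sheaf of groups on $\mathbb{CP}^1$ of those local holomorphic sections of $\mathcal G/\mathcal H\to\mathbb{CP}^1$ which take values in $N(\mathcal H)/\mathcal H$. Let $H^1_{\mathbb R}(\mathbb{CP}^1,\mathcal O(N(\mathcal H)/\mathcal H))$ be the (non-abelian) Čech cohomology set formed from $\tau$-invariant cocycles modulo $\tau$-invariant cochains: one uses open coverings $\{U_i\}_{i\in I}$ with an involution $i\mapsto\bar\imath$ of $I$ such that $U_{\bar\imath}=a(U_i)$; a cocycle consists of sections $s_{ij}$ over $U_i\cap U_j$ with $s_{ik}=s_{ij}s_{jk}$ and $s_{\bar\imath\bar\jmath}\circ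 a=\tau\circ s_{ij}$; and $s$, $s'$ are cohomologous if, after pulling back to a common refinement $\{V_k\}$ of the same kind (by refinement maps commuting with the involutions), $r_k\,s'_{kl}=s_{kl}\,r_l$ for some sections $r_k$ over $V_k$ with $r_{\bar k}\circ a=\tau\circ r_k$. **Proposition.** Let $\mathcal H$ be a closed twistor subgroup of a twistor group $\mathcal G$. The set of isomorphism classes of homogeneous $\mathcal G$-spaces which are locally isomorphic to $\mathcal G/\mathcal H$ is in bijection with $H^1_{\mathbb R}\bigl(\mathbb{CP}^1,\mathcal O(N(\mathcal H)/\mathcal H)\bigr)$. More precisely, there is a bijection with the following property: if $W$ is such a space and $h_i:(\mathcal G/\mathcal H)|_{U_i}\to W|_{U_i}$ are $\mathcal G$-equivariant isomorphisms over the members of a covering as above with $h_{\bar\imath}\circ\tau=\tau\circ h_i$, then the sections $s_{ij}(\zeta)=h_j^{-1}\bigl(h_i(\mathcal H_\zeta)\bigr)$, where $\mathcal H_\zeta\in\mathcal G/\mathcal H$ is the trivial coset over $\zeta$, form a $\tau$-invariant cocycle, and the class of $W$ corresponds to the class of this cocycle. -/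

import Mathlib

open Set Topology
open scoped Manifold ContDiff

universe u

noncomputable section

namespace Twistor

/-! ### The complex projective line and its antipodal map -/

/-- The complex projective line, as `ℂ ∪ {∞}`. -/
abbrev CP1 : Type := OnePoint ℂ

/-- The involution `ζ ↦ 1/ζ` of the projective line, exchanging `0` and `∞`. -/
def invCP1 (x : CP1) : CP1 :=
  OnePoint.elim x ((0 : ℂ) : CP1) (fun z => if z = 0 then OnePoint.infty else ((z⁻¹ : ℂ) : CP1))

lemma invCP1_infty : invCP1 OnePoint.infty = ((0 : ℂ) : CP1) := rfl

lemma invCP1_zero : invCP1 ((0 : ℂ) : CP1) = OnePoint.infty := by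
  simp [invCP1]

lemma invCP1_coe {z : ℂ} (hz : z ≠ 0) : invCP1 (z : CP1) = ((z⁻¹ : ℂ) : CP1) := by
  simp [invCP1, hz]

lemma invCP1_invCP1 (x : CP1) : invCP1 (invCP1 x) = x := by
  induction x using OnePoint.rec with
  | infty => rw [invCP1_infty, invCP1_zero]
  | coe z =>
    by_cases hz : z = 0
    · subst hz; rw [invCP1_zero, invCP1_infty]
    · rw [invCP1_coe hz, invCP1_coe (inv_ne_zero hz), inv_inv]

lemma continuous_invCP1 : Continuous invCP1 := by
  rw [continuous_iff_continuousAt]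
  intro x
  induction x using OnePoint.rec with
  | infty =>
    rw [OnePoint.continuousAt_infty', invCP1_infty]
    rw [Filter.coclosedCompact_eq_cocompact, ← Metric.cobounded_eq_cocompact]
    have h1 : Filter.Tendsto (fun z : ℂ => ((z⁻¹ : ℂ) : CP1)) (Bornology.cobounded ℂ)
        (𝓝 ((0 : ℂ) : CP1)) :=
      (OnePoint.continuous_coe.tendsto (0 : ℂ)).comp Filter.tendsto_inv₀_cobounded
    refine h1.congr' ?_
    filter_upwards [Bornology.eventually_ne_cobounded (0 : ℂ)] with z hz
    exact (invCP1_coe hz).symm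
  | coe z =>
    rw [OnePoint.continuousAt_coe]
    by_cases hz : z = 0
    · subst hz
      rw [continuousAt_iff_punctured_nhds]
      simp only [Function.comp, invCP1_zero]
      have h1 : Filter.Tendsto (fun w : ℂ => ((w⁻¹ : ℂ) : CP1)) (𝓝[≠] 0)
          (𝓝 (OnePoint.infty : CP1)) := by
        refine OnePoint.tendsto_coe_infty.comp ?_
        rw [Filter.coclosedCompact_eq_cocompact, ← Metric.cobounded_eq_cocompact]
        exact Filter.tendsto_inv₀_nhdsNE_zero
      refine h1.congr' ?_
      filter_upwards [self_mem_nhdsWithin] with w hw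
      exact (invCP1_coe hw).symm
    · have h1 : ContinuousAt (fun w : ℂ => ((w⁻¹ : ℂ) : CP1)) z :=
        OnePoint.continuous_coe.continuousAt.comp (continuousAt_inv₀ hz)
      refine h1.congr ?_
      filter_upwards [isOpen_ne.mem_nhds hz] with w hw
      exact (invCP1_coe hw).symm

/-- `ζ ↦ 1/ζ` as a homeomorphism. -/
def invHomeo : CP1 ≃ₜ CP1 where
  toFun := invCP1
  invFun := invCP1
  left_inv := invCP1_invCP1
  right_inv := invCP1_invCP1
  continuous_toFun := continuous_invCP1
  continuous_invFun := continuous_invCP1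

/-- The affine coordinate `ζ` on the complement of `∞`. -/
def chartZero : OpenPartialHomeomorph CP1 ℂ :=
  ((OnePoint.isOpenEmbedding_coe (X := ℂ)).toOpenPartialHomeomorph _).symm

/-- The affine coordinate `1/ζ` on the complement of `0`. -/
def chartInfty : OpenPartialHomeomorph CP1 ℂ :=
  invHomeo.toOpenPartialHomeomorph.trans chartZero

lemma chartZero_source : chartZero.source = range ((↑) : ℂ → CP1) := by
  simp [chartZero]

lemma chartZero_target : chartZero.target = univ := by
  simp [chartZero]

lemma chartZero_symm_apply (z : ℂ) : chartZero.symm z = (z : CP1) := by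
  simp [chartZero]

lemma chartZero_coe (z : ℂ) : chartZero (z : CP1) = z := by
  have h := chartZero.right_inv (x := z) (by rw [chartZero_target]; trivial)
  rwa [chartZero_symm_apply] at h

lemma chartInfty_apply (x : CP1) : chartInfty x = chartZero (invCP1 x) := rfl

lemma chartInfty_symm_apply (z : ℂ) : chartInfty.symm z = invCP1 (z : CP1) := by
  have h : chartInfty.symm z = invCP1 (chartZero.symm z) := rfl
  rw [h, chartZero_symm_apply]

lemma chartInfty_source : chartInfty.source = invCP1 ⁻¹' range ((↑) : ℂ → CP1) := by
  simp only [chartInfty, OpenPartialHomeomorph.trans_source, chartZero_source]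
  simp [invHomeo]

/-- The holomorphic atlas of the projective line with the two coordinates `ζ` and `1/ζ`. -/
instance : ChartedSpace ℂ CP1 where
  atlas := {chartZero, chartInfty}
  chartAt x := OnePoint.elim x chartInfty (fun _ => chartZero)
  mem_chart_source x := by
    induction x using OnePoint.rec with
    | infty =>
      change OnePoint.infty ∈ chartInfty.source
      rw [chartInfty_source, mem_preimage, invCP1_infty]
      exact mem_range_self _
    | coe z =>
      change (z : CP1) ∈ chartZero.source
      rw [chartZero_source]
      exact mem_range_self _
  chart_mem_atlas x := by
    induction x using OnePoint.rec with
    | infty => exact Or.inr rfl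
    | coe z => exact Or.inl rfl

lemma chart_change_aux {z : ℂ} (h : invCP1 (z : CP1) ∈ range ((↑) : ℂ → CP1)) : z ≠ 0 := by
  rintro rfl
  rw [invCP1_zero] at h
  exact OnePoint.infty_notMem_range_coe h

instance : IsManifold 𝓘(ℂ) ω CP1 := by
  have key : ContDiffOn ℂ ω (fun z : ℂ => z⁻¹) {z | z ≠ 0} :=
    fun z hz => (contDiffAt_inv ℂ hz).contDiffWithinAt
  have hself : ∀ e : OpenPartialHomeomorph CP1 ℂ,
      ContDiffOn ℂ ω (e.symm.trans e) (e.symm.trans e).source := by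
    intro e
    refine contDiffOn_id.congr fun z hz => ?_
    have hz' : z ∈ e.target := by
      have := hz
      rw [OpenPartialHomeomorph.trans_source] at this
      exact this.1
    exact e.right_inv hz'
  refine isManifold_of_contDiffOn _ _ _ fun e e' he he' => ?_
  simp only [modelWithCornersSelf_coe, modelWithCornersSelf_coe_symm, Function.id_comp,
    Function.comp_id, preimage_id, range_id, inter_univ]
  rcases he with rfl | rfl <;> rcases he' with rfl | rfl
  · exact hself _
  · have hsub : (chartZero.symm.trans chartInfty).source ⊆ {z | z ≠ 0} := by
      intro z hz
      rw [OpenPartialHomeomorph.trans_source] at hz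
      have h2 : chartZero.symm z ∈ chartInfty.source := hz.2
      rw [chartZero_symm_apply, chartInfty_source] at h2
      exact chart_change_aux h2
    refine (key.mono hsub).congr fun z hz => ?_
    change chartInfty (chartZero.symm z) = z⁻¹
    rw [chartZero_symm_apply, chartInfty_apply, invCP1_coe (hsub hz), chartZero_coe]
  · have hsub : (chartInfty.symm.trans chartZero).source ⊆ {z | z ≠ 0} := by
      intro z hz
      rw [OpenPartialHomeomorph.trans_source] at hz
      have h2 : chartInfty.symm z ∈ chartZero.source := hz.2
      rw [chartInfty_symm_apply, chartZero_source] at h2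
      exact chart_change_aux h2
    refine (key.mono hsub).congr fun z hz => ?_
    change chartZero (chartInfty.symm z) = z⁻¹
    rw [chartInfty_symm_apply, invCP1_coe (hsub hz), chartZero_coe]
  · exact hself _

/-- The antipodal map `ζ ↦ -1/ζ̄` of the projective line, exchanging `0` and `∞`. -/
def antipode (x : CP1) : CP1 :=
  OnePoint.elim x ((0 : ℂ) : CP1)
    (fun z => if z = 0 then OnePoint.infty else ((-(starRingEnd ℂ z)⁻¹ : ℂ) : CP1))

lemma antipode_antipode (x : CP1) : antipode (antipode x) = x := by
  induction x using OnePoint.rec with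
  | infty => simp [antipode]
  | coe z =>
    by_cases hz : z = 0
    · subst hz; simp [antipode]
    · simp [antipode, hz]

/-! ### Holomorphic functions and morphisms of ringed spaces -/

/-- A structure of (reduced) `ℂ`-ringed space on `X`, given by specifying which complex functions
are holomorphic on which (open) subsets of `X`. -/
abbrev HolStructure (X : Type*) := Set X → (X → ℂ) → Prop

/-- The holomorphic functions on open subsets of a complex manifold `M` modelled on `E`. -/
def manifoldHol (E : Type*) [NormedAddCommGroup E] [NormedSpace ℂ E] (M : Type*)
    [TopologicalSpace M] [ChartedSpace E M] : HolStructure M :=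
  fun V φ => ContMDiffOn 𝓘(ℂ, E) 𝓘(ℂ, ℂ) ω φ V

/-- `f` is holomorphic on the open set `D`: it is continuous there and pulls back
holomorphic functions to holomorphic functions. -/
def HolOn {X Y : Type*} [TopologicalSpace X] [TopologicalSpace Y]
    (OX : HolStructure X) (OY : HolStructure Y) (D : Set X) (f : X → Y) : Prop :=
  ContinuousOn f D ∧
    ∀ (V : Set Y) (φ : Y → ℂ), IsOpen V → OY V φ → OX (D ∩ f ⁻¹' V) (φ ∘ f)

/-- `f` is antiholomorphic: it is continuous and, for each holomorphic function `φ` on an open set,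
the complex conjugate of `φ ∘ f` is holomorphic. -/
def AntiHol {X Y : Type*} [TopologicalSpace X] [TopologicalSpace Y]
    (OX : HolStructure X) (OY : HolStructure Y) (f : X → Y) : Prop :=
  Continuous f ∧
    ∀ (V : Set Y) (φ : Y → ℂ), IsOpen V → OY V φ → OX (f ⁻¹' V) (fun x => starRingEnd ℂ (φ (f x)))

/-! ### Smooth spaces with a real structure, twistor groups and their actions -/

/-- A smooth space over `ℂP¹` with a real structure: a complex manifold with a surjective
holomorphic submersion to `ℂP¹` and an antiholomorphic involution covering the antipodal map. -/
structure RealSpace where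
  carrier : Type u
  [top : TopologicalSpace carrier]
  [t2 : T2Space carrier]
  /-- The complex dimension. -/
  dim : ℕ
  [charted : ChartedSpace (Fin dim → ℂ) carrier]
  [manifold : IsManifold 𝓘(ℂ, Fin dim → ℂ) ω carrier]
  /-- The projection to `ℂP¹`. -/
  proj : carrier → CP1
  proj_hol : ContMDiff 𝓘(ℂ, Fin dim → ℂ) 𝓘(ℂ, ℂ) ω proj
  proj_surjective : Function.Surjective proj
  proj_submersion : ∀ z, Function.Surjective (mfderiv 𝓘(ℂ, Fin dim → ℂ) 𝓘(ℂ, ℂ) proj z)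
  /-- The real structure. -/
  τ : carrier → carrier
  τ_antihol : AntiHol (manifoldHol (Fin dim → ℂ) carrier) (manifoldHol (Fin dim → ℂ) carrier) τ
  τ_τ : ∀ z, τ (τ z) = z
  proj_τ : ∀ z, proj (τ z) = antipode (proj z)

attribute [instance] RealSpace.top RealSpace.t2 RealSpace.charted RealSpace.manifold

namespace RealSpace

/-- The sheaf of holomorphic functions of a smooth space. -/
abbrev hol (Z : RealSpace.{u}) : HolStructure Z.carrier := manifoldHol (Fin Z.dim → ℂ) Z.carrier

/-- The fibre product over `ℂP¹`, as a (closed, smooth) subset of the product. -/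
def fibreProd (Y Z : RealSpace.{u}) : Set (Y.carrier × Z.carrier) := {p | Y.proj p.1 = Z.proj p.2}

end RealSpace

/-- A twistor group: a group object in the category of smooth spaces over `ℂP¹` with a real
structure. The multiplication is only meaningful on pairs of elements in the same fibre (its other
values are irrelevant), and it is holomorphic on the fibre product. -/
structure TwistorGroup extends RealSpace.{u} where
  mul : carrier → carrier → carrier
  inv : carrier → carrier
  one : CP1 → carrier
  mul_hol : ContMDiffOn (𝓘(ℂ, Fin dim → ℂ).prod 𝓘(ℂ, Fin dim → ℂ)) 𝓘(ℂ, Fin dim → ℂ) ω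
    (fun p : carrier × carrier => mul p.1 p.2) (toRealSpace.fibreProd toRealSpace)
  inv_hol : ContMDiff 𝓘(ℂ, Fin dim → ℂ) 𝓘(ℂ, Fin dim → ℂ) ω inv
  one_hol : ContMDiff 𝓘(ℂ, ℂ) 𝓘(ℂ, Fin dim → ℂ) ω one
  proj_mul : ∀ g h, proj g = proj h → proj (mul g h) = proj g
  proj_inv : ∀ g, proj (inv g) = proj g
  proj_one : ∀ x, proj (one x) = x
  mul_assoc : ∀ g h k, proj g = proj h → proj h = proj k → mul (mul g h) k = mul g (mul h k)
  one_mul : ∀ g, mul (one (proj g)) g = g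
  mul_one : ∀ g, mul g (one (proj g)) = g
  inv_mul : ∀ g, mul (inv g) g = one (proj g)
  mul_inv : ∀ g, mul g (inv g) = one (proj g)
  τ_mul : ∀ g h, proj g = proj h → τ (mul g h) = mul (τ g) (τ h)
  τ_inv : ∀ g, τ (inv g) = inv (τ g)
  τ_one : ∀ x, τ (one x) = one (antipode x)

/-- A homogeneous `G`-space: a smooth space over `ℂP¹` with a real structure and with a holomorphic
action of `G`, compatible with the projections and the real structures, which is transitive on each
fibre. The action is only meaningful on pairs of elements in the same fibre. -/
structure HomogeneousSpace (G : TwistorGroup.{u}) extends RealSpace.{u} where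
  act : G.carrier → carrier → carrier
  act_hol : ContMDiffOn (𝓘(ℂ, Fin G.dim → ℂ).prod 𝓘(ℂ, Fin dim → ℂ)) 𝓘(ℂ, Fin dim → ℂ) ω
    (fun p : G.carrier × carrier => act p.1 p.2) (G.toRealSpace.fibreProd toRealSpace)
  proj_act : ∀ g w, G.proj g = proj w → proj (act g w) = proj w
  one_act : ∀ w, act (G.one (proj w)) w = w
  mul_act : ∀ g h w, G.proj g = G.proj h → G.proj h = proj w →
    act (G.mul g h) w = act g (act h w)
  τ_act : ∀ g w, G.proj g = proj w → τ (act g w) = act (G.τ g) (τ w)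
  transitive : ∀ w w', proj w = proj w' → ∃ g, G.proj g = proj w ∧ act g w = w'

/-- An isomorphism of homogeneous `G`-spaces: a biholomorphic map over `ℂP¹` which is
`G`-equivariant and compatible with the real structures. -/
structure HomogeneousSpace.Iso {G : TwistorGroup.{u}} (W W' : HomogeneousSpace G) where
  toEquiv : W.carrier ≃ W'.carrier
  hol : ContMDiff 𝓘(ℂ, Fin W.dim → ℂ) 𝓘(ℂ, Fin W'.dim → ℂ) ω toEquiv
  hol_symm : ContMDiff 𝓘(ℂ, Fin W'.dim → ℂ) 𝓘(ℂ, Fin W.dim → ℂ) ω toEquiv.symm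
  proj_eq : ∀ w, W'.proj (toEquiv w) = W.proj w
  equivariant : ∀ g w, G.proj g = W.proj w → toEquiv (W.act g w) = W'.act g (toEquiv w)
  real : ∀ w, toEquiv (W.τ w) = W'.τ (toEquiv w)

/-- A closed twistor subgroup of `G`: a closed fibrewise subgroup, invariant under the real
structure, which is smooth over `ℂP¹`, i.e. a complex submanifold on which the projection is a
submersion. The last condition says that the subset is cut out locally by holomorphic equations
`F = 0` whose differential is surjective jointly with that of the projection. -/
structure ClosedTwistorSubgroup (G : TwistorGroup.{u}) where
  carrier : Set G.carrier
  isClosed : IsClosed carrier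
  one_mem : ∀ x, G.one x ∈ carrier
  mul_mem : ∀ g h, G.proj g = G.proj h → g ∈ carrier → h ∈ carrier → G.mul g h ∈ carrier
  inv_mem : ∀ g, g ∈ carrier → G.inv g ∈ carrier
  τ_mem : ∀ g, g ∈ carrier → G.τ g ∈ carrier
  /-- The codimension of the subgroup. -/
  codim : ℕ
  smooth : ∀ h ∈ carrier, ∃ (V : Set G.carrier) (F : G.carrier → (Fin codim → ℂ)),
    IsOpen V ∧ h ∈ V ∧
    ContMDiffOn 𝓘(ℂ, Fin G.dim → ℂ) 𝓘(ℂ, Fin codim → ℂ) ω F V ∧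
    (∀ g ∈ V, g ∈ carrier ↔ F g = 0) ∧
    Function.Surjective fun v : TangentSpace 𝓘(ℂ, Fin G.dim → ℂ) h =>
      (mfderiv 𝓘(ℂ, Fin G.dim → ℂ) 𝓘(ℂ, ℂ) G.proj h v,
        mfderiv 𝓘(ℂ, Fin G.dim → ℂ) 𝓘(ℂ, Fin codim → ℂ) F h v)

/-! ### The quotient `G/H` -/

section Quotient

variable {G : TwistorGroup.{u}} (H : ClosedTwistorSubgroup G)

/-- Two elements are equivalent if they lie in the same left coset of `H` in a fibre of `G`. -/
def cosetSetoid : Setoid G.carrier where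
  r g g' := G.proj g = G.proj g' ∧ G.mul (G.inv g) g' ∈ H.carrier
  iseqv := by
    refine ⟨fun g => ⟨rfl, ?_⟩, ?_, ?_⟩
    · rw [G.inv_mul]; exact H.one_mem _
    · rintro g g' ⟨h, hm⟩
      refine ⟨h.symm, ?_⟩
      have hp : G.proj (G.inv g) = G.proj g' := (G.proj_inv g).trans h
      have hp' : G.proj (G.inv g') = G.proj g := (G.proj_inv g').trans h.symm
      have e1 : G.mul (G.mul (G.inv g) g') (G.mul (G.inv g') g) = G.one (G.proj g) := by
        rw [G.mul_assoc _ _ _ hp (by rw [G.proj_mul _ _ hp', G.proj_inv]),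
          ← G.mul_assoc g' _ _ (G.proj_inv g').symm hp', G.mul_inv, ← h, G.one_mul, G.inv_mul]
      have hx : G.proj (G.mul (G.inv g) g') = G.proj g := by rw [G.proj_mul _ _ hp, G.proj_inv]
      have hy : G.proj (G.mul (G.inv g') g) = G.proj g := by rw [G.proj_mul _ _ hp', hp']
      have e2 : G.inv (G.mul (G.inv g) g') = G.mul (G.inv g') g := by
        have := congrArg (G.mul (G.inv (G.mul (G.inv g) g'))) e1
        rw [← G.mul_assoc _ _ _ (G.proj_inv _) (hx.trans hy.symm), G.inv_mul] at this
        rw [hx, ← hy, G.one_mul, hy] at this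
        rw [this, ← hx, ← G.proj_inv, G.mul_one]
      rw [← e2]
      exact H.inv_mem _ hm
    · rintro g g' g'' ⟨h, hm⟩ ⟨h', hm'⟩
      refine ⟨h.trans h', ?_⟩
      have hp : G.proj (G.inv g) = G.proj g' := (G.proj_inv g).trans h
      have hp' : G.proj (G.inv g') = G.proj g'' := (G.proj_inv g').trans h'
      have e1 : G.mul (G.mul (G.inv g) g') (G.mul (G.inv g') g'') = G.mul (G.inv g) g'' := by
        rw [G.mul_assoc _ _ _ hp (by rw [G.proj_mul _ _ hp', G.proj_inv]),
          ← G.mul_assoc g' _ _ (G.proj_inv g').symm hp', G.mul_inv, h', G.one_mul]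
      rw [← e1]
      refine H.mul_mem _ _ ?_ hm hm'
      rw [G.proj_mul _ _ hp, G.proj_mul _ _ hp', hp, G.proj_inv]

/-- The quotient `G/H`, fibrewise the set of left cosets. -/
def Coset : Type u := Quotient (cosetSetoid H)

/-- The quotient topology. -/
instance : TopologicalSpace (Coset H) :=
  inferInstanceAs (TopologicalSpace (Quotient (cosetSetoid H)))

namespace Coset

/-- The quotient map `G → G/H`. -/
def mk (g : G.carrier) : Coset H := Quotient.mk (cosetSetoid H) g

variable {H}

/-- A chosen representative of a coset. -/
def rep (x : Coset H) : G.carrier := Quotient.out (s := cosetSetoid H) x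

lemma mk_rep (x : Coset H) : mk H x.rep = x := Quotient.out_eq (s := cosetSetoid H) x

lemma mk_eq_mk {g g' : G.carrier} :
    mk H g = mk H g' ↔ G.proj g = G.proj g' ∧ G.mul (G.inv g) g' ∈ H.carrier :=
  Quotient.eq (r := cosetSetoid H)

variable (H) in
/-- The natural structure of ringed space on `G/H`: a function on `G/H` is holomorphic if its
pull-back to `G` is. -/
def hol : HolStructure (Coset H) := fun V φ => G.hol (mk H ⁻¹' V) (φ ∘ mk H)

/-- The projection of `G/H` to `ℂP¹`. -/
def proj (x : Coset H) : CP1 :=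
  Quotient.lift (s := cosetSetoid H) G.proj (fun _ _ h => h.1) x

lemma proj_mk (g : G.carrier) : (mk H g).proj = G.proj g := rfl

lemma proj_rep (x : Coset H) : G.proj x.rep = x.proj := by
  rw [← proj_mk (H := H), mk_rep]

/-- The real structure of `G/H`. -/
def τ (x : Coset H) : Coset H :=
  Quotient.map (sa := cosetSetoid H) (sb := cosetSetoid H) G.τ (by
    rintro g g' ⟨h, hm⟩
    refine ⟨by rw [G.proj_τ, G.proj_τ, h], ?_⟩
    rw [← G.τ_inv, ← G.τ_mul _ _ ((G.proj_inv g).trans h)]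
    exact H.τ_mem _ hm) x

lemma τ_mk (g : G.carrier) : (mk H g).τ = mk H (G.τ g) := rfl

/-- The action of `G` on `G/H` by left translations (of interest for `g` and `x` in the same
fibre). -/
def act (g : G.carrier) (x : Coset H) : Coset H := mk H (G.mul g x.rep)

lemma inv_mul_rev {a b : G.carrier} (h : G.proj a = G.proj b) :
    G.inv (G.mul a b) = G.mul (G.inv b) (G.inv a) := by
  have h1 : G.proj (G.mul a b) = G.proj b := (G.proj_mul _ _ h).trans h
  have h2 : G.proj (G.inv b) = G.proj (G.inv a) := by rw [G.proj_inv, G.proj_inv, h]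
  have h3 : G.proj (G.mul (G.inv b) (G.inv a)) = G.proj b := by
    rw [G.proj_mul _ _ h2, G.proj_inv]
  have e : G.mul (G.mul a b) (G.mul (G.inv b) (G.inv a)) = G.one (G.proj b) := by
    rw [G.mul_assoc _ _ _ h h3.symm, ← G.mul_assoc b _ _ (G.proj_inv b).symm h2, G.mul_inv,
      ← h, ← G.proj_inv a, G.one_mul, G.mul_inv, G.proj_inv]
  have := congrArg (G.mul (G.inv (G.mul a b))) e
  rw [← G.mul_assoc _ _ _ (G.proj_inv _) (h1.trans h3.symm), G.inv_mul, h1] at this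
  rw [← h3, G.one_mul, h3] at this
  rw [this, ← h1, ← G.proj_inv, G.mul_one]

/-- The action does not depend on the chosen representative. -/
lemma act_mk {g a : G.carrier} (h : G.proj g = G.proj a) : act g (mk H a) = mk H (G.mul g a) := by
  have hr : mk H (mk H a).rep = mk H a := mk_rep _
  obtain ⟨hp, hm⟩ := mk_eq_mk.1 hr
  set r := (mk H a).rep
  have hgr : G.proj g = G.proj r := h.trans hp.symm
  refine mk_eq_mk.2 ⟨by rw [G.proj_mul _ _ hgr, G.proj_mul _ _ h], ?_⟩
  have e : G.mul (G.inv (G.mul g r)) (G.mul g a) = G.mul (G.inv r) a := by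
    rw [inv_mul_rev hgr, G.mul_assoc _ _ _ (by rw [G.proj_inv, G.proj_inv, hgr])
      (by rw [G.proj_inv, G.proj_mul _ _ h]), ← G.mul_assoc (G.inv g) _ _ (G.proj_inv g) h,
      G.inv_mul, h, G.one_mul]
  rw [e]
  exact hm

end Coset

/-! ### The sheaf of holomorphic sections of `N(H)/H` -/

/-- The (fibrewise) normalizer `N(H)` of `H` in `G`. -/
def normalizer : Set G.carrier :=
  {g | ∀ h, G.proj h = G.proj g → (h ∈ H.carrier ↔ G.mul (G.mul g h) (G.inv g) ∈ H.carrier)}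

/-- The subset `N(H)/H` of `G/H`. -/
def normalizerQuotient : Set (Coset H) := Coset.mk H '' normalizer H

variable {H}

/-- The multiplication of `N(H)/H` (of interest for two elements of `N(H)/H` in the same fibre). -/
def nmul (x y : Coset H) : Coset H := Coset.mk H (G.mul x.rep y.rep)

/-- The product of two cosets in `N(H)/H` does not depend on the chosen representatives. -/
lemma nmul_mk {a b : G.carrier} (hab : G.proj a = G.proj b) (hb : b ∈ normalizer H) :
    nmul (Coset.mk H a) (Coset.mk H b) = Coset.mk H (G.mul a b) := by
  change Coset.act (Coset.mk H a).rep (Coset.mk H b) = _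
  have hr : Coset.mk H a = Coset.mk H (Coset.mk H a).rep := (Coset.mk_rep _).symm
  obtain ⟨hp, hm⟩ := Coset.mk_eq_mk.1 hr
  set r := (Coset.mk H a).rep
  have hrb : G.proj r = G.proj b := hp.symm.trans hab
  rw [Coset.act_mk hrb]
  symm
  refine Coset.mk_eq_mk.2 ⟨by rw [G.proj_mul _ _ hab, G.proj_mul _ _ hrb, hp], ?_⟩
  -- the element in question is the conjugate of `a⁻¹ r ∈ H` by `b⁻¹`
  have hbi : G.proj (G.inv b) = G.proj b := G.proj_inv b
  have hai : G.proj (G.inv a) = G.proj b := (G.proj_inv a).trans hab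
  have hair : G.proj (G.mul (G.inv a) r) = G.proj b := by
    rw [G.proj_mul _ _ (hai.trans hrb.symm), hai]
  have e : G.mul (G.inv (G.mul a b)) (G.mul r b) =
      G.mul (G.inv b) (G.mul (G.mul (G.inv a) r) b) := by
    rw [Coset.inv_mul_rev hab, G.mul_assoc _ _ _ (hbi.trans hai.symm)
      (by rw [G.proj_mul _ _ hrb, hai, hrb]), G.mul_assoc (G.inv a) _ _ (hai.trans hrb.symm) hrb]
  rw [e]
  have hy : G.proj (G.mul (G.mul (G.inv a) r) b) = G.proj b := by
    rw [G.proj_mul _ _ hair, hair]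
  refine (hb _ ?_).2 ?_
  · rw [G.proj_mul _ _ (hbi.trans hy.symm), hbi]
  · have e2 : G.mul (G.mul b (G.mul (G.inv b) (G.mul (G.mul (G.inv a) r) b))) (G.inv b) =
        G.mul (G.inv a) r := by
      rw [← G.mul_assoc b _ _ hbi.symm (hbi.trans hy.symm), G.mul_inv, ← hy, G.one_mul,
        G.mul_assoc _ _ _ hair hbi.symm, G.mul_inv, ← hair, G.mul_one]
    rw [e2]
    exact hm

variable (H) in
/-- `s` restricts to a section over `U` of the sheaf of holomorphic sections of `N(H)/H`, that is a
holomorphic section of `G/H → ℂP¹` over `U` with values in `N(H)/H`. -/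
def IsNSection (U : Set CP1) (s : CP1 → Coset H) : Prop :=
  HolOn (manifoldHol ℂ CP1) (Coset.hol H) U s ∧
    ∀ x ∈ U, (s x).proj = x ∧ s x ∈ normalizerQuotient H

end Quotient

/-! ### Real cohomology -/

/-- An open covering of `ℂP¹` invariant under the antipodal map, which exchanges the members
indexed by `i` and `bar i`. -/
structure RealCover where
  ι : Type
  bar : ι → ι
  bar_bar : ∀ i, bar (bar i) = i
  U : ι → Set CP1
  isOpen : ∀ i, IsOpen (U i)
  covers : ∀ x, ∃ i, x ∈ U i
  U_bar : ∀ i, U (bar i) = antipode ⁻¹' U i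

section Cohomology

variable {G : TwistorGroup.{u}} (H : ClosedTwistorSubgroup G)

/-- A real (i.e. compatible with the real structure) `1`-cocycle on an invariant covering with
values in the sheaf of groups of holomorphic sections of `N(H)/H`. The values of `s i j` outside
`U i ∩ U j` are irrelevant. -/
structure RealCocycle (C : RealCover) where
  s : C.ι → C.ι → CP1 → Coset H
  isSection : ∀ i j, IsNSection H (C.U i ∩ C.U j) (s i j)
  cocycle : ∀ i j k, ∀ x ∈ C.U i ∩ C.U j ∩ C.U k, s i k x = nmul (s i j x) (s j k x)
  real : ∀ i j, ∀ x ∈ C.U i ∩ C.U j, s (C.bar i) (C.bar j) (antipode x) = (s i j x).τ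

variable {H}

/-- Two real cocycles are cohomologous if, on a common invariant refinement, they differ by the
coboundary of a real `0`-cochain `r`: `s' = r⁻¹ s r`. -/
def Cohomologous (c c' : Σ C : RealCover, RealCocycle H C) : Prop :=
  ∃ (D : RealCover) (ρ : D.ι → c.1.ι) (ρ' : D.ι → c'.1.ι) (r : D.ι → CP1 → Coset H),
    (∀ k, ρ (D.bar k) = c.1.bar (ρ k)) ∧ (∀ k, ρ' (D.bar k) = c'.1.bar (ρ' k)) ∧
    (∀ k, D.U k ⊆ c.1.U (ρ k)) ∧ (∀ k, D.U k ⊆ c'.1.U (ρ' k)) ∧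
    (∀ k, IsNSection H (D.U k) (r k)) ∧
    (∀ k, ∀ x ∈ D.U k, r (D.bar k) (antipode x) = (r k x).τ) ∧
    ∀ k l, ∀ x ∈ D.U k ∩ D.U l,
      nmul (r k x) (c'.2.s (ρ' k) (ρ' l) x) = nmul (c.2.s (ρ k) (ρ l) x) (r l x)

variable (H)

/-- The real cohomology set `H¹_ℝ(ℂP¹, 𝒪(N(H)/H))`: the classes of real cocycles on invariant
coverings, with respect to (the equivalence relation generated by) being cohomologous on a common
refinement. -/
def H1Real : Type (max 1 u) := Quot (Cohomologous (H := H))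

variable {H}

/-- The cohomology class of a real cocycle. -/
def H1Real.mk {C : RealCover} (c : RealCocycle H C) : H1Real H := Quot.mk _ ⟨C, c⟩

/-! ### Homogeneous spaces locally isomorphic to `G/H` -/

variable (H)

/-- A `G`-equivariant isomorphism, over the open set `U`, of the restrictions to `U` of `G/H` and of
the homogeneous `G`-space `W`. -/
structure LocalIso (W : HomogeneousSpace G) (U : Set CP1) where
  e : OpenPartialHomeomorph (Coset H) W.carrier
  source_eq : e.source = Coset.proj ⁻¹' U
  target_eq : e.target = W.proj ⁻¹' U
  hol : HolOn (Coset.hol H) W.hol e.source e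
  hol_symm : HolOn W.hol (Coset.hol H) e.target e.symm
  proj_eq : ∀ x ∈ e.source, W.proj (e x) = x.proj
  equivariant : ∀ g, ∀ x ∈ e.source, G.proj g = x.proj → e (Coset.act g x) = W.act g (e x)

/-- `W` is locally isomorphic to `G/H`: each point of `ℂP¹` has an open neighbourhood over which the
two are isomorphic as `G`-spaces. -/
def LocallyIsoCoset (W : HomogeneousSpace G) : Prop :=
  ∀ x : CP1, ∃ U : Set CP1, IsOpen U ∧ x ∈ U ∧ Nonempty (LocalIso H W U)

/-- The homogeneous `G`-spaces which are locally isomorphic to `G/H`. -/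
def LocallyCosetSpace : Type (u + 1) := {W : HomogeneousSpace G // LocallyIsoCoset H W}

/-- The set of isomorphism classes of homogeneous `G`-spaces locally isomorphic to `G/H`. -/
def IsoClass : Type (u + 1) :=
  Quot fun W W' : LocallyCosetSpace H => Nonempty (HomogeneousSpace.Iso W.1 W'.1)

variable {H}

/-- A family of local isomorphisms over an invariant covering is real if the real structures
exchange the isomorphisms over `U i` and over its image under the antipodal map. -/
def IsRealFamily {W : HomogeneousSpace G} {C : RealCover} (h : ∀ i, LocalIso H W (C.U i)) : Prop :=
  ∀ i, ∀ x : Coset H, x.proj ∈ C.U i → (h (C.bar i)).e x.τ = W.τ ((h i).e x)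

/-- The transition section over `U i ∩ U j` of a family `h` of local isomorphisms: the value
of the `G`-equivariant automorphism `h_j⁻¹ ∘ h_i` of `G/H` on the trivial coset. -/
def transition {W : HomogeneousSpace G} {C : RealCover} (h : ∀ i, LocalIso H W (C.U i))
    (i j : C.ι) (x : CP1) : Coset H :=
  (h j).e.symm ((h i).e (Coset.mk H (G.one x)))

end Cohomology

end Twistor

end

/-! This is descent for a locally constant type of `G`-space: spaces locally isomorphic to `G/H` are
classified by cocycles in the sheaf of automorphisms of `G/H`. These automorphisms are the sections
of `N(H)/H`. An equivariant bijection of a fibre of `G/H` is determined by the image of the trivial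
coset, because `G` acts transitively; that image has the same stabilizer as the trivial coset, so it
lies in `N(H)/H`, and the map is right multiplication by it (`Coset.equivariant_mem`,
`Coset.equivariant_eq`). Hence two local isomorphisms `h_i`, `h_j` with the same `W` satisfy `h_j⁻¹
h_i = R_{s_ij}`, where `R` denotes right multiplication, and composing automorphisms gives `s_ik =
s_ij s_jk` (`LocalIso.toSection_trans`).

The analytic input is that `G/H`, as a ringed space, is a complex manifold for which `G → G/H` has
local holomorphic sections. Since `H` is cut out by equations whose differentials are independent
jointly with that of the projection, there is a holomorphic slice transversal to each coset, and the
implicit function theorem projects a neighbourhood in `G` to it along the cosets (`exists_slice`,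
`exists_slice_coordinates`). Slices give the charts (`exists_isCosetChart`). After that, morphisms
of ringed spaces to and from `G/H` are holomorphic maps of manifolds, and questions about `G/H` are
lifted to `G` with `Coset.exists_lift`.

A real family of local isomorphisms always exists: each isomorphism over `U` is supplemented by its
conjugate over the antipodal set (`LocallyIsoCoset.exists_isRealFamily`). If `F : W ≅ W'`, the
sections of `h'_j⁻¹ F h_i` form a real cochain relating the two cocycles (`cohomologous_of_iso`).
Conversely, a cochain `r` glues the maps `h'_k R_{r_k} h_k⁻¹` to an isomorphism
(`nonempty_iso_of_cohomologous`). Every real cocycle is realised by glueing copies of `G/H` along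
right multiplications; these commute with the left action and, by reality, with the real structures
up to exchanging indices (`RealCocycle.space`, `RealCocycle.isCocycleOf_space`).

Both sets of classes are quotients by relations, so these two comparison lemmas are all that is
needed for the two maps to be well defined and mutually inverse. -/

noncomputable section

namespace Twistor

/-! ### Local inverses of holomorphic maps -/

section Analysis

variable {E F : Type*} [NormedAddCommGroup E] [NormedSpace ℂ E]
  [NormedAddCommGroup F] [NormedSpace ℂ F] [FiniteDimensional ℂ F]

/-- An analytic map with surjective derivative has a local analytic right inverse. -/
lemma exists_contDiffAt_rightInverse {f : E → F} {a : E} (hf : ContDiffAt ℂ ω f a)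
    (hs : Function.Surjective (fderiv ℂ f a)) :
    ∃ σ : F → E, ContDiffAt ℂ ω σ (f a) ∧ σ (f a) = a ∧ ∀ᶠ y in 𝓝 (f a), f (σ y) = y := by
  have : CompleteSpace F := FiniteDimensional.complete ℂ F
  -- On the affine subspace through `a` spanned by a linear right inverse of the derivative, `f` has
  -- derivative the identity, so the inverse function theorem applies to `f ∘ A`.
  obtain ⟨R, hR⟩ := (fderiv ℂ f a).toLinearMap.exists_rightInverse_of_surjective
    (LinearMap.range_eq_top.2 hs)
  let R' : F →L[ℂ] E := R.toContinuousLinearMap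
  have hR' : (fderiv ℂ f a).comp R' = ContinuousLinearMap.id ℂ F := by
    ext y; exact congrArg (fun l : F →ₗ[ℂ] F => l y) hR
  let A : F → E := fun y => a + R' (y - f a)
  have hA : ContDiff ℂ ω A := by unfold A; fun_prop
  have hAa : A (f a) = a := by simp [A]
  have hg : ContDiffAt ℂ ω (f ∘ A) (f a) := by
    refine ContDiffAt.comp _ ?_ hA.contDiffAt
    rwa [hAa]
  have hd : HasFDerivAt (f ∘ A) ((ContinuousLinearEquiv.refl ℂ F : F ≃L[ℂ] F) : F →L[ℂ] F)
      (f a) := by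
    have h1 : HasFDerivAt A R' (f a) := by
      have h2 : HasFDerivAt (fun y => y - f a) (ContinuousLinearMap.id ℂ F) (f a) :=
        (hasFDerivAt_id _).sub_const _
      exact (R'.hasFDerivAt.comp (f a) h2).const_add a
    have h3 : HasFDerivAt f (fderiv ℂ f a) (A (f a)) := by
      rw [hAa]; exact (hf.differentiableAt (by simp)).hasFDerivAt
    have := h3.comp (f a) h1
    rw [hR'] at this
    exact this
  have hfix : (f ∘ A) (f a) = f a := by simp [hAa]
  let e := hg.toOpenPartialHomeomorph (f ∘ A) hd (by simp)
  have ht : f a ∈ e.target := by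
    have := hg.image_mem_toOpenPartialHomeomorph_target hd (by simp)
    rwa [hfix] at this
  have hψ : hg.localInverse hd (by simp) (f a) = f a := by
    have := hg.localInverse_apply_image hd (by simp)
    rwa [hfix] at this
  refine ⟨A ∘ e.symm, ?_, ?_, ?_⟩
  · refine ContDiffAt.comp _ hA.contDiffAt ?_
    have := hg.to_localInverse hd (by simp)
    rw [hfix] at this
    exact this
  · change A (hg.localInverse hd (by simp) (f a)) = a
    rw [hψ, hAa]
  · filter_upwards [e.open_target.mem_nhds ht] with y hy
    exact e.right_inv hy

variable {M : Type*} [TopologicalSpace M] [ChartedSpace E M]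

/-- A submersion has local holomorphic sections. -/
lemma exists_contMDiffAt_rightInverse [IsManifold 𝓘(ℂ, E) ω M] {H' : Type*} [TopologicalSpace H']
    {I' : ModelWithCorners ℂ F H'} [I'.Boundaryless] {N : Type*} [TopologicalSpace N]
    [ChartedSpace H' N] [IsManifold I' ω N] {f : M → N} {p : M}
    (hf : ContMDiffAt 𝓘(ℂ, E) I' ω f p)
    (hs : Function.Surjective (mfderiv 𝓘(ℂ, E) I' f p)) :
    ∃ σ : N → M, ContMDiffAt I' 𝓘(ℂ, E) ω σ (f p) ∧ σ (f p) = p ∧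
      ∀ᶠ y in 𝓝 (f p), f (σ y) = y := by
  let c := extChartAt 𝓘(ℂ, E) p
  let d := extChartAt I' (f p)
  have hf' := contMDiffAt_iff.1 hf
  have h1 : ContDiffAt ℂ ω (d ∘ f ∘ c.symm) (c p) := by
    have := hf'.2
    simp only [modelWithCornersSelf_coe, range_id, contDiffWithinAt_univ] at this
    exact this
  have h2 : Function.Surjective (fderiv ℂ (d ∘ f ∘ c.symm) (c p)) := by
    have e : (mfderiv 𝓘(ℂ, E) I' f p : E →L[ℂ] F) = fderiv ℂ (d ∘ f ∘ c.symm) (c p) := by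
      refine (hf.mdifferentiableAt (by simp)).mfderiv.trans ?_
      simp only [modelWithCornersSelf_coe, range_id, fderivWithin_univ]
      rfl
    exact e ▸ hs
  obtain ⟨σ, hσ, hσp, hσr⟩ := exists_contDiffAt_rightInverse h1 h2
  have hcp : c.symm (c p) = p := extChartAt_to_inv p
  have hfp : (d ∘ f ∘ c.symm) (c p) = d (f p) := by simp [hcp]
  rw [hfp] at hσ hσp hσr
  have hcσ : ContMDiffAt I' 𝓘(ℂ, E) ω (fun y => σ (d y)) (f p) :=
    ContMDiffAt.comp (f p) hσ.contMDiffAt (contMDiffAt_extChartAt (x := f p))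
  have hσc : ContMDiffAt I' 𝓘(ℂ, E) ω (fun y => c.symm (σ (d y))) (f p) := by
    refine ContMDiffAt.comp (f p) (g := c.symm) ?_ hcσ
    rw [hσp]
    refine (contMDiffOn_extChartAt_symm p).contMDiffAt ?_
    exact extChartAt_target_mem_nhds p
  refine ⟨fun y => c.symm (σ (d y)), hσc, by simp only [hσp, hcp], ?_⟩
  have hdc : ContinuousAt d (f p) := continuousAt_extChartAt (f p)
  have e1 := hdc.eventually hσr
  have e2 : ∀ᶠ y in 𝓝 (f p), y ∈ d.source := extChartAt_source_mem_nhds (f p)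
  -- The identity is known only after applying the chart `d`; cancelling `d` requires both sides to
  -- stay in its source.
  have e3 : ∀ᶠ y in 𝓝 (f p), f (c.symm (σ (d y))) ∈ d.source := by
    have : ContinuousAt (fun y => f (c.symm (σ (d y)))) (f p) := by
      refine ContinuousAt.comp (g := f) ?_ hσc.continuousAt
      simp only [hσp, hcp]
      exact hf.continuousAt
    refine this.eventually (extChartAt_source_mem_nhds' ?_)
    simp only [hσp, hcp]
    exact mem_extChartAt_source (f p)
  filter_upwards [e1, e2, e3] with y h1 h2 h3
  have := congrArg d.symm h1
  simp only [Function.comp] at this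
  rwa [d.left_inv h3, d.left_inv h2] at this

/-- The implicit function theorem for a map which restricts to the identity on the second
factor at the base point. -/
lemma exists_implicit [CompleteSpace E] [IsManifold 𝓘(ℂ, E) ω M] {Θ : M × F → F} {p : M}
    (hΘ : ContMDiffAt (𝓘(ℂ, E).prod 𝓘(ℂ, F)) 𝓘(ℂ, F) ω Θ (p, 0))
    (hid : ∀ᶠ y in 𝓝 (0 : F), Θ (p, y) = y) :
    ∃ Y : M → F, ContMDiffAt 𝓘(ℂ, E) 𝓘(ℂ, F) ω Y p ∧ Y p = 0 ∧
      ∀ᶠ q in 𝓝 ((p, 0) : M × F), Θ q = 0 ↔ Y q.1 = q.2 := by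
  have : CompleteSpace F := FiniteDimensional.complete ℂ F
  let c := extChartAt 𝓘(ℂ, E) p
  have hcp : c.symm (c p) = p := extChartAt_to_inv p
  let f : E × F → F := fun q => Θ (c.symm q.1, q.2)
  have hf0 : f (c p, 0) = 0 := by
    change Θ (c.symm (c p), 0) = 0
    rw [hcp, hid.self_of_nhds]
  have hf : ContDiffAt ℂ ω f (c p, 0) := by
    have key : ContMDiffAt (𝓘(ℂ, E).prod 𝓘(ℂ, F)) 𝓘(ℂ, F) ω f (c p, 0) := by
      refine ContMDiffAt.comp (I' := 𝓘(ℂ, E).prod 𝓘(ℂ, F)) (c p, (0 : F)) (g := Θ)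
        (f := fun q : E × F => (c.symm q.1, q.2)) (by rw [hcp]; exact hΘ) ?_
      refine ContMDiffAt.prodMk ?_ contMDiffAt_snd
      refine ContMDiffAt.comp (I' := 𝓘(ℂ, E)) (c p, (0 : F)) (g := c.symm) ?_ contMDiffAt_fst
      exact (contMDiffOn_extChartAt_symm p).contMDiffAt (extChartAt_target_mem_nhds (I := 𝓘(ℂ, E)) p)
    rw [← modelWithCornersSelf_prod, chartedSpaceSelf_prod] at key
    exact key.contDiffAt
  -- As `Θ (p, ·)` is the identity near `0`, the partial derivative is the identity. This is the
  -- invertibility required by the implicit function theorem.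
  have hinv : fderiv ℂ f (c p, 0) ∘L .inr ℂ E F = ContinuousLinearMap.id ℂ F := by
    have h1 : HasFDerivAt (fun y : F => f (c p, y)) (fderiv ℂ f (c p, 0) ∘L .inr ℂ E F) 0 :=
      HasFDerivAt.comp (0 : F) (g := f) (hf.differentiableAt (by simp)).hasFDerivAt
        (hasFDerivAt_prodMk_right (c p) (0 : F))
    have h2 : HasFDerivAt (fun y : F => f (c p, y)) (ContinuousLinearMap.id ℂ F) 0 := by
      refine (hasFDerivAt_id (0 : F)).congr_of_eventuallyEq ?_
      filter_upwards [hid] with y hy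
      change Θ (c.symm (c p), y) = y
      rw [hcp, hy]
    exact h1.unique h2
  have hi : (fderiv ℂ f (c p, 0) ∘L .inr ℂ E F).IsInvertible := by
    rw [hinv]; exact ⟨ContinuousLinearEquiv.refl ℂ F, rfl⟩
  have hY := hf.contDiffAt_implicitFunction (by simp) hi
  have hY0 := hf.implicitFunction_apply_self (by simp) hi
  have hYe := hf.eventually_apply_eq_iff_implicitFunction (by simp) hi
  let ψ := hf.implicitFunction (by simp) hi
  refine ⟨fun g => ψ (c g), ?_, hY0, ?_⟩
  · exact ContMDiffAt.comp p hY.contMDiffAt (contMDiffAt_extChartAt (x := p))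
  · have hc : ContinuousAt (fun q : M × F => (c q.1, q.2)) (p, 0) :=
      ((continuousAt_extChartAt (I := 𝓘(ℂ, E)) p).comp (x := ((p, 0) : M × F)) continuousAt_fst).prodMk continuousAt_snd
    have h1 := hc.eventually hYe
    have h2 : ∀ᶠ q in 𝓝 ((p, 0) : M × F), q.1 ∈ c.source :=
      continuousAt_fst.eventually (extChartAt_source_mem_nhds p)
    filter_upwards [h1, h2] with q h1 h2
    rw [hf0] at h1
    have : f (c q.1, q.2) = Θ q := by
      change Θ (c.symm (c q.1), q.2) = Θ q
      rw [c.left_inv h2]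
    rw [← this]
    exact h1

/-- A map with a local differentiable section through a point is submersive there. -/
lemma mfderiv_surjective_of_section {EM HM EN HN : Type*} [NormedAddCommGroup EM]
    [NormedSpace ℂ EM] [TopologicalSpace HM] [NormedAddCommGroup EN] [NormedSpace ℂ EN]
    [TopologicalSpace HN] {I : ModelWithCorners ℂ EM HM} {J : ModelWithCorners ℂ EN HN}
    {M N : Type*} [TopologicalSpace M] [ChartedSpace HM M] [TopologicalSpace N]
    [ChartedSpace HN N] {f : M → N} {σ : N → M} {p : M}
    (hf : MDifferentiableAt I J f p) (hσ : MDifferentiableAt J I σ (f p)) (hp : σ (f p) = p)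
    (h : ∀ᶠ y in 𝓝 (f p), f (σ y) = y) : Function.Surjective (mfderiv I J f p) := by
  have h1 : mfderiv J J (f ∘ σ) (f p) = ContinuousLinearMap.id ℂ _ := by
    have h2 : (f ∘ σ) =ᶠ[𝓝 (f p)] id := h
    rw [h2.mfderiv_eq, mfderiv_id]
  intro v
  refine ⟨mfderiv J I σ (f p) v, ?_⟩
  rw [← mfderiv_comp_apply_of_eq (f p) hf hσ hp, h1]
  rfl

end Analysis

/-! ### The fibres of a twistor group -/

/-- The fibre of a twistor group, a group. -/
def Fibre (G : TwistorGroup.{u}) (x : CP1) : Type u := {g : G.carrier // G.proj g = x}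

variable {G : TwistorGroup.{u}} {H : ClosedTwistorSubgroup G}

/-- An element of the total space as an element of its fibre. -/
def Fibre.of {x : CP1} (g : G.carrier) (h : G.proj g = x) : Fibre G x := ⟨g, h⟩

/-- `G.mul` is defined on all pairs but obeys the group laws only within a fibre. Passing to fibres
gives honest groups, where coset and normalizer computations can use ordinary group theory. -/
instance (x : CP1) : Group (Fibre G x) where
  mul a b := ⟨G.mul a.1 b.1, by rw [G.proj_mul _ _ (a.2.trans b.2.symm), a.2]⟩
  one := ⟨G.one x, G.proj_one x⟩
  inv a := ⟨G.inv a.1, by rw [G.proj_inv, a.2]⟩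
  mul_assoc a b c := Subtype.ext (G.mul_assoc _ _ _ (a.2.trans b.2.symm) (b.2.trans c.2.symm))
  one_mul a := Subtype.ext (by
    have := G.one_mul a.1
    rwa [a.2] at this)
  mul_one a := Subtype.ext (by
    have := G.mul_one a.1
    rwa [a.2] at this)
  inv_mul_cancel a := Subtype.ext (by
    have := G.inv_mul a.1
    rwa [a.2] at this)

/-- The real structure as a homomorphism between fibres. -/
def Fibre.τ {x : CP1} : Fibre G x →* Fibre G (antipode x) where
  toFun a := ⟨G.τ a.1, by rw [G.proj_τ, a.2]⟩
  map_one' := Subtype.ext (G.τ_one x)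
  map_mul' a b := Subtype.ext (G.τ_mul _ _ (a.2.trans b.2.symm))

variable (H) in
/-- The fibre of a closed twistor subgroup. -/
def ClosedTwistorSubgroup.fibre (x : CP1) : Subgroup (Fibre G x) where
  carrier := {a | a.1 ∈ H.carrier}
  mul_mem' {a b} ha hb := H.mul_mem _ _ (a.2.trans b.2.symm) ha hb
  one_mem' := H.one_mem x
  inv_mem' ha := H.inv_mem _ ha

lemma mem_normalizer_fibre {x : CP1} {a : Fibre G x} :
    a.1 ∈ normalizer H ↔ a ∈ Subgroup.normalizer (H.fibre x : Set (Fibre G x)) := by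
  rw [Subgroup.mem_normalizer_iff]
  exact ⟨fun h b => h b.1 (b.2.trans a.2.symm), fun h b hb => h ⟨b, hb.trans a.2⟩⟩

/-- The coset of an element of a fibre. -/
def Fibre.mk (H : ClosedTwistorSubgroup G) {x : CP1} (a : Fibre G x) : Coset H :=
  Coset.mk H a.1

lemma Fibre.mk_eq_mk {x : CP1} {a b : Fibre G x} : a.mk H = b.mk H ↔ a⁻¹ * b ∈ H.fibre x :=
  Coset.mk_eq_mk.trans ⟨fun h => h.2, fun h => ⟨a.2.trans b.2.symm, h⟩⟩

lemma Fibre.proj_mk {x : CP1} (a : Fibre G x) : (a.mk H).proj = x := a.2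

lemma Coset.exists_fibre {x : CP1} {y : Coset H} (hy : y.proj = x) :
    ∃ a : Fibre G x, a.mk H = y :=
  ⟨⟨y.rep, (Coset.proj_rep y).trans hy⟩, Coset.mk_rep y⟩

lemma Fibre.act_mk {x : CP1} (g a : Fibre G x) : Coset.act g.1 (a.mk H) = (g * a).mk H :=
  Coset.act_mk (g.2.trans a.2.symm)

lemma Fibre.nmul_mk {x : CP1} (a : Fibre G x) {b : Fibre G x} (hb : b.1 ∈ normalizer H) :
    nmul (a.mk H) (b.mk H) = (a * b).mk H :=
  Twistor.nmul_mk (a.2.trans b.2.symm) hb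

/-- Since `H ⊆ N(H)`, a coset with one representative in the normalizer has all of them there. -/
lemma Fibre.mk_mem_iff {x : CP1} {b : Fibre G x} :
    b.mk H ∈ normalizerQuotient H ↔ b.1 ∈ normalizer H := by
  constructor
  · rintro ⟨c, hc, hcb⟩
    have hp : G.proj c = x := by
      rw [← Coset.proj_mk (H := H), hcb]; exact Fibre.proj_mk b
    have e : (Fibre.of c hp)⁻¹ * b ∈ H.fibre x :=
      Fibre.mk_eq_mk (a := Fibre.of c hp).1 hcb
    have hc' := mem_normalizer_fibre (H := H) (a := (Fibre.of c hp)).1 hc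
    rw [mem_normalizer_fibre]
    have := mul_mem hc' (Subgroup.le_normalizer e)
    rwa [mul_inv_cancel_left] at this
  · exact fun h => ⟨b.1, h, rfl⟩

lemma exists_fibre_normalizer {x : CP1} {s : Coset H} (hs : s.proj = x)
    (hn : s ∈ normalizerQuotient H) :
    ∃ b : Fibre G x, b.1 ∈ normalizer H ∧ b.mk H = s := by
  obtain ⟨b, rfl⟩ := Coset.exists_fibre hs
  exact ⟨b, Fibre.mk_mem_iff.1 hn, rfl⟩

/-! ### The trivial coset and multiplication by sections of `N(H)/H` -/

variable (H) in
/-- The trivial coset in a fibre. -/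
def Coset.one (x : CP1) : Coset H := Coset.mk H (G.one x)

lemma Fibre.mk_one (x : CP1) : (1 : Fibre G x).mk H = Coset.one H x := rfl

lemma Coset.proj_one (x : CP1) : (Coset.one H x).proj = x := G.proj_one x

lemma Coset.one_mem (x : CP1) : Coset.one H x ∈ normalizerQuotient H := by
  rw [← Fibre.mk_one, Fibre.mk_mem_iff, mem_normalizer_fibre]
  exact Subgroup.one_mem _

lemma Coset.proj_act {g : G.carrier} {y : Coset H} (h : G.proj g = y.proj) :
    (Coset.act g y).proj = y.proj := by
  obtain ⟨x, hx⟩ : ∃ x, y.proj = x := ⟨_, rfl⟩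
  rw [hx] at h ⊢
  obtain ⟨a, rfl⟩ := Coset.exists_fibre hx
  exact (congrArg Coset.proj (Fibre.act_mk (Fibre.of g h) a)).trans (Fibre.proj_mk _)

lemma Coset.one_act (y : Coset H) : Coset.act (G.one y.proj) y = y := by
  obtain ⟨x, hx⟩ : ∃ x, y.proj = x := ⟨_, rfl⟩
  obtain ⟨a, ha⟩ := Coset.exists_fibre hx
  have := Fibre.act_mk (H := H) 1 a
  rwa [_root_.one_mul, ha, ← hx] at this

lemma Coset.mul_act {g h : G.carrier} {y : Coset H} (hgh : G.proj g = G.proj h)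
    (hy : G.proj h = y.proj) :
    Coset.act (G.mul g h) y = Coset.act g (Coset.act h y) := by
  obtain ⟨a, ha⟩ := Coset.exists_fibre hy.symm
  have e1 := Fibre.act_mk (H := H) ((Fibre.of g hgh) * (Fibre.of h rfl)) a
  have e2 := Fibre.act_mk (H := H) (Fibre.of h rfl) a
  have e3 := Fibre.act_mk (H := H) (Fibre.of g hgh) ((Fibre.of h rfl) * a)
  rw [_root_.mul_assoc, ← e3, ← e2, ha] at e1
  exact e1

lemma Coset.exists_act_eq {y z : Coset H} (h : y.proj = z.proj) :
    ∃ g, G.proj g = y.proj ∧ Coset.act g y = z := by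
  obtain ⟨x, hx⟩ : ∃ x, y.proj = x := ⟨_, rfl⟩
  rw [hx] at h ⊢
  obtain ⟨a, rfl⟩ := Coset.exists_fibre hx
  obtain ⟨b, rfl⟩ := Coset.exists_fibre h.symm
  refine ⟨(b * a⁻¹).1, (b * a⁻¹).2, ?_⟩
  have := Fibre.act_mk (H := H) (b * a⁻¹) a
  rwa [inv_mul_cancel_right] at this

lemma Coset.exists_act_one {x : CP1} {y : Coset H} (h : y.proj = x) :
    ∃ g, G.proj g = x ∧ Coset.act g (Coset.one H x) = y := by
  obtain ⟨g, hg, e⟩ := Coset.exists_act_eq ((Coset.proj_one x).trans h.symm)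
  exact ⟨g, hg.trans (Coset.proj_one x), e⟩

lemma Coset.proj_nmul {y s : Coset H} (h : y.proj = s.proj) : (nmul y s).proj = y.proj := by
  unfold nmul
  rw [Coset.proj_mk, G.proj_mul _ _ (by rw [Coset.proj_rep, Coset.proj_rep, h]), Coset.proj_rep]

/-- Associativity in the fibre: left translations commute with right multiplication by `N(H)/H`.
Here `y` is an arbitrary coset; only `s` has to normalize. -/
lemma Coset.act_nmul {g : G.carrier} {y s : Coset H} (hg : G.proj g = y.proj)
    (hs : y.proj = s.proj) (hn : s ∈ normalizerQuotient H) :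
    Coset.act g (nmul y s) = nmul (Coset.act g y) s := by
  obtain ⟨x, hx⟩ : ∃ x, y.proj = x := ⟨_, rfl⟩
  rw [hx] at hg hs
  obtain ⟨a, rfl⟩ := Coset.exists_fibre hx
  obtain ⟨b, hb, rfl⟩ := exists_fibre_normalizer hs.symm hn
  obtain ⟨c, rfl⟩ : ∃ c : Fibre G x, c.1 = g := ⟨⟨g, hg⟩, rfl⟩
  rw [Fibre.nmul_mk a hb, Fibre.act_mk, Fibre.act_mk, Fibre.nmul_mk _ hb, _root_.mul_assoc]

lemma Coset.nmul_assoc {y s t : Coset H} (hs : y.proj = s.proj) (ht : y.proj = t.proj)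
    (hns : s ∈ normalizerQuotient H) (hnt : t ∈ normalizerQuotient H) :
    nmul (nmul y s) t = nmul y (nmul s t) := by
  obtain ⟨x, hx⟩ : ∃ x, y.proj = x := ⟨_, rfl⟩
  rw [hx] at ht hs
  obtain ⟨a, rfl⟩ := Coset.exists_fibre hx
  obtain ⟨b, hb, rfl⟩ := exists_fibre_normalizer hs.symm hns
  obtain ⟨c, hc, rfl⟩ := exists_fibre_normalizer ht.symm hnt
  have hbc : (b * c).1 ∈ normalizer H := by
    rw [mem_normalizer_fibre] at *; exact mul_mem hb hc
  rw [Fibre.nmul_mk a hb, Fibre.nmul_mk _ hc, Fibre.nmul_mk _ hc, Fibre.nmul_mk _ hbc,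
    _root_.mul_assoc]

lemma Coset.nmul_one {x : CP1} {y : Coset H} (h : y.proj = x) : nmul y (Coset.one H x) = y := by
  obtain ⟨a, rfl⟩ := Coset.exists_fibre h
  rw [← Fibre.mk_one, Fibre.nmul_mk _ (Fibre.mk_mem_iff.1 (Coset.one_mem x)), _root_.mul_one]

lemma Coset.one_nmul {x : CP1} {s : Coset H} (h : s.proj = x) (hn : s ∈ normalizerQuotient H) :
    nmul (Coset.one H x) s = s := by
  obtain ⟨b, hb, rfl⟩ := exists_fibre_normalizer h hn
  rw [← Fibre.mk_one, Fibre.nmul_mk _ hb, _root_.one_mul]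

/-- An idempotent of `N(H)/H` is trivial. -/
lemma Coset.eq_one_of_nmul_self {x : CP1} {s : Coset H} (h : s.proj = x)
    (hn : s ∈ normalizerQuotient H) (hs : s = nmul s s) : s = Coset.one H x := by
  obtain ⟨b, hb, rfl⟩ := exists_fibre_normalizer h hn
  rw [Fibre.nmul_mk _ hb, Fibre.mk_eq_mk, inv_mul_cancel_left] at hs
  rw [← Fibre.mk_one, Fibre.mk_eq_mk, _root_.mul_one]
  exact inv_mem hs

/-- The inverse in `N(H)/H`. -/
def ninv (s : Coset H) : Coset H := Coset.mk H (G.inv s.rep)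

lemma Coset.proj_ninv (s : Coset H) : (ninv s).proj = s.proj := by
  unfold ninv
  rw [Coset.proj_mk, G.proj_inv, Coset.proj_rep]

/-- For another representative `c`, the element `c b⁻¹` is the conjugate by `b` of `b⁻¹ c ∈ H`, so
inversion is independent of representatives on `N(H)/H`. -/
lemma Fibre.ninv_mk {x : CP1} {b : Fibre G x} (hb : b.1 ∈ normalizer H) :
    ninv (b.mk H) = (b⁻¹).mk H := by
  have hp : G.proj (b.mk H).rep = x := (Coset.proj_rep _).trans (Fibre.proj_mk b)
  let c : Fibre G x := ⟨(b.mk H).rep, hp⟩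
  have hc : c.mk H = b.mk H := Coset.mk_rep _
  change (c⁻¹).mk H = _
  have hcb := Fibre.mk_eq_mk.1 hc.symm
  rw [Fibre.mk_eq_mk, inv_inv]
  rw [mem_normalizer_fibre, Subgroup.mem_normalizer_iff] at hb
  have := (hb _).1 hcb
  rwa [mul_inv_cancel_left] at this

lemma Coset.ninv_mem {s : Coset H} (hn : s ∈ normalizerQuotient H) :
    ninv s ∈ normalizerQuotient H := by
  obtain ⟨b, hb, hbs⟩ := exists_fibre_normalizer rfl hn
  rw [← hbs, Fibre.ninv_mk hb, Fibre.mk_mem_iff]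
  rw [mem_normalizer_fibre] at *
  exact inv_mem hb

lemma Coset.nmul_ninv {x : CP1} {s : Coset H} (h : s.proj = x) (hn : s ∈ normalizerQuotient H) :
    nmul s (ninv s) = Coset.one H x := by
  have hi := Coset.ninv_mem hn
  obtain ⟨b, hb, rfl⟩ := exists_fibre_normalizer h hn
  rw [Fibre.ninv_mk hb, Fibre.mk_mem_iff] at hi
  rw [Fibre.ninv_mk hb, Fibre.nmul_mk _ hi, mul_inv_cancel, Fibre.mk_one]

lemma Coset.ninv_nmul {x : CP1} {s : Coset H} (h : s.proj = x) (hn : s ∈ normalizerQuotient H) :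
    nmul (ninv s) s = Coset.one H x := by
  obtain ⟨b, hb, rfl⟩ := exists_fibre_normalizer h hn
  rw [Fibre.ninv_mk hb, Fibre.nmul_mk _ hb, inv_mul_cancel, Fibre.mk_one]

lemma Coset.nmul_nmul_ninv {y s : Coset H} (h : y.proj = s.proj) (hn : s ∈ normalizerQuotient H) :
    nmul (nmul y s) (ninv s) = y := by
  rw [Coset.nmul_assoc h (h.trans (Coset.proj_ninv s).symm) hn (Coset.ninv_mem hn),
    Coset.nmul_ninv rfl hn, Coset.nmul_one h]

lemma Coset.nmul_ninv_nmul {y s : Coset H} (h : y.proj = s.proj) (hn : s ∈ normalizerQuotient H) :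
    nmul (nmul y (ninv s)) s = y := by
  rw [Coset.nmul_assoc (h.trans (Coset.proj_ninv s).symm) h (Coset.ninv_mem hn) hn,
    Coset.ninv_nmul rfl hn, Coset.nmul_one h]

/-! ### The real structure of the quotient -/

lemma Fibre.τ_mk {x : CP1} (a : Fibre G x) : (a.mk H).τ = (Fibre.τ a).mk H := Coset.τ_mk _

lemma Coset.τ_τ (y : Coset H) : y.τ.τ = y := by
  rw [← Coset.mk_rep y, Coset.τ_mk, Coset.τ_mk, G.τ_τ]

lemma Coset.proj_τ (y : Coset H) : y.τ.proj = antipode y.proj := by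
  rw [← Coset.mk_rep y, Coset.τ_mk, Coset.proj_mk, G.proj_τ, Coset.proj_mk]

lemma Coset.τ_one (x : CP1) : (Coset.one H x).τ = Coset.one H (antipode x) := by
  unfold Coset.one; rw [Coset.τ_mk, G.τ_one]

lemma Coset.τ_act {g : G.carrier} {y : Coset H} (h : G.proj g = y.proj) :
    (Coset.act g y).τ = Coset.act (G.τ g) y.τ := by
  obtain ⟨x, hx⟩ : ∃ x, y.proj = x := ⟨_, rfl⟩
  rw [hx] at h
  obtain ⟨a, rfl⟩ := Coset.exists_fibre hx
  have e := Fibre.act_mk (H := H) (Fibre.τ (Fibre.of g h)) (Fibre.τ a)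
  rw [show Coset.act g (a.mk H) = _ from Fibre.act_mk (Fibre.of g h) a, Fibre.τ_mk, Fibre.τ_mk, map_mul]
  exact e.symm

lemma τ_mem_iff {g : G.carrier} : G.τ g ∈ H.carrier ↔ g ∈ H.carrier :=
  ⟨fun h => by simpa [G.τ_τ] using H.τ_mem _ h, H.τ_mem g⟩

lemma τ_mem_normalizer {g : G.carrier} (hg : g ∈ normalizer H) : G.τ g ∈ normalizer H := by
  intro h hh
  have hp : G.proj (G.τ h) = G.proj g := by rw [G.proj_τ, hh, G.proj_τ, antipode_antipode]
  rw [← τ_mem_iff, hg _ hp, ← τ_mem_iff, G.τ_mul, G.τ_mul, G.τ_inv, G.τ_τ]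
  · exact hp.symm
  · rw [G.proj_mul _ _ hp.symm, G.proj_inv]

lemma Coset.τ_mem {s : Coset H} (hn : s ∈ normalizerQuotient H) : s.τ ∈ normalizerQuotient H := by
  obtain ⟨b, hb, rfl⟩ := hn
  exact ⟨G.τ b, τ_mem_normalizer hb, rfl⟩

lemma Coset.τ_nmul {y s : Coset H} (h : y.proj = s.proj) (hn : s ∈ normalizerQuotient H) :
    (nmul y s).τ = nmul y.τ s.τ := by
  obtain ⟨x, hx⟩ : ∃ x, y.proj = x := ⟨_, rfl⟩
  rw [hx] at h
  obtain ⟨a, rfl⟩ := Coset.exists_fibre hx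
  obtain ⟨b, hb, rfl⟩ := exists_fibre_normalizer h.symm hn
  have hb' : (Fibre.τ b).1 ∈ normalizer H := τ_mem_normalizer hb
  rw [Fibre.nmul_mk a hb, Fibre.τ_mk, Fibre.τ_mk, Fibre.τ_mk, Fibre.nmul_mk _ hb', map_mul]

/-- A fibrewise equivariant bijection of `G/H` with inverse is the right multiplication by its
value at the trivial coset, which lies in `N(H)/H`. -/
lemma Coset.equivariant_mem {x : CP1} {β β' : Coset H → Coset H}
    (hβ : ∀ y, y.proj = x → (β y).proj = x) 
    (hact : ∀ g y, G.proj g = x → y.proj = x → β (Coset.act g y) = Coset.act g (β y))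
    (hact' : ∀ g y, G.proj g = x → y.proj = x → β' (Coset.act g y) = Coset.act g (β' y))
    (hl : ∀ y, y.proj = x → β' (β y) = y) :
    β (Coset.one H x) ∈ normalizerQuotient H := by
  have h1 := Coset.proj_one (H := H) x
  obtain ⟨b, hb⟩ := Coset.exists_fibre (hβ _ h1)
  -- Compare stabilizers: `a` fixes the trivial coset iff `a ∈ H`, and fixes `bH` iff `b⁻¹ a b ∈ H`.
  -- The maps `β` and `β'` show that the two stabilizers agree, which says that `b⁻¹` normalizes.
  rw [← hb, Fibre.mk_mem_iff, mem_normalizer_fibre, ← inv_mem_iff, Subgroup.mem_normalizer_iff]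
  intro a
  have e1 : a ∈ H.fibre x ↔ Coset.act a.1 (Coset.one H x) = Coset.one H x := by
    rw [← Fibre.mk_one, Fibre.act_mk, eq_comm, Fibre.mk_eq_mk]; simp
  have e2 : b⁻¹ * a * (b⁻¹)⁻¹ ∈ H.fibre x ↔ Coset.act a.1 (b.mk H) = b.mk H := by
    rw [Fibre.act_mk, eq_comm, Fibre.mk_eq_mk, inv_inv, _root_.mul_assoc]
  rw [e1, e2, hb]
  constructor
  · intro h
    rw [← hact _ _ a.2 h1, h]
  · intro h
    have := congrArg β' h
    rwa [hact' _ _ a.2 (hβ _ h1), hl _ h1] at this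

/-- Every coset of the fibre is `g` applied to the trivial one, and both `β` and the right
multiplication commute with `g`. -/
lemma Coset.equivariant_eq {x : CP1} {β : Coset H → Coset H}
    (hβ : ∀ y, y.proj = x → (β y).proj = x)
    (hact : ∀ g y, G.proj g = x → y.proj = x → β (Coset.act g y) = Coset.act g (β y))
    (hn : β (Coset.one H x) ∈ normalizerQuotient H) {y : Coset H} (hy : y.proj = x) :
    β y = nmul y (β (Coset.one H x)) := by
  have h1 := Coset.proj_one (H := H) x
  obtain ⟨g, hg, rfl⟩ := Coset.exists_act_one hy
  rw [hact _ _ hg h1, ← Coset.act_nmul (hg.trans h1.symm) (h1.trans (hβ _ h1).symm) hn,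
    Coset.one_nmul (hβ _ h1) hn]

/-- The model of a smooth space. -/
abbrev RealSpace.I (Z : RealSpace.{u}) : ModelWithCorners ℂ (Fin Z.dim → ℂ) (Fin Z.dim → ℂ) :=
  𝓘(ℂ, Fin Z.dim → ℂ)

/-! ### Germs of holomorphic maps to a twistor group -/

section Germs

variable {E HX X : Type*} [NormedAddCommGroup E] [NormedSpace ℂ E] [TopologicalSpace HX]
  {I : ModelWithCorners ℂ E HX} [TopologicalSpace X] [ChartedSpace HX X]

/-- Multiplication is holomorphic only within the fibre product, so the set `s` has to be mapped
into it. -/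
lemma contMDiffWithinAt_mul {f g : X → G.carrier} {s : Set X} {x : X}
    (hf : ContMDiffWithinAt I G.I ω f s x) (hg : ContMDiffWithinAt I G.I ω g s x)
    (h : ∀ y ∈ s, G.proj (f y) = G.proj (g y)) (hx : G.proj (f x) = G.proj (g x)) :
    ContMDiffWithinAt I G.I ω (fun y => G.mul (f y) (g y)) s x :=
  ContMDiffWithinAt.comp (I' := G.I.prod G.I) x (G.mul_hol (f x, g x) hx)
    (hf.prodMk hg) (fun y hy => h y hy)

lemma contMDiffAt_mul {f g : X → G.carrier} {x : X}
    (hf : ContMDiffAt I G.I ω f x) (hg : ContMDiffAt I G.I ω g x)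
    (h : ∀ᶠ y in 𝓝 x, G.proj (f y) = G.proj (g y)) :
    ContMDiffAt I G.I ω (fun y => G.mul (f y) (g y)) x := by
  refine ContMDiffWithinAt.contMDiffAt (s := {y | G.proj (f y) = G.proj (g y)}) ?_ h
  exact contMDiffWithinAt_mul hf.contMDiffWithinAt hg.contMDiffWithinAt (fun y hy => hy)
    h.self_of_nhds

lemma contMDiffAt_inv {f : X → G.carrier} {x : X} (hf : ContMDiffAt I G.I ω f x) :
    ContMDiffAt I G.I ω (fun y => G.inv (f y)) x :=
  G.inv_hol.contMDiffAt.comp x hf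

lemma contMDiffAt_proj {f : X → G.carrier} {x : X} (hf : ContMDiffAt I G.I ω f x) :
    ContMDiffAt I 𝓘(ℂ) ω (fun y => G.proj (f y)) x :=
  G.proj_hol.contMDiffAt.comp x hf

end Germs

/-! ### Local holomorphic sections of `G` and `H`. -/

lemma RealSpace.exists_section {Z : RealSpace.{u}} (z : Z.carrier) :
    ∃ γ : CP1 → Z.carrier, ContMDiffAt 𝓘(ℂ) Z.I ω γ (Z.proj z) ∧ γ (Z.proj z) = z ∧
      ∀ᶠ x in 𝓝 (Z.proj z), Z.proj (γ x) = x :=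
  exists_contMDiffAt_rightInverse Z.proj_hol.contMDiffAt (Z.proj_submersion z)

lemma RealSpace.continuous_proj (Z : RealSpace.{u}) : Continuous Z.proj := Z.proj_hol.continuous

/-- Any twistor group supplies the continuity, as the antipodal map is `proj ∘ τ ∘ one`. -/
lemma continuous_antipode (G : TwistorGroup.{u}) : Continuous antipode := by
  have : antipode = fun x => G.proj (G.τ (G.one x)) := by
    funext x; rw [G.τ_one, G.proj_one]
  rw [this]
  exact G.continuous_proj.comp (G.τ_antihol.1.comp G.one_hol.continuous)

/-- Near a point of `H`, the map `(proj, F)` to the base and to the normal directions has a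
holomorphic right inverse. -/
lemma ClosedTwistorSubgroup.exists_transversal {h : G.carrier} (hh : h ∈ H.carrier) :
    ∃ (F : G.carrier → (Fin H.codim → ℂ)) (S : CP1 × (Fin H.codim → ℂ) → G.carrier),
      ContMDiffAt G.I 𝓘(ℂ, Fin H.codim → ℂ) ω F h ∧
      (∀ᶠ g in 𝓝 h, g ∈ H.carrier ↔ F g = 0) ∧
      ContMDiffAt (𝓘(ℂ).prod 𝓘(ℂ, Fin H.codim → ℂ)) G.I ω S (G.proj h, 0) ∧
      S (G.proj h, 0) = h ∧
      (∀ᶠ b in 𝓝 (G.proj h, (0 : Fin H.codim → ℂ)), G.proj (S b) = b.1) ∧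
      ∀ᶠ b in 𝓝 (G.proj h, (0 : Fin H.codim → ℂ)), F (S b) = b.2 := by
  obtain ⟨V, F, hV, hhV, hF, hVF, hs⟩ := H.smooth h hh
  have hFh : ContMDiffAt G.I 𝓘(ℂ, Fin H.codim → ℂ) ω F h := hF.contMDiffAt (hV.mem_nhds hhV)
  have hF0 : F h = 0 := (hVF h hhV).1 hh
  have hp : ContMDiffAt G.I (𝓘(ℂ).prod 𝓘(ℂ, Fin H.codim → ℂ)) ω (fun g => (G.proj g, F g)) h :=
    G.proj_hol.contMDiffAt.prodMk hFh
  have hsurj : Function.Surjective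
      (mfderiv G.I (𝓘(ℂ).prod 𝓘(ℂ, Fin H.codim → ℂ)) (fun g => (G.proj g, F g)) h) := by
    rw [mfderiv_prodMk (G.proj_hol.contMDiffAt.mdifferentiableAt (by simp))
      (hFh.mdifferentiableAt (by simp))]
    exact hs
  obtain ⟨S, hS, hSh, hr⟩ := exists_contMDiffAt_rightInverse hp hsurj
  simp only [hF0] at hS hSh hr
  refine ⟨F, S, hFh, ?_, hS, hSh, ?_, ?_⟩
  · filter_upwards [hV.mem_nhds hhV] with g hg using hVF g hg
  · filter_upwards [hr] with b hb using congrArg Prod.fst hb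
  · filter_upwards [hr] with b hb using congrArg Prod.snd hb

/-- Local holomorphic sections of a closed twistor subgroup. -/
lemma ClosedTwistorSubgroup.exists_section {h : G.carrier} (hh : h ∈ H.carrier) :
    ∃ η : CP1 → G.carrier, ContMDiffAt 𝓘(ℂ) G.I ω η (G.proj h) ∧ η (G.proj h) = h ∧
      ∀ᶠ x in 𝓝 (G.proj h), G.proj (η x) = x ∧ η x ∈ H.carrier := by
  obtain ⟨F, S, -, hF, hS, hSh, h1, h2⟩ := H.exists_transversal hh
  -- The section is the part of the transversal with zero normal coordinate, where the equations `F
  -- = 0` of `H` hold.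
  have hi : ContMDiffAt 𝓘(ℂ) (𝓘(ℂ).prod 𝓘(ℂ, Fin H.codim → ℂ)) ω
      (fun x : CP1 => (x, (0 : Fin H.codim → ℂ))) (G.proj h) :=
    contMDiffAt_id.prodMk contMDiffAt_const
  have hη : ContMDiffAt 𝓘(ℂ) G.I ω (fun x => S (x, 0)) (G.proj h) :=
    ContMDiffAt.comp (I' := 𝓘(ℂ).prod 𝓘(ℂ, Fin H.codim → ℂ)) (G.proj h) hS hi
  refine ⟨fun x => S (x, 0), hη, hSh, ?_⟩
  have hF' : ∀ᶠ x in 𝓝 (G.proj h), S (x, 0) ∈ H.carrier ↔ F (S (x, 0)) = 0 := by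
    refine Filter.Tendsto.eventually (p := fun g => g ∈ H.carrier ↔ F g = 0) hη.continuousAt ?_
    simp only [hSh]
    exact hF
  filter_upwards [hF', hi.continuousAt.eventually h1, hi.continuousAt.eventually h2]
    with x h3 h4 h5
  exact ⟨h4, h3.2 h5⟩

/-- Two points of the same coset are related by a right translation by a local holomorphic section
of `H`. -/
lemma exists_translation {g₀ g₁ : G.carrier} (h : Coset.mk H g₀ = Coset.mk H g₁) :
    ∃ T : G.carrier → G.carrier, ContMDiffAt G.I G.I ω T g₀ ∧ T g₀ = g₁ ∧
      ∀ᶠ g in 𝓝 g₀, G.proj (T g) = G.proj g ∧ Coset.mk H (T g) = Coset.mk H g := by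
  obtain ⟨hp, hm⟩ := Coset.mk_eq_mk.1 h
  have hip : G.proj (G.inv g₀) = G.proj g₁ := (G.proj_inv g₀).trans hp
  have hpm : G.proj (G.mul (G.inv g₀) g₁) = G.proj g₀ := by
    rw [G.proj_mul _ _ hip, G.proj_inv]
  obtain ⟨η, hη, hη0, hηe⟩ := H.exists_section hm
  rw [hpm] at hη hη0 hηe
  have hη' : ContMDiffAt G.I G.I ω (fun g => η (G.proj g)) g₀ :=
    ContMDiffAt.comp g₀ hη G.proj_hol.contMDiffAt
  have he := G.continuous_proj.continuousAt.eventually hηe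
  refine ⟨fun g => G.mul g (η (G.proj g)), contMDiffAt_mul contMDiffAt_id hη' ?_, ?_, ?_⟩
  · filter_upwards [he] with g hg using hg.1.symm
  · simp only [hη0]
    rw [← G.mul_assoc _ _ _ (G.proj_inv g₀).symm hip, G.mul_inv, hp, G.one_mul]
  · filter_upwards [he] with g hg
    have hpg : G.proj (G.mul g (η (G.proj g))) = G.proj g := G.proj_mul _ _ hg.1.symm
    refine ⟨hpg, (Coset.mk_eq_mk.2 ⟨hpg.symm, ?_⟩).symm⟩
    have := G.one_mul (η (G.proj g))
    rw [hg.1] at this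
    rw [← G.mul_assoc _ _ _ (G.proj_inv g) hg.1.symm, G.inv_mul, this]
    exact hg.2

/-! ### The quotient topology of `G/H`. -/

lemma Coset.continuous_mk : Continuous (Coset.mk H) := continuous_quotient_mk'

lemma Coset.surjective_mk : Function.Surjective (Coset.mk H) := fun x => ⟨x.rep, x.mk_rep⟩

lemma Coset.isQuotientMap_mk : IsQuotientMap (Coset.mk H) := isQuotientMap_quotient_mk'

/-- If `g₀` is equivalent to a point of an open set `O`, a local right translation by a section of
`H` carries a neighbourhood of `g₀` into `O`; so the saturation of `O` is open. -/
lemma Coset.isOpenMap_mk : IsOpenMap (Coset.mk H) := by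
  intro O hO
  rw [← Coset.isQuotientMap_mk.isOpen_preimage, isOpen_iff_mem_nhds]
  rintro g₀ ⟨g₁, hg₁, hg⟩
  obtain ⟨T, hT, hT0, he⟩ := exists_translation hg.symm
  have h1 : ∀ᶠ g in 𝓝 g₀, T g ∈ O :=
    hT.continuousAt.eventually (hO.mem_nhds (by rwa [hT0]))
  filter_upwards [h1, he] with g hg1 hg2
  exact ⟨T g, hg1, hg2.2⟩

lemma Coset.isOpenQuotientMap_mk : IsOpenQuotientMap (Coset.mk H) :=
  ⟨Coset.surjective_mk, Coset.continuous_mk, Coset.isOpenMap_mk⟩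

lemma Coset.continuous_proj : Continuous (Coset.proj (H := H)) :=
  Coset.isQuotientMap_mk.continuous_iff.2 G.continuous_proj

/-- The quotient map is open, so it suffices that the relation is closed. It is the preimage of the
closed set `H` under `(g, g') ↦ g⁻¹ g'` on the closed fibre product. -/
instance : T2Space (Coset H) := by
  rw [t2Space_iff_of_isOpenQuotientMap Coset.isOpenQuotientMap_mk]
  have h1 : IsClosed (G.toRealSpace.fibreProd G.toRealSpace) :=
    isClosed_eq (G.continuous_proj.comp continuous_fst) (G.continuous_proj.comp continuous_snd)
  have h2 : ContinuousOn (fun p : G.carrier × G.carrier => G.mul (G.inv p.1) p.2)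
      (G.toRealSpace.fibreProd G.toRealSpace) := by
    refine G.mul_hol.continuousOn.comp
      ((G.inv_hol.continuous.comp continuous_fst).prodMk continuous_snd).continuousOn ?_
    intro p hp
    exact (G.proj_inv p.1).trans hp
  have h3 := h2.preimage_isClosed_of_isClosed h1 H.isClosed
  convert h3 using 1
  ext p
  exact Coset.mk_eq_mk

/-! ### Slices -/

/-- A slice through `g₀`, transversal to the coset of `g₀`. -/
lemma exists_slice (H : ClosedTwistorSubgroup G) (g₀ : G.carrier) :
    ∃ (S : CP1 × (Fin H.codim → ℂ) → G.carrier) (Y : G.carrier → (Fin H.codim → ℂ)),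
      ContMDiffAt (𝓘(ℂ).prod 𝓘(ℂ, Fin H.codim → ℂ)) G.I ω S (G.proj g₀, 0) ∧
      ContMDiffAt G.I 𝓘(ℂ, Fin H.codim → ℂ) ω Y g₀ ∧
      S (G.proj g₀, 0) = g₀ ∧ Y g₀ = 0 ∧
      (∀ᶠ b in 𝓝 (G.proj g₀, (0 : Fin H.codim → ℂ)), G.proj (S b) = b.1) ∧
      ∀ᶠ q in 𝓝 (g₀, (0 : Fin H.codim → ℂ)),
        Coset.mk H (S (G.proj q.1, q.2)) = Coset.mk H q.1 ↔ Y q.1 = q.2 := by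
  obtain ⟨x₀, hx₀⟩ : ∃ x, G.proj g₀ = x := ⟨_, rfl⟩
  -- A transversal to `H` at the identity is carried to `g₀` by left multiplication with a local
  -- section `γ` of `G` through `g₀`.
  obtain ⟨γ, hγ, hγ0, hγe⟩ := G.exists_section g₀
  obtain ⟨F, S, hF, hFe, hS, hS0, hSp, hSF⟩ := H.exists_transversal (H.one_mem x₀)
  rw [G.proj_one] at hS hS0 hSp hSF
  rw [hx₀] at hγ hγ0 hγe ⊢
  let J := 𝓘(ℂ).prod 𝓘(ℂ, Fin H.codim → ℂ)
  -- the translated slice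
  let S' : CP1 × (Fin H.codim → ℂ) → G.carrier := fun b => G.mul (γ b.1) (S b)
  have hγ1 : ContMDiffAt J G.I ω (fun b : CP1 × (Fin H.codim → ℂ) => γ b.1) (x₀, 0) :=
    ContMDiffAt.comp (I' := 𝓘(ℂ)) (x₀, (0 : Fin H.codim → ℂ)) (g := γ) hγ contMDiffAt_fst
  have hγe1 : ∀ᶠ b in 𝓝 (x₀, (0 : Fin H.codim → ℂ)), G.proj (γ b.1) = b.1 :=
    (continuousAt_fst (p := (x₀, (0 : Fin H.codim → ℂ)))).eventually hγe
  have hγS : ∀ᶠ b in 𝓝 (x₀, (0 : Fin H.codim → ℂ)), G.proj (γ b.1) = G.proj (S b) := by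
    filter_upwards [hγe1, hSp] with b h1 h2 using h1.trans h2.symm
  have hS' : ContMDiffAt J G.I ω S' (x₀, 0) := contMDiffAt_mul hγ1 hS hγS
  have hS'0 : S' (x₀, 0) = g₀ := by
    change G.mul (γ x₀) (S (x₀, 0)) = g₀
    rw [hS0, hγ0, ← hx₀, G.mul_one]
  have hS'p : ∀ᶠ b in 𝓝 (x₀, (0 : Fin H.codim → ℂ)), G.proj (S' b) = b.1 := by
    filter_upwards [hγe1, hγS] with b h1 h2 using (G.proj_mul _ _ h2).trans h1
  -- the equation for the coset
  let K := G.I.prod 𝓘(ℂ, Fin H.codim → ℂ)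
  let P : G.carrier × (Fin H.codim → ℂ) → G.carrier :=
    fun q => G.mul (G.inv q.1) (S' (G.proj q.1, q.2))
  have hb : ContMDiffAt K J ω
      (fun q : G.carrier × (Fin H.codim → ℂ) => (G.proj q.1, q.2)) (g₀, 0) :=
    (contMDiffAt_proj contMDiffAt_fst).prodMk contMDiffAt_snd
  have hb0 : (fun q : G.carrier × (Fin H.codim → ℂ) => (G.proj q.1, q.2)) (g₀, 0) = (x₀, 0) := by
    simp only [hx₀]
  have hbt : Filter.Tendsto (fun q : G.carrier × (Fin H.codim → ℂ) => (G.proj q.1, q.2))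
      (𝓝 (g₀, 0)) (𝓝 (x₀, 0)) := by
    have := hb.continuousAt.tendsto
    simp only [hx₀] at this
    exact this
  have hSq : ContMDiffAt K G.I ω
      (fun q : G.carrier × (Fin H.codim → ℂ) => S' (G.proj q.1, q.2)) (g₀, 0) :=
    ContMDiffAt.comp_of_eq hS' hb hb0
  have hPp : ∀ᶠ q in 𝓝 (g₀, (0 : Fin H.codim → ℂ)),
      G.proj (G.inv q.1) = G.proj (S' (G.proj q.1, q.2)) := by
    filter_upwards [hbt.eventually hS'p] with q hq
    rw [G.proj_inv]
    exact hq.symm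
  have hP : ContMDiffAt K G.I ω P (g₀, 0) :=
    contMDiffAt_mul (contMDiffAt_inv contMDiffAt_fst) hSq hPp
  have hP0 : P (g₀, 0) = G.one x₀ := by
    change G.mul (G.inv g₀) (S' (G.proj g₀, 0)) = _
    rw [hx₀, hS'0, G.inv_mul, hx₀]
  have hΘ : ContMDiffAt K 𝓘(ℂ, Fin H.codim → ℂ) ω (fun q => F (P q)) (g₀, 0) :=
    ContMDiffAt.comp_of_eq (I' := G.I) hF hP hP0
  -- At `g₀` the translation by `γ` cancels: `P (g₀, ·)` is the original transversal, on which `F`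
  -- is the normal coordinate. This is the normalisation used by `exists_implicit`.
  have hid : ∀ᶠ y in 𝓝 (0 : Fin H.codim → ℂ), F (P (g₀, y)) = y := by
    have ht : Filter.Tendsto (fun y : Fin H.codim → ℂ => (x₀, y)) (𝓝 0) (𝓝 (x₀, 0)) :=
      (Continuous.prodMk_right x₀).tendsto 0
    filter_upwards [ht.eventually hSF, ht.eventually hSp] with y hy hy'
    have : P (g₀, y) = S (x₀, y) := by
      change G.mul (G.inv g₀) (G.mul (γ (G.proj g₀)) (S (G.proj g₀, y))) = _
      rw [hx₀, hγ0, ← G.mul_assoc _ _ _ (G.proj_inv g₀) (hx₀.trans hy'.symm), G.inv_mul, hx₀]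
      have := G.one_mul (S (x₀, y))
      rwa [hy'] at this
    rw [this, hy]
  obtain ⟨Y, hY, hY0, hYe⟩ := exists_implicit hΘ hid
  refine ⟨S', Y, hS', hY, hS'0, hY0, hS'p, ?_⟩
  -- `P q ∈ H` says that the slice point lies in the coset of `q.1`, so the implicit function `Y`
  -- selects the slice point of each coset.
  have hFP : ∀ᶠ q in 𝓝 (g₀, (0 : Fin H.codim → ℂ)), P q ∈ H.carrier ↔ F (P q) = 0 := by
    refine Filter.Tendsto.eventually (p := fun g => g ∈ H.carrier ↔ F g = 0) hP.continuousAt ?_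
    rw [hP0]
    exact hFe
  filter_upwards [hYe, hFP, hPp] with q h1 h2 h3
  rw [← h1, ← h2, eq_comm, Coset.mk_eq_mk]
  rw [G.proj_inv] at h3
  exact ⟨fun h => h.2, fun h => ⟨h3, h⟩⟩

/-! ### The complex manifold `G/H` -/

variable (H) in
/-- The vector space on which `G/H` is modelled. -/
abbrev ClosedTwistorSubgroup.Model : Type := Fin (H.codim + 1) → ℂ

variable (H) in
/-- The model of `G/H`. -/
abbrev ClosedTwistorSubgroup.I : ModelWithCorners ℂ H.Model H.Model := 𝓘(ℂ, H.Model)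

/-- A slice in coordinates, with the projection to it along the cosets. -/
lemma exists_slice_coordinates (H : ClosedTwistorSubgroup G) (g₀ : G.carrier) :
    ∃ (S : H.Model → G.carrier) (Q : G.carrier → H.Model) (b₀ : H.Model),
      ContMDiffAt H.I G.I ω S b₀ ∧ ContMDiffAt G.I H.I ω Q g₀ ∧ S b₀ = g₀ ∧ Q g₀ = b₀ ∧
      (∀ᶠ g in 𝓝 g₀, Coset.mk H (S (Q g)) = Coset.mk H g) ∧
      ∀ᶠ q in 𝓝 (b₀, b₀), Coset.mk H (S q.1) = Coset.mk H (S q.2) → q.1 = q.2 := by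
  obtain ⟨S, Y, hS, hY, hS0, hY0, hSp, hSY⟩ := exists_slice H g₀
  let F := Fin H.codim → ℂ
  let J := 𝓘(ℂ).prod 𝓘(ℂ, F)
  -- Any linear isomorphism will do: one coordinate of the base and `codim` normal ones give the
  -- dimension `codim + 1`.
  let L : (ℂ × F) ≃L[ℂ] H.Model := ContinuousLinearEquiv.ofFinrankEq (by simp [F, add_comm])
  obtain ⟨x₀, hx₀⟩ : ∃ x, G.proj g₀ = x := ⟨_, rfl⟩
  rw [hx₀] at hS hS0 hSp
  let c := chartAt ℂ x₀
  let ψ : CP1 × F → H.Model := fun b => L (c b.1, b.2)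
  let ψ' : H.Model → CP1 × F := fun v => (c.symm (L.symm v).1, (L.symm v).2)
  let b₀ := ψ (x₀, 0)
  have hb₀ : ψ' b₀ = (x₀, 0) := by simp [b₀, ψ, ψ', c]
  have hψ : ContMDiffAt J H.I ω ψ (x₀, 0) := by
    have hc : ContMDiffAt 𝓘(ℂ) 𝓘(ℂ) ω c x₀ :=
      contMDiffOn_chart.contMDiffAt (c.open_source.mem_nhds (mem_chart_source ℂ x₀))
    have h1 : ContMDiffAt J 𝓘(ℂ, ℂ × F) ω (fun b : CP1 × F => (c b.1, b.2)) (x₀, 0) :=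
      ContMDiffAt.prodMk_space
        (ContMDiffAt.comp (I' := 𝓘(ℂ)) (x₀, (0 : F)) (g := c) hc contMDiffAt_fst) contMDiffAt_snd
    exact L.contDiff.contMDiff.contMDiffAt.comp (x₀, (0 : F)) h1
  have hψ' : ContMDiffAt H.I J ω ψ' b₀ := by
    have hL : ContMDiff H.I 𝓘(ℂ, ℂ × F) ω L.symm := L.symm.contDiff.contMDiff
    have h1 : ContMDiff H.I 𝓘(ℂ) ω (fun v => (L.symm v).1) :=
      (contDiff_fst.comp L.symm.contDiff).contMDiff
    have h2 : ContMDiff H.I 𝓘(ℂ, F) ω (fun v => (L.symm v).2) :=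
      (contDiff_snd.comp L.symm.contDiff).contMDiff
    have hc : ContMDiffAt 𝓘(ℂ) 𝓘(ℂ) ω c.symm (c x₀) :=
      contMDiffOn_chart_symm.contMDiffAt (c.open_target.mem_nhds (mem_chart_target ℂ x₀))
    refine ContMDiffAt.prodMk ?_ h2.contMDiffAt
    exact ContMDiffAt.comp_of_eq hc h1.contMDiffAt (by simp [b₀, ψ])
  have hψψ' : ∀ᶠ v in 𝓝 b₀, ψ (ψ' v) = v := by
    have h1 : ContinuousAt (fun v => (L.symm v).1) b₀ :=
      (continuous_fst.comp L.symm.continuous).continuousAt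
    have h2 : (L.symm b₀).1 = c x₀ := by simp [b₀, ψ]
    have h3 : ∀ᶠ v in 𝓝 b₀, (L.symm v).1 ∈ c.target := by
      refine h1.eventually (c.open_target.mem_nhds ?_)
      simp only [h2]; exact mem_chart_target ℂ x₀
    filter_upwards [h3] with v hv
    simp only [ψ, ψ', c.right_inv hv, Prod.mk.eta, L.apply_symm_apply]
  have hψ'ψ : ∀ᶠ b in 𝓝 (x₀, (0 : F)), ψ' (ψ b) = b := by
    have h3 : ∀ᶠ b in 𝓝 (x₀, (0 : F)), b.1 ∈ c.source :=
      (continuousAt_fst (p := (x₀, (0 : F)))).eventually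
        (c.open_source.mem_nhds (mem_chart_source ℂ x₀))
    filter_upwards [h3] with b hb
    simp only [ψ, ψ', L.symm_apply_apply, c.left_inv hb]
  have hQ₀ : ContMDiffAt G.I J ω (fun g => (G.proj g, Y g)) g₀ :=
    G.proj_hol.contMDiffAt.prodMk hY
  have hQ₀0 : (G.proj g₀, Y g₀) = (x₀, (0 : F)) := by rw [hx₀, hY0]
  have hQt : Filter.Tendsto (fun g => (G.proj g, Y g)) (𝓝 g₀) (𝓝 (x₀, 0)) := by
    rw [← hQ₀0]; exact hQ₀.continuousAt
  have hψ't : Filter.Tendsto ψ' (𝓝 b₀) (𝓝 (x₀, 0)) := by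
    have := hψ'.continuousAt.tendsto; rwa [hb₀] at this
  have hSt : Filter.Tendsto S (𝓝 (x₀, 0)) (𝓝 g₀) := by
    have := hS.continuousAt.tendsto; rwa [hS0] at this
  refine ⟨fun v => S (ψ' v), fun g => ψ (G.proj g, Y g), b₀, ContMDiffAt.comp_of_eq hS hψ' hb₀,
    ContMDiffAt.comp_of_eq (g := ψ) (f := fun g => (G.proj g, Y g)) hψ hQ₀ hQ₀0, by simp only [hb₀, hS0], by simp only [hQ₀0, b₀], ?_, ?_⟩
  · have h1 : Filter.Tendsto (fun g => (g, Y g)) (𝓝 g₀) (𝓝 (g₀, 0)) := by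
      have : ContinuousAt (fun g => (g, Y g)) g₀ := continuousAt_id.prodMk hY.continuousAt
      have := this.tendsto
      rwa [hY0] at this
    filter_upwards [h1.eventually hSY, hQt.eventually hψ'ψ] with g h2 h3
    rw [h3]
    exact h2.2 rfl
  · have hf : Filter.Tendsto (fun q : H.Model × H.Model => q.1) (𝓝 (b₀, b₀)) (𝓝 b₀) :=
      continuousAt_fst
    have hs : Filter.Tendsto (fun q : H.Model × H.Model => q.2) (𝓝 (b₀, b₀)) (𝓝 b₀) :=
      continuousAt_snd
    -- If two slice points lie in one coset, their base points agree, and `Y` at the first point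
    -- equals the normal coordinate of each of them.
    have h1 : Filter.Tendsto (fun q : H.Model × H.Model => (S (ψ' q.1), (ψ' q.2).2))
        (𝓝 (b₀, b₀)) (𝓝 (g₀, 0)) :=
      ((hSt.comp (hψ't.comp hf)).prodMk_nhds
        ((continuous_snd.tendsto (x₀, (0 : F))).comp (hψ't.comp hs)))
    have h2 : Filter.Tendsto (fun q : H.Model × H.Model => (S (ψ' q.1), (ψ' q.1).2))
        (𝓝 (b₀, b₀)) (𝓝 (g₀, 0)) :=
      ((hSt.comp (hψ't.comp hf)).prodMk_nhds
        ((continuous_snd.tendsto (x₀, (0 : F))).comp (hψ't.comp hf)))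
    filter_upwards [h1.eventually hSY, h2.eventually hSY, (hψ't.comp hf).eventually hSp,
      (hψ't.comp hs).eventually hSp, hf.eventually hψψ', hs.eventually hψψ']
      with q e1 e2 e3 e4 e5 e6 hq
    simp only [Function.comp] at e1 e2 e3 e4 e5 e6
    have hp : (ψ' q.1).1 = (ψ' q.2).1 := by
      rw [← e3, ← e4, ← Coset.proj_mk (H := H), hq, Coset.proj_mk]
    have hy1 : Y (S (ψ' q.1)) = (ψ' q.2).2 := e1.1 (by rw [e3, hp]; exact hq.symm)
    have hy2 : Y (S (ψ' q.1)) = (ψ' q.1).2 := e2.1 (by rw [e3])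
    rw [← e5, ← e6]
    exact congrArg ψ (Prod.ext hp (hy2.symm.trans hy1))

/-- The holomorphic charts of `G/H`: those which pull back to holomorphic maps on `G` and whose
inverses lift to holomorphic maps to `G`. -/
structure IsCosetChart (e : OpenPartialHomeomorph (Coset H) H.Model) : Prop where
  hol : ContMDiffOn G.I H.I ω (e ∘ Coset.mk H) (Coset.mk H ⁻¹' e.source)
  lift : ∃ S : H.Model → G.carrier, ContMDiffOn H.I G.I ω S e.target ∧
    ∀ b ∈ e.target, Coset.mk H (S b) = e.symm b

/-- Holomorphy of the pull-back of a map on `G/H` only depends on the coset. -/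
lemma contMDiffAt_comp_mk_of_mk_eq {E' HN N : Type*} [NormedAddCommGroup E'] [NormedSpace ℂ E']
    [TopologicalSpace HN] {I' : ModelWithCorners ℂ E' HN} [TopologicalSpace N]
    [ChartedSpace HN N] {f : Coset H → N} {g₀ g₁ : G.carrier} (h : Coset.mk H g₀ = Coset.mk H g₁)
    (hf : ContMDiffAt G.I I' ω (f ∘ Coset.mk H) g₁) :
    ContMDiffAt G.I I' ω (f ∘ Coset.mk H) g₀ := by
  obtain ⟨T, hT, hT0, he⟩ := exists_translation h
  refine (ContMDiffAt.comp_of_eq hf hT hT0).congr_of_eventuallyEq ?_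
  filter_upwards [he] with g hg
  simp only [Function.comp, hg.2]

/-- The inverse chart is `b ↦ mk (S b)` on a small slice. It is injective by transversality, and
open because `mk` is open and each `g` near the slice lies in the coset of `S (Q g)`. Near the slice
the chart pulls back to the holomorphic map `Q`. -/
lemma exists_isCosetChart (x : Coset H) :
    ∃ e : OpenPartialHomeomorph (Coset H) H.Model, IsCosetChart e ∧ x ∈ e.source := by
  obtain ⟨g₀, rfl⟩ := Coset.surjective_mk x
  obtain ⟨S, Q, b₀, hS, hQ, hS0, hQ0, hSQ, hinj⟩ := exists_slice_coordinates H g₀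
  -- The slice points of `Q (S b)` and `b` lie in the same coset, so local injectivity identifies
  -- the parameters.
  have hQS : ∀ᶠ b in 𝓝 b₀, Q (S b) = b := by
    have h1 : ContinuousAt (fun b => (Q (S b), b)) b₀ := by
      refine ContinuousAt.prodMk ?_ continuousAt_id
      refine ContinuousAt.comp (g := Q) ?_ hS.continuousAt
      rw [hS0]; exact hQ.continuousAt
    have h2 := h1.tendsto
    simp only [hS0, hQ0] at h2
    have h3 : Filter.Tendsto S (𝓝 b₀) (𝓝 g₀) := by
      have := hS.continuousAt.tendsto; rwa [hS0] at this
    filter_upwards [h2.eventually hinj, h3.eventually hSQ] with b h4 h5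
    exact h4 h5
  rw [contMDiffAt_iff_contMDiffAt_nhds (by simp)] at hS hQ
  obtain ⟨Ω, hΩ, hΩo, hgΩ⟩ := eventually_nhds_iff.1 (hQ.and hSQ)
  have hSc : ContinuousAt S b₀ := hS.self_of_nhds.continuousAt
  have hSΩ : ∀ᶠ b in 𝓝 b₀, S b ∈ Ω := hSc.eventually (hΩo.mem_nhds (by rwa [hS0]))
  obtain ⟨B₁, hB₁, hB₁o, hbB₁⟩ := eventually_nhds_iff.1 ((hS.and hQS).and hSΩ)
  rw [nhds_prod_eq] at hinj
  obtain ⟨B₂, hB₂, hB₂'⟩ := Filter.mem_prod_same_iff.1 hinj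
  obtain ⟨B₃, hB₃, hB₃o, hbB₃⟩ := mem_nhds_iff.1 hB₂
  let B := B₁ ∩ B₃
  have hBo : IsOpen B := hB₁o.inter hB₃o
  have hbB : b₀ ∈ B := ⟨hbB₁, hbB₃⟩
  have hinjB : InjOn (fun b => Coset.mk H (S b)) B := fun b hb b' hb' h =>
    hB₂' (mk_mem_prod (hB₃ hb.2) (hB₃ hb'.2)) h
  have hcont : ContinuousOn (fun b => Coset.mk H (S b)) B := fun b hb =>
    (Coset.continuous_mk.continuousAt.comp
      (hB₁ b hb.1).1.1.continuousAt).continuousWithinAt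
  have himg : ∀ O ⊆ B, IsOpen O → IsOpen ((fun b => Coset.mk H (S b)) '' O) := by
    intro O hOB hO
    rw [isOpen_iff_mem_nhds]
    rintro _ ⟨b, hb, rfl⟩
    have hb1 := hB₁ b (hOB hb).1
    have hb2 := hΩ _ hb1.2
    have h1 : ∀ᶠ g in 𝓝 (S b), Q g ∈ O :=
      hb2.1.continuousAt.eventually (hO.mem_nhds (by rwa [hb1.1.2]))
    have h2 : ∀ᶠ g in 𝓝 (S b), g ∈ Ω := hΩo.mem_nhds hb1.2
    refine Filter.mem_of_superset (Coset.isOpenMap_mk.image_mem_nhds (h1.and h2)) ?_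
    rintro _ ⟨g, ⟨hg1, hg2⟩, rfl⟩
    exact ⟨Q g, hg1, (hΩ g hg2).2⟩
  let e₀ : OpenPartialHomeomorph H.Model (Coset H) :=
    OpenPartialHomeomorph.ofContinuousOpenRestrict (hinjB.toPartialEquiv _ _) hcont (by
      intro O hO
      have : (hinjB.toPartialEquiv _ _).source.domRestrict (hinjB.toPartialEquiv _ _) '' O =
          (fun b => Coset.mk H (S b)) '' (Subtype.val '' O) := by
        rw [image_image]; rfl
      rw [this]
      refine himg _ ?_ (hBo.isOpenMap_subtype_val _ hO)
      rintro _ ⟨b, _, rfl⟩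
      exact b.2) hBo
  refine ⟨e₀.symm, ⟨?_, S, fun b hb => (hB₁ b hb.1).1.1.contMDiffWithinAt, fun b _ => rfl⟩,
    ⟨b₀, hbB, by simp only [hS0]⟩⟩
  intro g hg
  refine ContMDiffAt.contMDiffWithinAt ?_
  obtain ⟨b, hb, hbg⟩ := hg
  have hb1 := hB₁ b hb.1
  -- The source of the chart contains whole cosets, whereas `Q` is controlled only near the slice; a
  -- right translation moves the question to the slice point `S b`.
  refine contMDiffAt_comp_mk_of_mk_eq hbg.symm ?_
  have hb2 := hΩ _ hb1.2
  refine hb2.1.congr_of_eventuallyEq ?_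
  have h1 : ∀ᶠ g in 𝓝 (S b), Q g ∈ B :=
    hb2.1.continuousAt.eventually (hBo.mem_nhds (by rwa [hb1.1.2]))
  filter_upwards [h1, hΩo.mem_nhds hb1.2] with g hg1 hg2
  have : Coset.mk H g = e₀ (Q g) := (hΩ g hg2).2.symm
  simp only [Function.comp, this]
  exact e₀.left_inv hg1

instance : ChartedSpace H.Model (Coset H) where
  atlas := {e | IsCosetChart e}
  chartAt x := (exists_isCosetChart x).choose
  mem_chart_source x := (exists_isCosetChart x).choose_spec.2
  chart_mem_atlas x := (exists_isCosetChart x).choose_spec.1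

/-- A chart change is `(e' ∘ mk) ∘ S`, where `S` lifts the inverse of `e` to `G`. Both factors are
holomorphic, which is why `IsCosetChart` records a condition on the chart and one on its inverse. -/
instance : IsManifold H.I ω (Coset H) := by
  refine isManifold_of_contDiffOn _ _ _ fun e e' he he' => ?_
  simp only [modelWithCornersSelf_coe, modelWithCornersSelf_coe_symm, Function.id_comp,
    Function.comp_id, preimage_id, range_id, inter_univ]
  obtain ⟨S, hS, hSe⟩ := he.lift
  rw [← contMDiffOn_iff_contDiffOn]
  have hsub : (e.symm.trans e').source ⊆ e.target := fun b hb => by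
    rw [OpenPartialHomeomorph.trans_source] at hb; exact hb.1
  refine (he'.hol.comp (hS.mono hsub) ?_).congr ?_
  · intro b hb
    have hb2 := hb
    rw [OpenPartialHomeomorph.trans_source] at hb2
    change Coset.mk H (S b) ∈ e'.source
    rw [hSe b hb2.1]
    exact hb2.2
  · intro b hb
    change e' (e.symm b) = e' (Coset.mk H (S b))
    rw [hSe b (hsub hb)]

/-! ### Local lifts to `G` and the comparison of manifold and ringed space structures on `G/H`. -/

lemma Coset.isCosetChart_chartAt (x : Coset H) : IsCosetChart (chartAt H.Model x) :=
  chart_mem_atlas H.Model x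

lemma Coset.contMDiff_mk : ContMDiff G.I H.I ω (Coset.mk H) := by
  intro g
  rw [contMDiffAt_iff_target]
  refine ⟨Coset.continuous_mk.continuousAt, ?_⟩
  have h := (Coset.isCosetChart_chartAt (Coset.mk H g)).hol
  exact h.contMDiffAt (((chartAt H.Model (Coset.mk H g)).open_source.preimage
    Coset.continuous_mk).mem_nhds (mem_chart_source _ _))

lemma Coset.exists_lift (x : Coset H) : ∃ σ : Coset H → G.carrier,
    ContMDiffAt H.I G.I ω σ x ∧ ∀ᶠ y in 𝓝 x, Coset.mk H (σ y) = y := by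
  obtain ⟨S, hS, hSe⟩ := (Coset.isCosetChart_chartAt x).lift
  let e := chartAt H.Model x
  have he : ContMDiffAt H.I H.I ω e x :=
    contMDiffOn_chart.contMDiffAt (e.open_source.mem_nhds (mem_chart_source _ x))
  have hS' : ContMDiffAt H.I G.I ω S (e x) :=
    hS.contMDiffAt (e.open_target.mem_nhds (mem_chart_target _ x))
  refine ⟨fun y => S (e y), hS'.comp x he, ?_⟩
  filter_upwards [e.open_source.mem_nhds (mem_chart_source _ x)] with y hy
  rw [hSe _ (e.map_source hy), e.left_inv hy]

/-- A map on `G/H` is holomorphic if and only if its pull-back to `G` is. -/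
lemma Coset.contMDiffAt_iff {E' HN N : Type*} [NormedAddCommGroup E'] [NormedSpace ℂ E']
    [TopologicalSpace HN] {I' : ModelWithCorners ℂ E' HN} [TopologicalSpace N]
    [ChartedSpace HN N] {f : Coset H → N} {g : G.carrier} :
    ContMDiffAt H.I I' ω f (Coset.mk H g) ↔ ContMDiffAt G.I I' ω (f ∘ Coset.mk H) g := by
  refine ⟨fun h => h.comp g Coset.contMDiff_mk.contMDiffAt, fun h => ?_⟩
  obtain ⟨σ, hσ, hσe⟩ := Coset.exists_lift (Coset.mk H g)
  have h1 := contMDiffAt_comp_mk_of_mk_eq hσe.self_of_nhds h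
  refine (h1.comp _ hσ).congr_of_eventuallyEq ?_
  filter_upwards [hσe] with y hy
  simp only [Function.comp, hy]

lemma Coset.contMDiff_proj : ContMDiff H.I 𝓘(ℂ) ω (Coset.proj (H := H)) := by
  intro x
  obtain ⟨g, rfl⟩ := Coset.surjective_mk x
  exact Coset.contMDiffAt_iff.2 G.proj_hol.contMDiffAt

/-- The ringed space structure of `G/H` is that of a complex manifold. -/
lemma Coset.hol_iff {V : Set (Coset H)} (hV : IsOpen V) {φ : Coset H → ℂ} :
    Coset.hol H V φ ↔ ContMDiffOn H.I 𝓘(ℂ) ω φ V := by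
  constructor
  · intro h x hx
    obtain ⟨g, rfl⟩ := Coset.surjective_mk x
    refine (Coset.contMDiffAt_iff.2 ?_).contMDiffWithinAt
    exact ContMDiffOn.contMDiffAt h ((hV.preimage Coset.continuous_mk).mem_nhds hx)
  · intro h g hg
    refine (Coset.contMDiffAt_iff.1 ?_).contMDiffWithinAt
    exact h.contMDiffAt (hV.mem_nhds hg)

/-! ### Holomorphic and antiholomorphic maps in terms of functions -/

section Functions

variable {E : Type*} [NormedAddCommGroup E] [NormedSpace ℂ E]
  {X : Type*} [TopologicalSpace X] [ChartedSpace E X]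
  {n : ℕ} {Y : Type*} [TopologicalSpace Y] [ChartedSpace (Fin n → ℂ) Y]

lemma exists_contMDiffOn_of_contMDiffAt [IsManifold 𝓘(ℂ, E) ω X] {φ : X → ℂ} {x : X}
    (h : ContMDiffAt 𝓘(ℂ, E) 𝓘(ℂ) ω φ x) :
    ∃ V, IsOpen V ∧ x ∈ V ∧ ContMDiffOn 𝓘(ℂ, E) 𝓘(ℂ) ω φ V := by
  obtain ⟨u, hu, h⟩ := (contMDiffAt_iff_contMDiffOn_nhds (by simp)).1 h
  obtain ⟨V, hVu, hV, hx⟩ := mem_nhds_iff.1 hu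
  exact ⟨V, hV, hx, h.mono hVu⟩

/-- A continuous map which pulls back holomorphic functions to holomorphic functions is
holomorphic. -/
lemma contMDiffAt_of_functions {f : X → Y} {x : X} (hc : ContinuousAt f x)
    (h : ∀ φ : Y → ℂ, ContMDiffAt 𝓘(ℂ, Fin n → ℂ) 𝓘(ℂ) ω φ (f x) →
      ContMDiffAt 𝓘(ℂ, E) 𝓘(ℂ) ω (φ ∘ f) x) :
    ContMDiffAt 𝓘(ℂ, E) 𝓘(ℂ, Fin n → ℂ) ω f x := by
  rw [contMDiffAt_iff_target]
  refine ⟨hc, contMDiffAt_pi_space.2 fun i => ?_⟩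
  refine h (fun y => extChartAt 𝓘(ℂ, Fin n → ℂ) (f x) y i) ?_
  exact contMDiffAt_pi_space.1 contMDiffAt_extChartAt i

/-- The coordinates of a chart of `Y` are holomorphic near each point, so they are enough test
functions to detect holomorphic maps. -/
lemma holOn_iff_contMDiffOn [IsManifold 𝓘(ℂ, Fin n → ℂ) ω Y] {f : X → Y} {D : Set X} (hD : IsOpen D) :
    HolOn (manifoldHol E X) (manifoldHol (Fin n → ℂ) Y) D f ↔
      ContMDiffOn 𝓘(ℂ, E) 𝓘(ℂ, Fin n → ℂ) ω f D := by
  constructor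
  · rintro ⟨hc, h⟩ x hx
    refine (contMDiffAt_of_functions (hc.continuousAt (hD.mem_nhds hx))
      fun φ hφ => ?_).contMDiffWithinAt
    obtain ⟨V, hV, hxV, hφV⟩ := exists_contMDiffOn_of_contMDiffAt hφ
    have h1 : ContMDiffOn 𝓘(ℂ, E) 𝓘(ℂ) ω (φ ∘ f) (D ∩ f ⁻¹' V) := h V φ hV hφV
    exact h1.contMDiffAt ((hc.isOpen_inter_preimage hD hV).mem_nhds ⟨hx, hxV⟩)
  · intro h
    refine ⟨h.continuousOn, fun V φ _ hφ => ?_⟩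
    exact ContMDiffOn.comp hφ (h.mono inter_subset_left) inter_subset_right

/-- `f` is antiholomorphic at `x`: it is continuous and the conjugates of the pull-backs of
holomorphic functions are holomorphic. -/
def AntiHolAt (E F : Type*) [NormedAddCommGroup E] [NormedSpace ℂ E] [NormedAddCommGroup F]
    [NormedSpace ℂ F] {X Y : Type*} [TopologicalSpace X] [ChartedSpace E X] [TopologicalSpace Y]
    [ChartedSpace F Y] (f : X → Y) (x : X) : Prop :=
  ContinuousAt f x ∧ ∀ φ : Y → ℂ, ContMDiffAt 𝓘(ℂ, F) 𝓘(ℂ) ω φ (f x) →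
    ContMDiffAt 𝓘(ℂ, E) 𝓘(ℂ) ω (fun y => starRingEnd ℂ (φ (f y))) x

lemma antiHol_iff [IsManifold 𝓘(ℂ, Fin n → ℂ) ω Y] {f : X → Y} :
    AntiHol (manifoldHol E X) (manifoldHol (Fin n → ℂ) Y) f ↔
      ∀ x, AntiHolAt E (Fin n → ℂ) f x := by
  constructor
  · rintro ⟨hc, h⟩ x
    refine ⟨hc.continuousAt, fun φ hφ => ?_⟩
    obtain ⟨V, hV, hxV, hφV⟩ := exists_contMDiffOn_of_contMDiffAt hφ
    exact ContMDiffOn.contMDiffAt (h V φ hV hφV) ((hV.preimage hc).mem_nhds hxV)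
  · intro h
    refine ⟨continuous_iff_continuousAt.2 fun x => (h x).1, fun V φ hV hφ x hx => ?_⟩
    exact ((h x).2 φ (hφ.contMDiffAt (hV.mem_nhds hx))).contMDiffWithinAt

/-! ### Composition of antiholomorphic germs. -/

section Comp

variable {F : Type*} [NormedAddCommGroup F] [NormedSpace ℂ F]
  {Z : Type*} [TopologicalSpace Z] [ChartedSpace F Z]

/-- The composition of two antiholomorphic maps is holomorphic. -/
lemma AntiHolAt.comp {g : Z → Y} {f : X → Z} {x : X}
    (hg : AntiHolAt F (Fin n → ℂ) g (f x)) (hf : AntiHolAt E F f x) :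
    ContMDiffAt 𝓘(ℂ, E) 𝓘(ℂ, Fin n → ℂ) ω (g ∘ f) x := by
  refine contMDiffAt_of_functions (ContinuousAt.comp hg.1 hf.1) fun φ hφ => ?_
  refine (hf.2 _ (hg.2 φ hφ)).congr_of_eventuallyEq (.of_forall fun y => ?_)
  simp

variable {F' : Type*} [NormedAddCommGroup F'] [NormedSpace ℂ F']
  {Z' : Type*} [TopologicalSpace Z'] [ChartedSpace F' Z']

lemma AntiHolAt.comp_contMDiffAt {g : Z → Z'} {f : X → Z} {x : X}
    (hg : AntiHolAt F F' g (f x)) (hf : ContMDiffAt 𝓘(ℂ, E) 𝓘(ℂ, F) ω f x) :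
    AntiHolAt E F' (g ∘ f) x :=
  ⟨ContinuousAt.comp hg.1 hf.continuousAt, fun φ hφ => (hg.2 φ hφ).comp x hf⟩

lemma AntiHolAt.contMDiffAt_comp {g : Z → Z'} {f : X → Z} {x : X}
    (hg : ContMDiffAt 𝓘(ℂ, F) 𝓘(ℂ, F') ω g (f x)) (hf : AntiHolAt E F f x) :
    AntiHolAt E F' (g ∘ f) x :=
  ⟨ContinuousAt.comp hg.continuousAt hf.1, fun φ hφ => hf.2 (φ ∘ g) (hφ.comp (f x) hg)⟩

lemma AntiHolAt.congr_of_eventuallyEq {f f' : X → Z} {x : X} (hf : AntiHolAt E F f x)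
    (h : f' =ᶠ[𝓝 x] f) : AntiHolAt E F f' x := by
  refine ⟨hf.1.congr h.symm, fun φ hφ => ?_⟩
  rw [h.self_of_nhds] at hφ
  refine (hf.2 φ hφ).congr_of_eventuallyEq ?_
  filter_upwards [h] with y hy
  rw [hy]

end Comp

end Functions

lemma RealSpace.antiHolAt_τ (Z : RealSpace.{u}) (z : Z.carrier) :
    AntiHolAt (Fin Z.dim → ℂ) (Fin Z.dim → ℂ) Z.τ z :=
  antiHol_iff.1 Z.τ_antihol z

lemma Coset.antiHolAt_τ (x : Coset H) : AntiHolAt H.Model H.Model Coset.τ x := by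
  obtain ⟨g, rfl⟩ := Coset.surjective_mk x
  refine ⟨Continuous.continuousAt ?_, fun φ hφ => Coset.contMDiffAt_iff.2 ?_⟩
  · exact Coset.isQuotientMap_mk.continuous_iff.2 (Coset.continuous_mk.comp G.τ_antihol.1)
  · exact (G.antiHolAt_τ g).2 (φ ∘ Coset.mk H) (Coset.contMDiffAt_iff.1 hφ)

/-! ### Ringed space morphisms from and to `G/H` -/

section

variable {E : Type*} [NormedAddCommGroup E] [NormedSpace ℂ E]
  {X : Type*} [TopologicalSpace X] [ChartedSpace E X]

lemma holOn_coset_iff [CompleteSpace E] {f : X → Coset H} {D : Set X} (hD : IsOpen D) :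
    HolOn (manifoldHol E X) (Coset.hol H) D f ↔ ContMDiffOn 𝓘(ℂ, E) H.I ω f D := by
  rw [← holOn_iff_contMDiffOn hD]
  refine and_congr_right fun _ => ?_
  refine forall_congr' fun V => forall_congr' fun φ => forall_congr' fun hV => ?_
  rw [Coset.hol_iff hV]
  rfl

lemma coset_holOn_iff {n : ℕ} {Y : Type*} [TopologicalSpace Y] [ChartedSpace (Fin n → ℂ) Y]
    [IsManifold 𝓘(ℂ, Fin n → ℂ) ω Y] {f : Coset H → Y} {D : Set (Coset H)} (hD : IsOpen D) :
    HolOn (Coset.hol H) (manifoldHol (Fin n → ℂ) Y) D f ↔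
      ContMDiffOn H.I 𝓘(ℂ, Fin n → ℂ) ω f D := by
  rw [← holOn_iff_contMDiffOn hD]
  refine and_congr_right fun hc => ?_
  refine forall_congr' fun V => forall_congr' fun φ => forall_congr' fun hV => ?_
  rw [Coset.hol_iff (hc.isOpen_inter_preimage hD hV)]
  rfl

end

/-! ### Right multiplication by sections of `N(H)/H` -/

lemma isNSection_iff {U : Set CP1} (hU : IsOpen U) {s : CP1 → Coset H} :
    IsNSection H U s ↔ ContMDiffOn 𝓘(ℂ) H.I ω s U ∧
      ∀ x ∈ U, (s x).proj = x ∧ s x ∈ normalizerQuotient H := by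
  unfold IsNSection
  rw [holOn_coset_iff hU]

/-- A section of `N(H)/H` lifts locally to a holomorphic section of `N(H)`. -/
lemma exists_normalizer_lift {U : Set CP1} (hU : IsOpen U) {s : CP1 → Coset H}
    (hs : IsNSection H U s) {x : CP1} (hx : x ∈ U) :
    ∃ σ : CP1 → G.carrier, ContMDiffAt 𝓘(ℂ) G.I ω σ x ∧
      ∀ᶠ y in 𝓝 x, y ∈ U ∧ G.proj (σ y) = y ∧ σ y ∈ normalizer H ∧ Coset.mk H (σ y) = s y := by
  rw [isNSection_iff hU] at hs
  have hsx : ContMDiffAt 𝓘(ℂ) H.I ω s x := hs.1.contMDiffAt (hU.mem_nhds hx)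
  obtain ⟨σ, hσ, hσe⟩ := Coset.exists_lift (s x)
  refine ⟨fun y => σ (s y), hσ.comp x hsx, ?_⟩
  filter_upwards [hU.mem_nhds hx, hsx.continuousAt.eventually hσe] with y hy h
  have hp : G.proj (σ (s y)) = y := by
    rw [← Coset.proj_mk (H := H), h]; exact (hs.2 y hy).1
  refine ⟨hy, hp, ?_, h⟩
  have := (hs.2 y hy).2
  rw [← h] at this
  exact Fibre.mk_mem_iff (b := ⟨σ (s y), hp⟩).1 this

/-- Lifting `s` locally to a holomorphic section `σ` of `N(H)`, the map is induced by `z ↦ z ·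
σ(proj z)` on `G`. -/
lemma contMDiffAt_rmul {U : Set CP1} (hU : IsOpen U) {s : CP1 → Coset H}
    (hs : IsNSection H U s) {y : Coset H} (hy : y.proj ∈ U) :
    ContMDiffAt H.I H.I ω (fun z : Coset H => nmul z (s z.proj)) y := by
  obtain ⟨g, rfl⟩ := Coset.surjective_mk y
  obtain ⟨σ, hσ, he⟩ := exists_normalizer_lift hU hs hy
  rw [Coset.contMDiffAt_iff]
  have he' := G.continuous_proj.continuousAt.eventually he
  have h1 : ContMDiffAt G.I G.I ω (fun z => σ (G.proj z)) g :=
    ContMDiffAt.comp g hσ G.proj_hol.contMDiffAt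
  have h2 : ContMDiffAt G.I G.I ω (fun z => G.mul z (σ (G.proj z))) g := by
    refine contMDiffAt_mul contMDiffAt_id h1 ?_
    filter_upwards [he'] with z hz using hz.2.1.symm
  refine (Coset.contMDiff_mk.contMDiffAt.comp g h2).congr_of_eventuallyEq ?_
  filter_upwards [he'] with z hz
  simp only [Function.comp, Coset.proj_mk]
  rw [← hz.2.2.2, nmul_mk hz.2.1.symm hz.2.2.1]

lemma IsNSection.ninv {U : Set CP1} (hU : IsOpen U) {s : CP1 → Coset H}
    (hs : IsNSection H U s) : IsNSection H U (fun x => ninv (s x)) := by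
  have hs' := (isNSection_iff hU).1 hs
  refine (isNSection_iff hU).2 ⟨fun x hx => ?_, fun x hx => ⟨?_, Coset.ninv_mem (hs'.2 x hx).2⟩⟩
  · obtain ⟨σ, hσ, he⟩ := exists_normalizer_lift hU hs hx
    refine ContMDiffAt.contMDiffWithinAt ?_
    refine (Coset.contMDiff_mk.contMDiffAt.comp x (contMDiffAt_inv hσ)).congr_of_eventuallyEq ?_
    filter_upwards [he] with y hy
    rw [← hy.2.2.2]
    exact Fibre.ninv_mk (b := ⟨σ y, hy.2.1⟩) hy.2.2.1
  · rw [Coset.proj_ninv, (hs'.2 x hx).1]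

/-! ### Local isomorphisms with `G/H` -/

namespace LocalIso

variable {W : HomogeneousSpace G} {U : Set CP1}

/-- A local isomorphism in terms of holomorphic maps of manifolds. -/
def ofContMDiffOn (e : OpenPartialHomeomorph (Coset H) W.carrier)
    (source_eq : e.source = Coset.proj ⁻¹' U) (target_eq : e.target = W.proj ⁻¹' U)
    (hol : ContMDiffOn H.I W.I ω e e.source) (hol_symm : ContMDiffOn W.I H.I ω e.symm e.target)
    (proj_eq : ∀ x ∈ e.source, W.proj (e x) = x.proj)
    (equivariant : ∀ g, ∀ x ∈ e.source, G.proj g = x.proj →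
      e (Coset.act g x) = W.act g (e x)) : LocalIso H W U where
  e := e
  source_eq := source_eq
  target_eq := target_eq
  hol := (coset_holOn_iff e.open_source).2 hol
  hol_symm := (holOn_coset_iff e.open_target).2 hol_symm
  proj_eq := proj_eq
  equivariant := equivariant

variable (A : LocalIso H W U)

lemma mem_source {y : Coset H} (hy : y.proj ∈ U) : y ∈ A.e.source := by
  rw [A.source_eq]; exact hy

lemma mem_target {w : W.carrier} (hw : W.proj w ∈ U) : w ∈ A.e.target := by
  rw [A.target_eq]; exact hw

lemma contMDiffAt {y : Coset H} (hy : y.proj ∈ U) : ContMDiffAt H.I W.I ω A.e y :=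
  ((coset_holOn_iff A.e.open_source).1 A.hol).contMDiffAt
    (A.e.open_source.mem_nhds (A.mem_source hy))

lemma contMDiffAt_symm {w : W.carrier} (hw : W.proj w ∈ U) :
    ContMDiffAt W.I H.I ω A.e.symm w :=
  ((holOn_coset_iff A.e.open_target).1 A.hol_symm).contMDiffAt
    (A.e.open_target.mem_nhds (A.mem_target hw))

lemma left_inv {y : Coset H} (hy : y.proj ∈ U) : A.e.symm (A.e y) = y :=
  A.e.left_inv (A.mem_source hy)

lemma right_inv {w : W.carrier} (hw : W.proj w ∈ U) : A.e (A.e.symm w) = w :=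
  A.e.right_inv (A.mem_target hw)

lemma proj_apply {y : Coset H} (hy : y.proj ∈ U) : W.proj (A.e y) = y.proj :=
  A.proj_eq y (A.mem_source hy)

lemma proj_symm {w : W.carrier} (hw : W.proj w ∈ U) : (A.e.symm w).proj = W.proj w := by
  have h := A.e.map_target (A.mem_target hw)
  rw [← A.proj_eq _ h, A.right_inv hw]

lemma act_apply {g : G.carrier} {y : Coset H} (hy : y.proj ∈ U) (hg : G.proj g = y.proj) :
    A.e (Coset.act g y) = W.act g (A.e y) :=
  A.equivariant g y (A.mem_source hy) hg

lemma act_symm {g : G.carrier} {w : W.carrier} (hw : W.proj w ∈ U) (hg : G.proj g = W.proj w) :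
    A.e.symm (W.act g w) = Coset.act g (A.e.symm w) := by
  have hp := A.proj_symm hw
  have hp' : (A.e.symm w).proj ∈ U := by rwa [hp]
  have h : A.e (Coset.act g (A.e.symm w)) = W.act g w := by
    rw [A.act_apply hp' (hg.trans hp.symm), A.right_inv hw]
  rw [← h, A.left_inv]
  rwa [Coset.proj_act (hg.trans hp.symm)]

/-- The section of `N(H)/H` given by the automorphism `B⁻¹ ∘ A` of `G/H`. -/
def toSection {U' : Set CP1} (A : LocalIso H W U) (B : LocalIso H W U') (x : CP1) : Coset H :=
  B.e.symm (A.e (Coset.one H x))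

variable {U' : Set CP1} (B : LocalIso H W U')

lemma proj_symm_apply {y : Coset H} (hy : y.proj ∈ U ∩ U') :
    (B.e.symm (A.e y)).proj = y.proj := by
  rw [B.proj_symm (by rw [A.proj_apply hy.1]; exact hy.2), A.proj_apply hy.1]

lemma act_symm_apply {g : G.carrier} {y : Coset H} (hy : y.proj ∈ U ∩ U')
    (hg : G.proj g = y.proj) :
    B.e.symm (A.e (Coset.act g y)) = Coset.act g (B.e.symm (A.e y)) := by
  have := A.proj_apply hy.1
  rw [A.act_apply hy.1 hg, B.act_symm (by rw [this]; exact hy.2) (hg.trans this.symm)]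

/-- `B⁻¹ A` is equivariant on the fibre over `x`, with equivariant left inverse `A⁻¹ B`, so the
stabilizer argument applies. -/
lemma toSection_mem {x : CP1} (hx : x ∈ U ∩ U') :
    A.toSection B x ∈ normalizerQuotient H := by
  refine Coset.equivariant_mem (x := x) (β := fun y => B.e.symm (A.e y))
    (β' := fun y => A.e.symm (B.e y)) ?_ ?_ ?_ ?_
  · rintro y rfl; exact A.proj_symm_apply B hx
  · rintro g y hg rfl; exact A.act_symm_apply B hx hg
  · rintro g y hg rfl; exact B.act_symm_apply A hx.symm hg
  · rintro y rfl
    have h : W.proj (A.e y) ∈ U' := by rw [A.proj_apply hx.1]; exact hx.2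
    rw [B.right_inv h, A.left_inv hx.1]

/-- Recovers the whole change of trivialization from its value at the trivial coset; this is what
lets sections of `N(H)/H` stand for automorphisms. -/
lemma symm_apply_eq {y : Coset H} (hy : y.proj ∈ U ∩ U') :
    B.e.symm (A.e y) = nmul y (A.toSection B y.proj) := by
  refine Coset.equivariant_eq (x := y.proj) (β := fun y => B.e.symm (A.e y)) ?_ ?_
    (A.toSection_mem B hy) rfl
  · intro z hz; rw [← hz] at hy ⊢; exact A.proj_symm_apply B hy
  · intro g z hg hz; rw [← hz] at hy hg; exact A.act_symm_apply B hy hg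

lemma proj_toSection {x : CP1} (hx : x ∈ U ∩ U') : (A.toSection B x).proj = x := by
  have h1 := Coset.proj_one (H := H) x
  have := A.proj_symm_apply B (y := Coset.one H x) (by rwa [h1])
  rwa [h1] at this

lemma isNSection (hU : IsOpen U) (hU' : IsOpen U') : IsNSection H (U ∩ U') (A.toSection B) := by
  refine (isNSection_iff (hU.inter hU')).2
    ⟨fun x hx => ?_, fun x hx => ⟨A.proj_toSection B hx, A.toSection_mem B hx⟩⟩
  have h1 := Coset.proj_one (H := H) x
  have ha : ContMDiffAt H.I W.I ω A.e (Coset.one H x) := A.contMDiffAt (by rw [h1]; exact hx.1)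
  have hb : ContMDiffAt W.I H.I ω B.e.symm (A.e (Coset.one H x)) := by
    refine B.contMDiffAt_symm ?_
    rw [A.proj_apply (by rw [h1]; exact hx.1), h1]
    exact hx.2
  have h0 : ContMDiffAt 𝓘(ℂ) H.I ω (Coset.one H) x :=
    (Coset.contMDiff_mk.comp G.one_hol).contMDiffAt
  exact (hb.comp x (ha.comp x h0)).contMDiffWithinAt

/-- Two descriptions of the same point. -/
lemma apply_eq {y : Coset H} (hy : y.proj ∈ U ∩ U') :
    A.e y = B.e (nmul y (A.toSection B y.proj)) := by
  rw [← A.symm_apply_eq B hy, B.right_inv]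
  rw [A.proj_apply hy.1]; exact hy.2

/-- The sections `B⁻¹A` and `D⁻¹B` compose to `D⁻¹A`. -/
lemma toSection_trans {U'' : Set CP1} (D : LocalIso H W U'') {x : CP1} (hx : x ∈ U) (hx' : x ∈ U')
    (hx'' : x ∈ U'') : A.toSection D x = nmul (A.toSection B x) (B.toSection D x) := by
  have h1 := Coset.proj_one (H := H) x
  have h2 := A.proj_toSection B ⟨hx, hx'⟩
  have h3 := B.symm_apply_eq D (y := A.toSection B x) (by rw [h2]; exact ⟨hx', hx''⟩)
  rw [h2] at h3
  rw [← h3]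
  unfold toSection
  rw [B.right_inv]
  rw [A.proj_apply (by rwa [h1]), h1]
  exact hx'

end LocalIso

/-! ### Transport of local isomorphisms -/

/-- The homeomorphism underlying an isomorphism. -/
def HomogeneousSpace.Iso.toHomeomorph {W W' : HomogeneousSpace G} (F : HomogeneousSpace.Iso W W') :
    W.carrier ≃ₜ W'.carrier where
  toEquiv := F.toEquiv
  continuous_toFun := F.hol.continuous
  continuous_invFun := F.hol_symm.continuous

/-- Transport of a local isomorphism along an isomorphism of homogeneous spaces. -/
def LocalIso.mapIso {W W' : HomogeneousSpace G} {U : Set CP1} (A : LocalIso H W U)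
    (F : HomogeneousSpace.Iso W W') : LocalIso H W' U :=
  LocalIso.ofContMDiffOn (A.e.trans F.toHomeomorph.toOpenPartialHomeomorph)
    (by
      rw [OpenPartialHomeomorph.trans_source]
      simp [A.source_eq])
    (by
      rw [OpenPartialHomeomorph.trans_target]
      ext w
      have := F.proj_eq (F.toEquiv.symm w)
      rw [F.toEquiv.apply_symm_apply] at this
      simp [A.target_eq, HomogeneousSpace.Iso.toHomeomorph, this])
    (fun y hy => by
      rw [OpenPartialHomeomorph.trans_source] at hy
      have hy' : y.proj ∈ U := by have := hy.1; rwa [A.source_eq] at this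
      exact (F.hol.contMDiffAt.comp y (A.contMDiffAt hy')).contMDiffWithinAt)
    (fun w hw => by
      rw [OpenPartialHomeomorph.trans_target] at hw
      have hw' : W.proj (F.toEquiv.symm w) ∈ U := by have := hw.2; rwa [A.target_eq] at this
      exact ((A.contMDiffAt_symm hw').comp w F.hol_symm.contMDiffAt).contMDiffWithinAt)
    (fun y hy => by
      rw [OpenPartialHomeomorph.trans_source] at hy
      exact (F.proj_eq _).trans (A.proj_eq y hy.1))
    (fun g y hy hg => by
      rw [OpenPartialHomeomorph.trans_source] at hy
      change F.toEquiv (A.e (Coset.act g y)) = W'.act g (F.toEquiv (A.e y))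
      rw [A.equivariant g y hy.1 hg, F.equivariant]
      exact hg.trans (A.proj_eq y hy.1).symm)

lemma LocalIso.mapIso_apply {W W' : HomogeneousSpace G} {U : Set CP1} (A : LocalIso H W U)
    (F : HomogeneousSpace.Iso W W') (y : Coset H) : (A.mapIso F).e y = F.toEquiv (A.e y) := rfl

lemma LocalIso.mapIso_symm_apply {W W' : HomogeneousSpace G} {U : Set CP1} (A : LocalIso H W U)
    (F : HomogeneousSpace.Iso W W') (w : W'.carrier) :
    (A.mapIso F).e.symm w = A.e.symm (F.toEquiv.symm w) := rfl

/-- The real structure as a homeomorphism. -/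
def RealSpace.τHomeo (Z : RealSpace.{u}) : Z.carrier ≃ₜ Z.carrier where
  toFun := Z.τ
  invFun := Z.τ
  left_inv := Z.τ_τ
  right_inv := Z.τ_τ
  continuous_toFun := Z.τ_antihol.1
  continuous_invFun := Z.τ_antihol.1

variable (H) in
/-- The real structure of `G/H` as a homeomorphism. -/
def Coset.τHomeo : Coset H ≃ₜ Coset H where
  toFun := Coset.τ
  invFun := Coset.τ
  left_inv := Coset.τ_τ
  right_inv := Coset.τ_τ
  continuous_toFun := continuous_iff_continuousAt.2 fun x => (Coset.antiHolAt_τ x).1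
  continuous_invFun := continuous_iff_continuousAt.2 fun x => (Coset.antiHolAt_τ x).1

/-- The conjugate `τ ∘ A ∘ τ` of a local isomorphism by the real structures. -/
def LocalIso.conj {W : HomogeneousSpace G} {U : Set CP1} (A : LocalIso H W U) :
    LocalIso H W (antipode ⁻¹' U) :=
  LocalIso.ofContMDiffOn ((Coset.τHomeo H).toOpenPartialHomeomorph.trans
      (A.e.trans W.τHomeo.toOpenPartialHomeomorph))
    (by
      simp only [OpenPartialHomeomorph.trans_source, A.source_eq]
      ext y
      simp [Coset.τHomeo, Coset.proj_τ])
    (by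
      simp only [OpenPartialHomeomorph.trans_target, A.target_eq]
      ext w
      simp [RealSpace.τHomeo, W.proj_τ])
    (fun y hy => by
      have hy' : y.τ.proj ∈ U := by
        simp only [OpenPartialHomeomorph.trans_source, A.source_eq] at hy
        exact hy.2.1
      have h1 := AntiHolAt.comp_contMDiffAt (W.antiHolAt_τ (A.e y.τ)) (A.contMDiffAt hy')
      exact (AntiHolAt.comp h1 (Coset.antiHolAt_τ y)).contMDiffWithinAt)
    (fun w hw => by
      have hw' : W.proj (W.τ w) ∈ U := by
        simp only [OpenPartialHomeomorph.trans_target, A.target_eq] at hw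
        exact hw.1.2
      have h1 := AntiHolAt.comp_contMDiffAt (Coset.antiHolAt_τ (A.e.symm (W.τ w)))
        (A.contMDiffAt_symm hw')
      exact (AntiHolAt.comp h1 (W.antiHolAt_τ w)).contMDiffWithinAt)
    (fun y hy => by
      have hy' : y.τ.proj ∈ U := by
        simp only [OpenPartialHomeomorph.trans_source, A.source_eq] at hy
        exact hy.2.1
      change W.proj (W.τ (A.e y.τ)) = y.proj
      rw [W.proj_τ, A.proj_apply hy', Coset.proj_τ, antipode_antipode])
    (fun g y hy hg => by
      have hy' : y.τ.proj ∈ U := by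
        simp only [OpenPartialHomeomorph.trans_source, A.source_eq] at hy
        exact hy.2.1
      change W.τ (A.e (Coset.act g y).τ) = W.act g (W.τ (A.e y.τ))
      have hg' : G.proj (G.τ g) = y.τ.proj := by rw [G.proj_τ, hg, Coset.proj_τ]
      rw [Coset.τ_act hg, A.act_apply hy' hg', W.τ_act _ _ (hg'.trans (A.proj_apply hy').symm),
        G.τ_τ])

/-- A homogeneous space which is locally isomorphic to `G/H` has a real family of local
isomorphisms. -/
lemma LocallyIsoCoset.exists_isRealFamily {W : HomogeneousSpace G} (hW : LocallyIsoCoset H W) :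
    ∃ (C : RealCover) (h : ∀ i, LocalIso H W (C.U i)), IsRealFamily h := by
  choose U hU hxU A using hW
  let A' := fun x => (A x).some
  let C : RealCover :=
    -- Each chosen open set occurs twice: with its own isomorphism, and as its antipodal image with
    -- the conjugate one. Flipping the flag exchanges the two, so the family is real by
    -- construction.
    { ι := CP1 × Bool
      bar := fun i => (i.1, !i.2)
      bar_bar := fun i => by simp
      U := fun i => if i.2 then U i.1 else antipode ⁻¹' U i.1
      isOpen := by
        rintro ⟨x, _ | _⟩
        · exact (hU x).preimage (continuous_antipode G)
        · exact hU x
      covers := fun x => ⟨(x, true), hxU x⟩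
      U_bar := by
        rintro ⟨x, _ | _⟩
        · change U x = antipode ⁻¹' (antipode ⁻¹' U x)
          ext y; simp [antipode_antipode]
        · rfl }
  let h : ∀ i, LocalIso H W (C.U i) := fun i =>
    match i with
    | (x, true) => A' x
    | (x, false) => (A' x).conj
  refine ⟨C, h, ?_⟩
  rintro ⟨x, _ | _⟩ y hy
  · change (A' x).e y.τ = W.τ (W.τ ((A' x).e y.τ))
    rw [W.τ_τ]
  · change W.τ ((A' x).e y.τ.τ) = W.τ ((A' x).e y)
    rw [Coset.τ_τ]

/-! ### The cocycle of a real family -/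

section RealFamily

variable {W : HomogeneousSpace G} {C : RealCover} {h : ∀ i, LocalIso H W (C.U i)}

lemma transition_eq (i j : C.ι) (x : CP1) : transition h i j x = (h i).toSection (h j) x := rfl

lemma IsRealFamily.symm_τ (hr : IsRealFamily h) {i : C.ι} {w : W.carrier}
    (hw : W.proj w ∈ C.U i) : (h (C.bar i)).e.symm (W.τ w) = ((h i).e.symm w).τ := by
  have hp := (h i).proj_symm hw
  have h1 := hr i ((h i).e.symm w) (by rwa [hp])
  rw [(h i).right_inv hw] at h1
  rw [← h1, (h (C.bar i)).left_inv]
  rw [Coset.proj_τ, hp, C.U_bar, mem_preimage, antipode_antipode]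
  exact hw

/-- Allowing two families and an isomorphism `F` covers two uses: reality of the transition cocycle
(`F` the identity) and of the cochain comparing two spaces. -/
lemma IsRealFamily.toSection_real {W' : HomogeneousSpace G} {C' : RealCover}
    {h' : ∀ i, LocalIso H W' (C'.U i)} (hr : IsRealFamily h) (hr' : IsRealFamily h')
    (F : HomogeneousSpace.Iso W W') {i : C.ι} {j : C'.ι} {x : CP1} (hi : x ∈ C.U i)
    (hj : x ∈ C'.U j) :
    ((h (C.bar i)).mapIso F).toSection (h' (C'.bar j)) (antipode x) =
      (((h i).mapIso F).toSection (h' j) x).τ := by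
  have h1 := Coset.proj_one (H := H) x
  have hi' : (Coset.one H x).proj ∈ C.U i := by rwa [h1]
  unfold LocalIso.toSection
  rw [← Coset.τ_one, LocalIso.mapIso_apply, LocalIso.mapIso_apply, hr i _ hi', F.real,
    hr'.symm_τ]
  rwa [F.proj_eq, (h i).proj_apply hi', h1]

/-- The identity isomorphism. -/
def HomogeneousSpace.Iso.refl (W : HomogeneousSpace G) : HomogeneousSpace.Iso W W where
  toEquiv := Equiv.refl _
  hol := contMDiff_id
  hol_symm := contMDiff_id
  proj_eq _ := rfl
  equivariant _ _ _ := rfl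
  real _ := rfl

/-- The cocycle of transition sections of a real family of local isomorphisms. -/
def IsRealFamily.cocycle (hr : IsRealFamily h) : RealCocycle H C where
  s := transition h
  isSection i j := (h i).isNSection (h j) (C.isOpen i) (C.isOpen j)
  cocycle i j k _ hx := (h i).toSection_trans (h j) (h k) hx.1.1 hx.1.2 hx.2
  real _ _ _ hx := hr.toSection_real hr (HomogeneousSpace.Iso.refl W) hx.1 hx.2

end RealFamily

/-- `c` is the cocycle of transition sections of a real family of local isomorphisms of `W` with
`G/H`. -/
def IsCocycleOf (W : HomogeneousSpace G) (c : Σ C : RealCover, RealCocycle H C) : Prop :=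
  ∃ h : ∀ i, LocalIso H W (c.1.U i), IsRealFamily h ∧
    ∀ i j, ∀ x ∈ c.1.U i ∩ c.1.U j, c.2.s i j x = transition h i j x

/-- The cocycles of isomorphic spaces are cohomologous. -/
lemma cohomologous_of_iso {W W' : HomogeneousSpace G} {c c' : Σ C : RealCover, RealCocycle H C}
    (hc : IsCocycleOf W c) (hc' : IsCocycleOf W' c') (F : HomogeneousSpace.Iso W W') :
    Cohomologous c c' := by
  obtain ⟨h, hr, hs⟩ := hc
  obtain ⟨h', hr', hs'⟩ := hc'
  let D : RealCover :=
    { ι := c.1.ι × c'.1.ι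
      bar := fun i => (c.1.bar i.1, c'.1.bar i.2)
      bar_bar := fun i => by rw [c.1.bar_bar, c'.1.bar_bar]
      U := fun i => c.1.U i.1 ∩ c'.1.U i.2
      isOpen := fun i => (c.1.isOpen i.1).inter (c'.1.isOpen i.2)
      covers := fun x => by
        obtain ⟨i, hi⟩ := c.1.covers x
        obtain ⟨j, hj⟩ := c'.1.covers x
        exact ⟨(i, j), hi, hj⟩
      U_bar := fun i => by rw [c.1.U_bar, c'.1.U_bar, preimage_inter] }
  -- The cochain consists of the sections of `h'_j⁻¹ F h_i`. Both sides of the coboundary relation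
  -- then equal the section of `h'_l⁻¹ F h_k`, because transition sections are unchanged by
  -- transport along `F`.
  refine ⟨D, Prod.fst, Prod.snd, fun k => ((h k.1).mapIso F).toSection (h' k.2), fun _ => rfl,
    fun _ => rfl, fun _ => inter_subset_left, fun _ => inter_subset_right,
    fun k => ((h k.1).mapIso F).isNSection (h' k.2) (c.1.isOpen _) (c'.1.isOpen _),
    fun k x hx => hr.toSection_real hr' F hx.1 hx.2, ?_⟩
  rintro k l x ⟨⟨h1, h2⟩, h3, h4⟩
  rw [hs _ _ x ⟨h1, h3⟩, hs' _ _ x ⟨h2, h4⟩, transition_eq, transition_eq,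
    ← LocalIso.toSection_trans _ _ _ h1 h2 h4]
  have : (h k.1).toSection (h l.1) x = ((h k.1).mapIso F).toSection ((h l.1).mapIso F) x := by
    unfold LocalIso.toSection
    rw [LocalIso.mapIso_apply, LocalIso.mapIso_symm_apply, F.toEquiv.symm_apply_apply]
  rw [this, ← LocalIso.toSection_trans _ _ _ h1 h3 h4]

/-! ### Spaces with cohomologous cocycles are isomorphic -/

namespace LocalIso

variable {W W' : HomogeneousSpace G} {U U' V : Set CP1}

/-- The map `B ∘ R_r ∘ A⁻¹` from `W` to `W'`, where `R_r` is the right multiplication by `r`. -/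
def twistedMap (A : LocalIso H W U) (B : LocalIso H W' U') (r : CP1 → Coset H)
    (w : W.carrier) : W'.carrier :=
  B.e (nmul (A.e.symm w) (r (W.proj w)))

variable (A : LocalIso H W U) (B : LocalIso H W' U') {r : CP1 → Coset H}

lemma proj_twistedMap (hr : IsNSection H V r) (hVU : V ⊆ U) (hVU' : V ⊆ U') {w : W.carrier}
    (hw : W.proj w ∈ V) : W'.proj (A.twistedMap B r w) = W.proj w := by
  have h1 := A.proj_symm (hVU hw)
  have h2 : (nmul (A.e.symm w) (r (W.proj w))).proj = W.proj w := by
    rw [Coset.proj_nmul (h1.trans (hr.2 _ hw).1.symm), h1]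
  unfold twistedMap
  rw [B.proj_apply, h2]
  rw [h2]; exact hVU' hw

lemma contMDiffAt_twistedMap (hV : IsOpen V) (hr : IsNSection H V r) (hVU : V ⊆ U)
    (hVU' : V ⊆ U') {w : W.carrier} (hw : W.proj w ∈ V) :
    ContMDiffAt W.I W'.I ω (A.twistedMap B r) w := by
  have h1 := A.proj_symm (hVU hw)
  have h2 : (nmul (A.e.symm w) (r (W.proj w))).proj = W.proj w := by
    rw [Coset.proj_nmul (h1.trans (hr.2 _ hw).1.symm), h1]
  have h3 : ContMDiffAt H.I H.I ω (fun z : Coset H => nmul z (r z.proj)) (A.e.symm w) :=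
    contMDiffAt_rmul hV hr (by rwa [h1])
  have h4 : ContMDiffAt H.I W'.I ω B.e (nmul (A.e.symm w) (r (A.e.symm w).proj)) := by
    refine B.contMDiffAt ?_
    rw [h1, h2]; exact hVU' hw
  refine (ContMDiffAt.comp w (g := B.e) h4 (h3.comp w (A.contMDiffAt_symm
    (hVU hw)))).congr_of_eventuallyEq ?_
  filter_upwards [(hV.preimage W.continuous_proj).mem_nhds hw] with w' hw'
  simp only [twistedMap, Function.comp, A.proj_symm (hVU hw')]

lemma twistedMap_act (hr : IsNSection H V r) (hVU : V ⊆ U) (hVU' : V ⊆ U') {w : W.carrier}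
    (hw : W.proj w ∈ V) {g : G.carrier} (hg : G.proj g = W.proj w) :
    A.twistedMap B r (W.act g w) = W'.act g (A.twistedMap B r w) := by
  have h1 := A.proj_symm (hVU hw)
  have h0 := h1.trans (hr.2 _ hw).1.symm
  have h2 : (nmul (A.e.symm w) (r (W.proj w))).proj = W.proj w := by
    rw [Coset.proj_nmul h0, h1]
  unfold twistedMap
  rw [W.proj_act _ _ hg, A.act_symm (hVU hw) hg, ← Coset.act_nmul (hg.trans h1.symm) h0
    (hr.2 _ hw).2, B.act_apply (by rw [h2]; exact hVU' hw) (hg.trans h2.symm)]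

lemma twistedMap_twistedMap_ninv (hr : IsNSection H V r) (hVU : V ⊆ U) (hVU' : V ⊆ U')
    {w : W.carrier} (hw : W.proj w ∈ V) :
    B.twistedMap A (fun x => ninv (r x)) (A.twistedMap B r w) = w := by
  have hp := A.proj_twistedMap B hr hVU hVU' hw
  have h1 := A.proj_symm (hVU hw)
  have h0 := h1.trans (hr.2 _ hw).1.symm
  have h2 : (nmul (A.e.symm w) (r (W.proj w))).proj = W.proj w := by
    rw [Coset.proj_nmul h0, h1]
  unfold twistedMap at hp ⊢
  rw [hp, B.left_inv (by rw [h2]; exact hVU' hw), Coset.nmul_nmul_ninv h0 (hr.2 _ hw).2,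
    A.right_inv (hVU hw)]

lemma twistedMap_ninv_twistedMap (hr : IsNSection H V r) (hVU : V ⊆ U) (hVU' : V ⊆ U')
    {w : W'.carrier} (hw : W'.proj w ∈ V) :
    A.twistedMap B r (B.twistedMap A (fun x => ninv (r x)) w) = w := by
  have hp : W.proj (B.twistedMap A (fun x => ninv (r x)) w) = W'.proj w := by
    have h1 := B.proj_symm (hVU' hw)
    have h2 : (nmul (B.e.symm w) (ninv (r (W'.proj w)))).proj = W'.proj w := by
      rw [Coset.proj_nmul (by rw [h1, Coset.proj_ninv, (hr.2 _ hw).1]), h1]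
    unfold twistedMap
    rw [A.proj_apply (by rw [h2]; exact hVU hw), h2]
  have h1 := B.proj_symm (hVU' hw)
  have h0 := h1.trans (hr.2 _ hw).1.symm
  have h2 : (nmul (B.e.symm w) (ninv (r (W'.proj w)))).proj = W'.proj w := by
    rw [Coset.proj_nmul (h0.trans (Coset.proj_ninv _).symm), h1]
  unfold twistedMap at hp ⊢
  rw [hp, A.left_inv (by rw [h2]; exact hVU hw), Coset.nmul_ninv_nmul h0 (hr.2 _ hw).2,
    B.right_inv (hVU' hw)]

end LocalIso

/-- The data of a cochain relating the cocycles of `W` and `W'`. -/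
lemma nonempty_iso_of_cochain {W W' : HomogeneousSpace G} {D : RealCover}
    {U U' : D.ι → Set CP1} (A : ∀ k, LocalIso H W (U k)) (B : ∀ k, LocalIso H W' (U' k))
    (hU : ∀ k, D.U k ⊆ U k) (hU' : ∀ k, D.U k ⊆ U' k) {r : D.ι → CP1 → Coset H}
    (hr : ∀ k, IsNSection H (D.U k) (r k))
    (hglue : ∀ k l, ∀ w, W.proj w ∈ D.U k ∩ D.U l →
      (A k).twistedMap (B k) (r k) w = (A l).twistedMap (B l) (r l) w)
    (hreal : ∀ k, ∀ w, W.proj w ∈ D.U k →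
      (A (D.bar k)).twistedMap (B (D.bar k)) (r (D.bar k)) (W.τ w) =
        W'.τ ((A k).twistedMap (B k) (r k) w)) :
    Nonempty (HomogeneousSpace.Iso W W') := by
  -- The map is defined with a pointwise choice of index; by `hglue` any admissible index gives the
  -- same value, so local properties can be checked with a fixed one.
  choose κ hκ using D.covers
  let f : W.carrier → W'.carrier := fun w =>
    (A (κ (W.proj w))).twistedMap (B (κ (W.proj w))) (r (κ (W.proj w))) w
  have hf : ∀ k w, W.proj w ∈ D.U k → f w = (A k).twistedMap (B k) (r k) w := fun k w hw =>
    hglue _ _ w ⟨hκ _, hw⟩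
  have hfp : ∀ w, W'.proj (f w) = W.proj w := fun w =>
    (A _).proj_twistedMap (B _) (hr _) (hU _) (hU' _) (hκ _)
  let g : W'.carrier → W.carrier := fun w =>
    (B (κ (W'.proj w))).twistedMap (A (κ (W'.proj w))) (fun x => ninv (r (κ (W'.proj w)) x)) w
  have hr' : ∀ k, IsNSection H (D.U k) (fun x => ninv (r k x)) := fun k => (hr k).ninv (D.isOpen k)
  have hfg : ∀ k w, W'.proj w ∈ D.U k →
      f ((B k).twistedMap (A k) (fun x => ninv (r k x)) w) = w := by
    intro k w hw
    rw [hf k, LocalIso.twistedMap_ninv_twistedMap _ _ (hr k) (hU k) (hU' k) hw]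
    rw [LocalIso.proj_twistedMap _ _ (hr' k) (hU' k) (hU k) hw]
    exact hw
  have hgf : ∀ w, g (f w) = w := by
    intro w
    have h1 : W.proj w ∈ D.U (κ (W'.proj (f w))) := by rw [hfp]; exact hκ _
    -- The index occurring in `g (f w)` depends on `f w` itself; making it a variable allows `f w`
    -- to be rewritten.
    have h2 : ∀ k w', W.proj w ∈ D.U k → w' = f w →
        (B k).twistedMap (A k) (fun x => ninv (r k x)) w' = w := by
      rintro k w' hk rfl
      rw [hf _ w hk]
      exact LocalIso.twistedMap_twistedMap_ninv _ _ (hr _) (hU _) (hU' _) hk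
    exact h2 _ _ h1 rfl
  let F : W.carrier ≃ W'.carrier := ⟨f, g, hgf, fun w => hfg _ w (hκ _)⟩
  have hg : ∀ k w, W'.proj w ∈ D.U k →
      g w = (B k).twistedMap (A k) (fun x => ninv (r k x)) w := by
    intro k w hw
    -- Both candidates are sent to `w` by the injective map `f`, so no separate glueing identity for
    -- the inverses is needed.
    apply F.injective
    change f (g w) = f _
    rw [hfg k w hw]
    exact hfg _ w (hκ _)
  refine ⟨⟨F, fun w => ?_, fun w => ?_, hfp, fun a w ha => ?_, fun w => ?_⟩⟩
  · refine (LocalIso.contMDiffAt_twistedMap (A _) (B _) (D.isOpen _) (hr _) (hU _) (hU' _)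
      (hκ (W.proj w))).congr_of_eventuallyEq ?_
    filter_upwards [((D.isOpen _).preimage W.continuous_proj).mem_nhds (hκ (W.proj w))] with w' hw'
      using hf _ _ hw'
  · refine (LocalIso.contMDiffAt_twistedMap (B _) (A _) (D.isOpen _) (hr' _) (hU' _) (hU _)
      (hκ (W'.proj w))).congr_of_eventuallyEq ?_
    filter_upwards [((D.isOpen _).preimage W'.continuous_proj).mem_nhds (hκ (W'.proj w))]
      with w' hw' using hg _ _ hw'
  · change f (W.act a w) = W'.act a (f w)
    have h1 := hκ (W.proj w)
    rw [hf _ w h1, hf _ (W.act a w) (by rw [W.proj_act _ _ ha]; exact h1)]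
    exact LocalIso.twistedMap_act _ _ (hr _) (hU _) (hU' _) h1 ha
  · change f (W.τ w) = W'.τ (f w)
    have h1 := hκ (W.proj w)
    have h2 : W.proj (W.τ w) ∈ D.U (D.bar (κ (W.proj w))) := by
      rw [W.proj_τ, D.U_bar, mem_preimage, antipode_antipode]; exact h1
    rw [hf _ _ h1, hf _ _ h2]
    exact hreal _ _ h1

/-- Spaces with cohomologous cocycles are isomorphic. -/
lemma nonempty_iso_of_cohomologous {W W' : HomogeneousSpace G}
    {c c' : Σ C : RealCover, RealCocycle H C} (hc : IsCocycleOf W c) (hc' : IsCocycleOf W' c')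
    (hcc' : Cohomologous c c') : Nonempty (HomogeneousSpace.Iso W W') := by
  obtain ⟨h, hh, hs⟩ := hc
  obtain ⟨h', hh', hs'⟩ := hc'
  obtain ⟨D, ρ, ρ', r, hρ, hρ', hU, hU', hr, hrr, hglue⟩ := hcc'
  refine nonempty_iso_of_cochain (D := D) (fun k => h (ρ k)) (fun k => h' (ρ' k)) hU hU' hr ?_ ?_
  · rintro k l w ⟨hk, hl⟩
    have e := hglue k l _ ⟨hk, hl⟩
    rw [hs' _ _ _ ⟨hU' k hk, hU' l hl⟩, hs _ _ _ ⟨hU k hk, hU l hl⟩, transition_eq,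
      transition_eq] at e
    have hz := (h (ρ k)).proj_symm (hU k hk)
    have hz' := (h (ρ k)).right_inv (hU k hk)
    set z := (h (ρ k)).e.symm w with hzdef
    have hzr := hz.trans ((hr k).2 _ hk).1.symm
    have hkl := (h (ρ k)).proj_toSection (h (ρ l)) ⟨hU k hk, hU l hl⟩
    have hkl' := (h' (ρ' k)).proj_toSection (h' (ρ' l)) ⟨hU' k hk, hU' l hl⟩
    have hp : (nmul z (r k (W.proj w))).proj = W.proj w := by rw [Coset.proj_nmul hzr, hz]
    -- With `z = h_k⁻¹ w`: `h'_k(z r_k) = h'_l(z r_k s'_kl) = h'_l(z s_kl r_l)`, and `z s_kl = h_l⁻¹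
    -- w`.
    unfold LocalIso.twistedMap
    rw [← hzdef, (h' (ρ' k)).apply_eq (h' (ρ' l)) (by rw [hp]; exact ⟨hU' k hk, hU' l hl⟩), hp,
      Coset.nmul_assoc hzr (hz.trans hkl'.symm) ((hr k).2 _ hk).2
        ((h' (ρ' k)).toSection_mem _ ⟨hU' k hk, hU' l hl⟩), e,
      ← Coset.nmul_assoc (hz.trans hkl.symm) (hz.trans ((hr l).2 _ hl).1.symm)
        ((h (ρ k)).toSection_mem _ ⟨hU k hk, hU l hl⟩) ((hr l).2 _ hl).2]
    have h3 := (h (ρ k)).symm_apply_eq (h (ρ l)) (y := z) (by rw [hz]; exact ⟨hU k hk, hU l hl⟩)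
    rw [hz, hz'] at h3
    rw [h3]
  · intro k w hk
    have hz := (h (ρ k)).proj_symm (hU k hk)
    have hzr := hz.trans ((hr k).2 _ hk).1.symm
    have hp : (nmul ((h (ρ k)).e.symm w) (r k (W.proj w))).proj = W.proj w := by
      rw [Coset.proj_nmul hzr, hz]
    have e1 : (h (ρ (D.bar k))).e.symm (W.τ w) = ((h (ρ k)).e.symm w).τ := by
      rw [hρ]; exact hh.symm_τ (hU k hk)
    have e2 : (h' (ρ' (D.bar k))).e (nmul ((h (ρ k)).e.symm w) (r k (W.proj w))).τ =
        W'.τ ((h' (ρ' k)).e (nmul ((h (ρ k)).e.symm w) (r k (W.proj w)))) := by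
      rw [hρ']; exact hh' _ _ (by rw [hp]; exact hU' k hk)
    unfold LocalIso.twistedMap
    rw [e1, W.proj_τ, hrr k _ hk, ← Coset.τ_nmul hzr ((hr k).2 _ hk).2, e2]

/-! ### Glueing of manifolds -/

section Glue

variable {E : Type*} [NormedAddCommGroup E] [NormedSpace ℂ E]
  {X : Type*} [TopologicalSpace X] [ChartedSpace E X]
  {T : Type*} [TopologicalSpace T] {ι : Type*}

/-- The charts of a space covered by open subsets of a manifold. -/
abbrev gluedChartedSpace (e : ι → OpenPartialHomeomorph X T) (κ : T → ι)
    (hκ : ∀ z, z ∈ (e (κ z)).target) : ChartedSpace E T where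
  atlas := {f | ∃ i, ∃ φ ∈ atlas E X, f = (e i).symm.trans φ}
  chartAt z := (e (κ z)).symm.trans (chartAt E ((e (κ z)).symm z))
  mem_chart_source z := by
    rw [OpenPartialHomeomorph.trans_source]
    exact ⟨hκ z, mem_chart_source E ((e (κ z)).symm z)⟩
  chart_mem_atlas z := ⟨κ z, _, chart_mem_atlas E _, rfl⟩

/-- A chart change is a transition map of the `e i` between a chart of `X` and the inverse of
another. -/
lemma isManifold_glued [IsManifold 𝓘(ℂ, E) ω X] {e : ι → OpenPartialHomeomorph X T} {κ : T → ι}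
    (hκ : ∀ z, z ∈ (e (κ z)).target)
    (he : ∀ i j, ContMDiffOn 𝓘(ℂ, E) 𝓘(ℂ, E) ω (fun y => (e j).symm (e i y))
      ((e i).source ∩ e i ⁻¹' (e j).target)) :
    letI := gluedChartedSpace (E := E) e κ hκ
    IsManifold 𝓘(ℂ, E) ω T := by
  let := gluedChartedSpace (E := E) e κ hκ
  refine isManifold_of_contDiffOn _ _ _ fun f f' hf hf' => ?_
  simp only [modelWithCornersSelf_coe, modelWithCornersSelf_coe_symm, Function.id_comp,
    Function.comp_id, preimage_id, range_id, inter_univ]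
  obtain ⟨i, φ, hφ, rfl⟩ := hf
  obtain ⟨j, φ', hφ', rfl⟩ := hf'
  rw [← contMDiffOn_iff_contDiffOn]
  intro b hb
  simp only [OpenPartialHomeomorph.trans_source, OpenPartialHomeomorph.symm_source,
    OpenPartialHomeomorph.trans_target, OpenPartialHomeomorph.symm_target, mem_inter_iff,
    mem_preimage] at hb
  obtain ⟨⟨h1, h2⟩, h3, h4⟩ := hb
  have h3' : e i (φ.symm b) ∈ (e j).target := h3
  have h4' : (e j).symm (e i (φ.symm b)) ∈ φ'.source := h4
  have a1 : ContMDiffAt 𝓘(ℂ, E) 𝓘(ℂ, E) ω φ.symm b :=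
    (contMDiffOn_symm_of_mem_maximalAtlas (IsManifold.subset_maximalAtlas hφ)).contMDiffAt
      (φ.open_target.mem_nhds h1)
  have a2 : ContMDiffAt 𝓘(ℂ, E) 𝓘(ℂ, E) ω (fun y => (e j).symm (e i y)) (φ.symm b) :=
    (he i j).contMDiffAt (((e i).isOpen_inter_preimage (e j).open_target).mem_nhds ⟨h2, h3'⟩)
  have a3 : ContMDiffAt 𝓘(ℂ, E) 𝓘(ℂ, E) ω φ' ((e j).symm (e i (φ.symm b))) :=
    (contMDiffOn_of_mem_maximalAtlas (IsManifold.subset_maximalAtlas hφ')).contMDiffAt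
      (φ'.open_source.mem_nhds h4')
  exact (a3.comp b (a2.comp b a1)).contMDiffWithinAt

lemma contMDiffAt_glued [IsManifold 𝓘(ℂ, E) ω X] {e : ι → OpenPartialHomeomorph X T} {κ : T → ι}
    (hκ : ∀ z, z ∈ (e (κ z)).target)
    (he : ∀ i j, ContMDiffOn 𝓘(ℂ, E) 𝓘(ℂ, E) ω (fun y => (e j).symm (e i y))
      ((e i).source ∩ e i ⁻¹' (e j).target)) (i : ι) {y : X} (hy : y ∈ (e i).source) :
    letI := gluedChartedSpace (E := E) e κ hκ
    ContMDiffAt 𝓘(ℂ, E) 𝓘(ℂ, E) ω (e i) y := by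
  let := gluedChartedSpace (E := E) e κ hκ
  rw [contMDiffAt_iff_target]
  refine ⟨(e i).continuousAt hy, ?_⟩
  have h1 := hκ (e i y)
  have a2 : ContMDiffAt 𝓘(ℂ, E) 𝓘(ℂ, E) ω (fun z => (e (κ (e i y))).symm (e i z)) y :=
    (he i _).contMDiffAt (((e i).isOpen_inter_preimage (e _).open_target).mem_nhds ⟨hy, h1⟩)
  have a3 : ContMDiffAt 𝓘(ℂ, E) 𝓘(ℂ, E) ω (extChartAt 𝓘(ℂ, E) ((e (κ (e i y))).symm (e i y)))
      ((e (κ (e i y))).symm (e i y)) := contMDiffAt_extChartAt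
  exact ContMDiffAt.comp (g := extChartAt 𝓘(ℂ, E) ((e (κ (e i y))).symm (e i y)))
    (f := fun z => (e (κ (e i y))).symm (e i z)) y a3 a2

/-- For the preferred index at `z` the inverse is read off from the chart there; any other index
differs by a transition map. -/
lemma contMDiffAt_glued_symm [IsManifold 𝓘(ℂ, E) ω X] {e : ι → OpenPartialHomeomorph X T}
    {κ : T → ι} (hκ : ∀ z, z ∈ (e (κ z)).target)
    (he : ∀ i j, ContMDiffOn 𝓘(ℂ, E) 𝓘(ℂ, E) ω (fun y => (e j).symm (e i y))
      ((e i).source ∩ e i ⁻¹' (e j).target)) (i : ι) {z : T} (hz : z ∈ (e i).target) :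
    letI := gluedChartedSpace (E := E) e κ hκ
    ContMDiffAt 𝓘(ℂ, E) 𝓘(ℂ, E) ω (e i).symm z := by
  let := gluedChartedSpace (E := E) e κ hκ
  have := isManifold_glued hκ he
  have h1 := hκ z
  set k := κ z with hk
  -- the inverse of the chosen isomorphism at `z`
  have a1 : ContMDiffAt 𝓘(ℂ, E) 𝓘(ℂ, E) ω (e k).symm z := by
    have hc : ContMDiffAt 𝓘(ℂ, E) 𝓘(ℂ, E) ω (chartAt E z) z :=
      contMDiffOn_chart.contMDiffAt ((chartAt E z).open_source.mem_nhds (mem_chart_source E z))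
    let φ := chartAt E ((e k).symm z)
    have hφ : ContMDiffAt 𝓘(ℂ, E) 𝓘(ℂ, E) ω φ.symm (chartAt E z z) :=
      contMDiffOn_chart_symm.contMDiffAt (φ.open_target.mem_nhds (mem_chart_target E _))
    refine (hφ.comp z hc).congr_of_eventuallyEq ?_
    filter_upwards [(chartAt E z).open_source.mem_nhds (mem_chart_source E z)] with z' hz'
    exact (φ.left_inv hz'.2).symm
  have hp : e k ((e k).symm z) = z := (e k).right_inv h1
  have a2 : ContMDiffAt 𝓘(ℂ, E) 𝓘(ℂ, E) ω (fun y => (e i).symm (e k y)) ((e k).symm z) :=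
    (he k i).contMDiffAt (((e k).isOpen_inter_preimage (e i).open_target).mem_nhds
      ⟨(e k).map_target h1, by rw [mem_preimage, hp]; exact hz⟩)
  refine (a2.comp z a1).congr_of_eventuallyEq ?_
  filter_upwards [(e k).open_target.mem_nhds h1] with z' hz'
  simp only [Function.comp, (e k).right_inv hz']

end Glue

/-! ### The homogeneous space of a cocycle -/

variable {C : RealCover} (c : RealCocycle H C)

/-- A chosen member of the covering containing `x`. -/
def RealCover.index (C : RealCover) (x : CP1) : C.ι := (C.covers x).choose

lemma RealCover.mem_index (C : RealCover) (x : CP1) : x ∈ C.U (C.index x) :=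
  (C.covers x).choose_spec

lemma RealCover.antipode_mem (C : RealCover) {i : C.ι} {x : CP1} (hx : x ∈ C.U i) :
    antipode x ∈ C.U (C.bar i) := by
  rw [C.U_bar, mem_preimage, antipode_antipode]; exact hx

namespace RealCocycle

variable {c} in
lemma proj_s {i j : C.ι} {x : CP1} (hi : x ∈ C.U i) (hj : x ∈ C.U j) : (c.s i j x).proj = x :=
  ((c.isSection i j).2 x ⟨hi, hj⟩).1

variable {c} in
lemma s_mem {i j : C.ι} {x : CP1} (hi : x ∈ C.U i) (hj : x ∈ C.U j) :
    c.s i j x ∈ normalizerQuotient H :=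
  ((c.isSection i j).2 x ⟨hi, hj⟩).2

variable {c} in
-- The cocycle condition for `i, i, i` makes the value idempotent in a group.
lemma s_self {i : C.ι} {x : CP1} (hi : x ∈ C.U i) : c.s i i x = Coset.one H x :=
  Coset.eq_one_of_nmul_self (proj_s hi hi) (s_mem hi hi) (c.cocycle i i i x ⟨⟨hi, hi⟩, hi⟩)

/-- Right multiplication by the section `s i j` of a cocycle. -/
def rmul (i j : C.ι) (y : Coset H) : Coset H := nmul y (c.s i j y.proj)

variable {c} {i j k : C.ι} {y : Coset H}

lemma proj_rmul (hi : y.proj ∈ C.U i) (hj : y.proj ∈ C.U j) : (c.rmul i j y).proj = y.proj :=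
  Coset.proj_nmul (proj_s hi hj).symm

lemma rmul_self (hi : y.proj ∈ C.U i) : c.rmul i i y = y := by
  unfold rmul
  rw [s_self hi, Coset.nmul_one rfl]

lemma rmul_rmul (hi : y.proj ∈ C.U i) (hj : y.proj ∈ C.U j) (hk : y.proj ∈ C.U k) :
    c.rmul j k (c.rmul i j y) = c.rmul i k y := by
  have h := proj_rmul (c := c) hi hj
  unfold rmul at h ⊢
  rw [h, Coset.nmul_assoc (proj_s hi hj).symm (proj_s hj hk).symm (s_mem hi hj) (s_mem hj hk),
    ← c.cocycle i j k _ ⟨⟨hi, hj⟩, hk⟩]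

lemma rmul_rmul_self (hi : y.proj ∈ C.U i) (hj : y.proj ∈ C.U j) :
    c.rmul j i (c.rmul i j y) = y := by
  rw [rmul_rmul hi hj hi, rmul_self hi]

lemma act_rmul {g : G.carrier} (hg : G.proj g = y.proj) (hi : y.proj ∈ C.U i)
    (hj : y.proj ∈ C.U j) : Coset.act g (c.rmul i j y) = c.rmul i j (Coset.act g y) := by
  unfold rmul
  rw [Coset.proj_act hg, Coset.act_nmul hg (proj_s hi hj).symm (s_mem hi hj)]

lemma τ_rmul (hi : y.proj ∈ C.U i) (hj : y.proj ∈ C.U j) :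
    (c.rmul i j y).τ = c.rmul (C.bar i) (C.bar j) y.τ := by
  unfold rmul
  rw [Coset.τ_nmul (proj_s hi hj).symm (s_mem hi hj), Coset.proj_τ, c.real i j _ ⟨hi, hj⟩]

lemma contMDiffAt_rmul (hi : y.proj ∈ C.U i) (hj : y.proj ∈ C.U j) :
    ContMDiffAt H.I H.I ω (c.rmul i j) y :=
  Twistor.contMDiffAt_rmul ((C.isOpen i).inter (C.isOpen j)) (c.isSection i j) ⟨hi, hj⟩

variable (c) in
/-- The total space of the homogeneous space of a cocycle: as a set it is `G/H`, and over `U i` it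
is identified with `G/H` through the right multiplication by `s i (index x)`. -/
def Total (_c : RealCocycle H C) : Type u := Coset H

variable (c) in
/-- The identification of `G/H` with the total space over `U i`. -/
def toTotal (i : C.ι) (y : Coset H) : c.Total := c.rmul i (C.index y.proj) y

variable (c) in
/-- The inverse of the identification of `G/H` with the total space over `U i`. -/
def ofTotal (i : C.ι) (z : c.Total) : Coset H := c.rmul (C.index (Coset.proj z)) i z

/-- The projection of the total space. -/
def Total.proj (z : c.Total) : CP1 := Coset.proj (H := H) z

lemma proj_toTotal (hi : y.proj ∈ C.U i) : (c.toTotal i y).proj = y.proj :=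
  proj_rmul hi (C.mem_index _)

lemma proj_ofTotal {z : c.Total} (hi : z.proj ∈ C.U i) : (c.ofTotal i z).proj = z.proj :=
  proj_rmul (C.mem_index _) hi

lemma ofTotal_toTotal (hi : y.proj ∈ C.U i) (hj : y.proj ∈ C.U j) :
    c.ofTotal j (c.toTotal i y) = c.rmul i j y := by
  have h : Coset.proj (H := H) (c.toTotal i y) = y.proj := proj_toTotal hi
  unfold ofTotal
  rw [h]
  exact rmul_rmul hi (C.mem_index _) hj

lemma toTotal_ofTotal {z : c.Total} (hi : z.proj ∈ C.U i) : c.toTotal i (c.ofTotal i z) = z := by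
  have h : (c.ofTotal i z).proj = z.proj := proj_ofTotal hi
  unfold toTotal
  rw [h]
  exact rmul_rmul_self (C.mem_index _) hi

/-- The index used to identify `Total` with `G/H` as a set jumps from point to point, so the
topology of `G/H` is not the right one; openness is tested in every trivialization instead. -/
instance : TopologicalSpace c.Total where
  IsOpen O := ∀ i, IsOpen (Coset.proj ⁻¹' C.U i ∩ c.toTotal i ⁻¹' O)
  isOpen_univ i := by simpa using (C.isOpen i).preimage Coset.continuous_proj
  isOpen_inter O O' hO hO' i := by
    convert (hO i).inter (hO' i) using 1
    ext y; simp only [mem_inter_iff, mem_preimage]; tauto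
  isOpen_sUnion 𝒪 h𝒪 i := by
    have : Coset.proj ⁻¹' C.U i ∩ c.toTotal i ⁻¹' ⋃₀ 𝒪 =
        ⋃ O ∈ 𝒪, Coset.proj ⁻¹' C.U i ∩ c.toTotal i ⁻¹' O := by
      ext y; simp
    rw [this]
    exact isOpen_biUnion fun O hO => h𝒪 O hO i

variable (c) in
/-- The identification of `G/H` with the total space over `U i` as a homeomorphism. -/
def totalHomeo (i : C.ι) : OpenPartialHomeomorph (Coset H) c.Total where
  toFun := c.toTotal i
  invFun := c.ofTotal i
  source := Coset.proj ⁻¹' C.U i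
  target := Total.proj ⁻¹' C.U i
  map_source' y hy := by rw [mem_preimage, proj_toTotal hy]; exact hy
  map_target' z hz := by rw [mem_preimage, proj_ofTotal hz]; exact hz
  left_inv' y hy := by rw [ofTotal_toTotal hy hy, rmul_self hy]
  right_inv' z hz := toTotal_ofTotal hz
  open_source := (C.isOpen i).preimage Coset.continuous_proj
  open_target := by
    intro j
    have : Coset.proj ⁻¹' C.U j ∩ c.toTotal j ⁻¹' (Total.proj ⁻¹' C.U i) =
        Coset.proj (H := H) ⁻¹' (C.U j ∩ C.U i) := by
      ext y
      refine and_congr_right fun hy => ?_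
      rw [mem_preimage, mem_preimage, proj_toTotal hy]
    rw [this]
    exact ((C.isOpen j).inter (C.isOpen i)).preimage Coset.continuous_proj
  continuousOn_toFun := by
    rw [continuousOn_open_iff ((C.isOpen i).preimage Coset.continuous_proj)]
    intro O hO
    exact hO i
  continuousOn_invFun := by
    rw [continuousOn_iff']
    intro O hO
    -- Seen over `U j`, this set is the preimage of `O` under the continuous transition map `rmul j
    -- i`.
    refine ⟨Total.proj ⁻¹' C.U i ∩ c.ofTotal i ⁻¹' O, fun j => ?_, ?_⟩
    · have : Coset.proj ⁻¹' C.U j ∩ c.toTotal j ⁻¹' (Total.proj ⁻¹' C.U i ∩ c.ofTotal i ⁻¹' O) =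
          Coset.proj (H := H) ⁻¹' (C.U j ∩ C.U i) ∩ c.rmul j i ⁻¹' O := by
        ext y
        simp only [mem_inter_iff, mem_preimage, and_assoc]
        refine and_congr_right fun hj => ?_
        rw [proj_toTotal hj]
        refine and_congr_right fun hi => ?_
        rw [ofTotal_toTotal hj hi]
      rw [this]
      refine ContinuousOn.isOpen_inter_preimage (fun y hy => ?_)
        (((C.isOpen j).inter (C.isOpen i)).preimage Coset.continuous_proj) hO
      exact (contMDiffAt_rmul hy.1 hy.2).continuousAt.continuousWithinAt
    · ext z
      simp only [mem_inter_iff, mem_preimage]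
      tauto

lemma mem_totalHomeo_target (z : c.Total) :
    z ∈ (c.totalHomeo (C.index z.proj)).target := C.mem_index _

lemma contMDiffOn_transition (i j : C.ι) :
    ContMDiffOn H.I H.I ω (fun y => (c.totalHomeo j).symm (c.totalHomeo i y))
      ((c.totalHomeo i).source ∩ c.totalHomeo i ⁻¹' (c.totalHomeo j).target) := by
  have key : ∀ y : Coset H, y.proj ∈ C.U i → (c.toTotal i y).proj ∈ C.U j → y.proj ∈ C.U j :=
    fun y hi hj => by rwa [proj_toTotal hi] at hj
  rintro y ⟨hi, hj⟩
  refine ((contMDiffAt_rmul (c := c) (i := i) (j := j) hi (key y hi hj)).contMDiffWithinAt).congr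
    (fun z hz => ?_) ?_
  · exact ofTotal_toTotal hz.1 (key z hz.1 hz.2)
  · exact ofTotal_toTotal hi (key y hi hj)

instance : ChartedSpace H.Model c.Total :=
  gluedChartedSpace c.totalHomeo (fun z => C.index z.proj) mem_totalHomeo_target

instance : IsManifold H.I ω c.Total := isManifold_glued mem_totalHomeo_target contMDiffOn_transition

lemma contMDiffAt_toTotal (hi : y.proj ∈ C.U i) : ContMDiffAt H.I H.I ω (c.toTotal i) y :=
  contMDiffAt_glued mem_totalHomeo_target contMDiffOn_transition i hi

lemma contMDiffAt_ofTotal {z : c.Total} (hi : z.proj ∈ C.U i) :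
    ContMDiffAt H.I H.I ω (c.ofTotal i) z :=
  contMDiffAt_glued_symm mem_totalHomeo_target contMDiffOn_transition i hi

lemma isOpen_preimage_proj {U : Set CP1} (hU : IsOpen U) :
    IsOpen (Total.proj (c := c) ⁻¹' U) := by
  intro i
  have : Coset.proj ⁻¹' C.U i ∩ c.toTotal i ⁻¹' (Total.proj ⁻¹' U) =
      Coset.proj (H := H) ⁻¹' (C.U i ∩ U) := by
    ext y
    refine and_congr_right fun hy => ?_
    rw [mem_preimage, mem_preimage, proj_toTotal hy]
  rw [this]
  exact ((C.isOpen i).inter hU).preimage Coset.continuous_proj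

lemma contMDiff_total_proj : ContMDiff H.I 𝓘(ℂ) ω (Total.proj (c := c)) := by
  intro z
  have hz := C.mem_index z.proj
  refine (Coset.contMDiff_proj.contMDiffAt.comp z
    (contMDiffAt_ofTotal hz)).congr_of_eventuallyEq ?_
  filter_upwards [(isOpen_preimage_proj (C.isOpen _)).mem_nhds hz] with z' hz'
  exact (proj_ofTotal hz').symm

/-- Two points of one fibre lie in a common trivialization, a piece of the Hausdorff space `G/H`;
points of different fibres are separated in the base. -/
instance : T2Space c.Total := by
  refine ⟨fun z z' hzz' => ?_⟩
  by_cases hp : z.proj = z'.proj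
  · let e := c.totalHomeo (C.index z.proj)
    have hz : z ∈ e.target := C.mem_index _
    have hz' : z' ∈ e.target := by
      change z'.proj ∈ C.U (C.index z.proj)
      rw [← hp]
      exact C.mem_index _
    obtain ⟨u, v, hu, hv, hzu, hzv, huv⟩ := t2_separation (e.symm.injOn.ne hz hz' hzz')
    refine ⟨_, _, e.symm.isOpen_inter_preimage hu, e.symm.isOpen_inter_preimage hv, ⟨hz, hzu⟩,
      ⟨hz', hzv⟩, ?_⟩
    exact (huv.preimage _).mono inter_subset_right inter_subset_right
  · obtain ⟨u, v, hu, hv, hzu, hzv, huv⟩ := t2_separation hp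
    exact ⟨_, _, isOpen_preimage_proj hu, isOpen_preimage_proj hv, hzu, hzv, huv.preimage _⟩

/-! ### Real structure and action on the glued space. -/

/-- The real structure of the total space. -/
def Total.τ (z : c.Total) : c.Total :=
  c.toTotal (C.bar (C.index z.proj)) (c.ofTotal (C.index z.proj) z).τ

/-- Reality of the cocycle makes the conjugation of trivializations compatible with changes of
index, so the chosen index may be replaced by one fixed in a neighbourhood. -/
lemma τ_eq {z : c.Total} (hi : z.proj ∈ C.U i) : z.τ = c.toTotal (C.bar i) (c.ofTotal i z).τ := by
  have hk := C.mem_index z.proj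
  have hp := proj_ofTotal hk
  unfold Total.τ
  set k := C.index z.proj
  have e1 : c.ofTotal i z = c.rmul k i (c.ofTotal k z) := by
    rw [← ofTotal_toTotal (by rwa [hp]) (by rwa [hp]), toTotal_ofTotal hk]
  have hk' : (c.ofTotal k z).τ.proj ∈ C.U (C.bar k) := by
    rw [Coset.proj_τ, hp]; exact C.antipode_mem hk
  have hi' : (c.ofTotal k z).τ.proj ∈ C.U (C.bar i) := by
    rw [Coset.proj_τ, hp]; exact C.antipode_mem hi
  rw [e1, τ_rmul (by rwa [hp]) (by rwa [hp]), ← ofTotal_toTotal hk' hi', toTotal_ofTotal]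
  rwa [proj_toTotal hk']

lemma proj_τ (z : c.Total) : z.τ.proj = antipode z.proj := by
  have hk := C.mem_index z.proj
  have hp := proj_ofTotal hk
  unfold Total.τ
  rw [proj_toTotal, Coset.proj_τ, hp]
  rw [Coset.proj_τ, hp]; exact C.antipode_mem hk

lemma τ_toTotal (hi : y.proj ∈ C.U i) : (c.toTotal i y).τ = c.toTotal (C.bar i) y.τ := by
  rw [τ_eq (i := i) (by rwa [proj_toTotal hi]), ofTotal_toTotal hi hi, rmul_self hi]

lemma τ_τ (z : c.Total) : z.τ.τ = z := by
  have hk := C.mem_index z.proj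
  have hp := proj_ofTotal hk
  rw [τ_eq hk, τ_toTotal, Coset.τ_τ, C.bar_bar, toTotal_ofTotal hk]
  rw [Coset.proj_τ, hp]; exact C.antipode_mem hk

lemma antiHolAt_total_τ (z : c.Total) : AntiHolAt H.Model H.Model (Total.τ (c := c)) z := by
  have hk := C.mem_index z.proj
  have hp := proj_ofTotal hk
  set k := C.index z.proj
  have h1 : ContMDiffAt H.I H.I ω (c.toTotal (C.bar k)) (c.ofTotal k z).τ := by
    refine contMDiffAt_toTotal ?_
    rw [Coset.proj_τ, hp]; exact C.antipode_mem hk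
  refine AntiHolAt.congr_of_eventuallyEq (AntiHolAt.comp_contMDiffAt
    (AntiHolAt.contMDiffAt_comp h1 (Coset.antiHolAt_τ _)) (contMDiffAt_ofTotal hk)) ?_
  filter_upwards [(isOpen_preimage_proj (C.isOpen _)).mem_nhds hk] with z' hz'
  exact τ_eq hz'

/-- The action of `G` on the total space. -/
def Total.act (g : G.carrier) (z : c.Total) : c.Total := Coset.act (H := H) g z

/-- Right multiplications commute with left translations, so the action on `G/H` serves unchanged on
the total space, and its algebraic axioms are inherited. -/
lemma act_toTotal {g : G.carrier} (hg : G.proj g = y.proj) (hi : y.proj ∈ C.U i) :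
    Total.act g (c.toTotal i y) = c.toTotal i (Coset.act g y) := by
  unfold toTotal Total.act
  rw [Coset.proj_act hg, act_rmul hg hi (C.mem_index _)]

lemma exists_toTotal (z : c.Total) :
    ∃ (i : C.ι) (y : Coset H), y.proj = z.proj ∧ y.proj ∈ C.U i ∧ c.toTotal i y = z := by
  have hk := C.mem_index z.proj
  have hp := proj_ofTotal hk
  exact ⟨_, _, hp, by rwa [hp], toTotal_ofTotal hk⟩

lemma proj_act {g : G.carrier} {z : c.Total} (h : G.proj g = z.proj) :
    (Total.act g z).proj = z.proj :=
  Coset.proj_act h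

lemma τ_act {g : G.carrier} {z : c.Total} (h : G.proj g = z.proj) :
    (Total.act g z).τ = Total.act (G.τ g) z.τ := by
  obtain ⟨i, y, hy, hi, rfl⟩ := exists_toTotal z
  rw [← hy] at h
  have hy' : G.proj (G.τ g) = y.τ.proj := by rw [G.proj_τ, Coset.proj_τ, h]
  rw [act_toTotal h hi, τ_toTotal (by rwa [Coset.proj_act h]), τ_toTotal hi, act_toTotal hy',
    Coset.τ_act h]
  rw [Coset.proj_τ]; exact C.antipode_mem hi

variable (c) in
-- In a trivialization, lift the coset holomorphically to `σ` in `G`; the action is then the class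
-- of the product `g · σ`, and multiplication is holomorphic within the fibre product.
lemma contMDiffOn_act : ContMDiffOn (G.I.prod H.I) H.I ω
    (fun p : G.carrier × c.Total => Total.act p.1 p.2) {p | G.proj p.1 = p.2.proj} := by
  rintro ⟨g₀, z₀⟩ h₀
  have hi := C.mem_index z₀.proj
  set i := C.index z₀.proj
  obtain ⟨σ, hσ, hσe⟩ := Coset.exists_lift (c.ofTotal i z₀)
  have hb := contMDiffAt_ofTotal hi
  have he : ∀ᶠ z in 𝓝 z₀, z.proj ∈ C.U i ∧ Coset.mk H (σ (c.ofTotal i z)) = c.ofTotal i z :=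
    Filter.Eventually.and ((isOpen_preimage_proj (C.isOpen i)).mem_nhds hi)
      (hb.continuousAt.eventually hσe)
  have hN : {p : G.carrier × c.Total | p.2.proj ∈ C.U i ∧
      Coset.mk H (σ (c.ofTotal i p.2)) = c.ofTotal i p.2} ∈ 𝓝 (g₀, z₀) :=
    (continuousAt_snd (p := (g₀, z₀))).eventually he
  rw [← contMDiffWithinAt_inter hN]
  have key : ∀ p ∈ {p : G.carrier × c.Total | G.proj p.1 = p.2.proj} ∩
      {p : G.carrier × c.Total | p.2.proj ∈ C.U i ∧
        Coset.mk H (σ (c.ofTotal i p.2)) = c.ofTotal i p.2},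
      G.proj p.1 = G.proj (σ (c.ofTotal i p.2)) ∧
      Total.act p.1 p.2 = c.toTotal i (Coset.mk H (G.mul p.1 (σ (c.ofTotal i p.2)))) := by
    rintro ⟨g, z⟩ ⟨h, hz, hm⟩
    have hp : (c.ofTotal i z).proj = z.proj := proj_ofTotal hz
    have hg : G.proj g = G.proj (σ (c.ofTotal i z)) := by
      rw [← Coset.proj_mk (H := H) (σ _), hm, hp]; exact h
    refine ⟨hg, ?_⟩
    dsimp only
    rw [← Coset.act_mk hg, hm, ← act_toTotal (by rw [hp]; exact h) (by rwa [hp]),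
      toTotal_ofTotal hz]
  have h0 := key (g₀, z₀) ⟨h₀, he.self_of_nhds⟩
  have h1 : ContMDiffAt (G.I.prod H.I) G.I ω
      (fun p : G.carrier × c.Total => σ (c.ofTotal i p.2)) (g₀, z₀) :=
    ContMDiffAt.comp (I' := H.I) (g₀, z₀) (g := fun z => σ (c.ofTotal i z)) (hσ.comp z₀ hb)
      contMDiffAt_snd
  have h2 := contMDiffWithinAt_mul (I := G.I.prod H.I) (f := Prod.fst)
    contMDiffAt_fst.contMDiffWithinAt h1.contMDiffWithinAt (fun p hp => (key p hp).1) h0.1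
  have h3 : ContMDiffAt G.I H.I ω (fun a => c.toTotal i (Coset.mk H a))
      (G.mul g₀ (σ (c.ofTotal i z₀))) := by
    refine ContMDiffAt.comp _ (g := c.toTotal i) (contMDiffAt_toTotal ?_)
      Coset.contMDiff_mk.contMDiffAt
    rw [Coset.proj_mk, G.proj_mul _ _ h0.1]
    have : G.proj g₀ = z₀.proj := h₀
    rwa [this]
  exact (ContMDiffAt.comp_contMDiffWithinAt (g := fun a => c.toTotal i (Coset.mk H a))
    (g₀, z₀) h3 h2).congr (fun p hp => (key p hp).2) h0.2

variable (c) in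
/-- The homogeneous space of a cocycle. -/
def space : HomogeneousSpace G where
  carrier := c.Total
  dim := H.codim + 1
  proj := Total.proj
  proj_hol := contMDiff_total_proj
  proj_surjective x := ⟨c.toTotal (C.index x) (Coset.one H x), by
    have h := Coset.proj_one (H := H) x
    rw [proj_toTotal (by rw [h]; exact C.mem_index x), h]⟩
  proj_submersion z := by
    obtain ⟨i, y, hy, hi, rfl⟩ := exists_toTotal z
    obtain ⟨g, rfl⟩ := Coset.surjective_mk y
    -- A local section of `G` through a representative, pushed to the total space, is a section of
    -- the projection and makes it submersive.
    obtain ⟨γ, hγ, hγ0, hγe⟩ := G.exists_section g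
    rw [Coset.proj_mk] at hy hi
    have h1 : ContMDiffAt 𝓘(ℂ) H.I ω (fun x => c.toTotal i (Coset.mk H (γ x))) (G.proj g) := by
      refine ContMDiffAt.comp _ (g := c.toTotal i) (contMDiffAt_toTotal ?_)
        (Coset.contMDiff_mk.contMDiffAt.comp _ hγ)
      rwa [hγ0]
    refine mfderiv_surjective_of_section (σ := fun x => c.toTotal i (Coset.mk H (γ x)))
      (contMDiff_total_proj.contMDiffAt.mdifferentiableAt (by simp)) ?_ ?_ ?_
    · rw [← hy]; exact h1.mdifferentiableAt (by simp)
    · simp only [← hy, hγ0]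
    · rw [← hy]
      filter_upwards [hγe, (C.isOpen i).mem_nhds hi] with x hx hxi
      have h2 : (Coset.mk H (γ x)).proj = x := hx
      rw [proj_toTotal (by rwa [h2]), h2]
  τ := Total.τ
  τ_antihol := antiHol_iff.2 antiHolAt_total_τ
  τ_τ := τ_τ
  proj_τ := proj_τ
  act := Total.act
  act_hol := contMDiffOn_act c
  proj_act _ _ h := proj_act h
  one_act z := Coset.one_act (H := H) z
  mul_act _ _ _ hgh hz := Coset.mul_act (H := H) hgh hz
  τ_act _ _ h := τ_act h
  transitive _ _ h := Coset.exists_act_eq (H := H) h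

variable (c) in
/-- The local isomorphisms of `G/H` with the homogeneous space of a cocycle. -/
def localIso (i : C.ι) : LocalIso H c.space (C.U i) :=
  LocalIso.ofContMDiffOn (c.totalHomeo i) rfl rfl
    (fun _ hy => (contMDiffAt_toTotal hy).contMDiffWithinAt)
    (fun _ hz => (contMDiffAt_ofTotal hz).contMDiffWithinAt)
    (fun _ hy => proj_toTotal hy)
    (fun _ _ hy hg => (act_toTotal hg hy).symm)

variable (c) in
lemma locallyIsoCoset_space : LocallyIsoCoset H c.space := fun x =>
  ⟨C.U (C.index x), C.isOpen _, C.mem_index x, ⟨c.localIso _⟩⟩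

variable (c) in
lemma isCocycleOf_space : IsCocycleOf c.space ⟨C, c⟩ := by
  refine ⟨c.localIso, fun i y hy => (τ_toTotal hy).symm, fun i j x hx => ?_⟩
  have h := Coset.proj_one (H := H) x
  have h1 := ofTotal_toTotal (c := c) (i := i) (j := j) (y := Coset.one H x)
    (by rw [h]; exact hx.1) (by rw [h]; exact hx.2)
  refine Eq.trans ?_ h1.symm
  unfold rmul
  rw [h, Coset.one_nmul (proj_s hx.1 hx.2) (s_mem hx.1 hx.2)]

end RealCocycle

/-! ### The classification -/

lemma LocallyIsoCoset.exists_isCocycleOf {W : HomogeneousSpace G} (hW : LocallyIsoCoset H W) :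
    ∃ c : Σ C : RealCover, RealCocycle H C, IsCocycleOf W c := by
  obtain ⟨C, h, hr⟩ := hW.exists_isRealFamily
  exact ⟨⟨C, hr.cocycle⟩, h, hr, fun _ _ _ _ => rfl⟩

variable (H) in
/-- The cohomology class of a homogeneous space. -/
def IsoClass.toH1Real : IsoClass H → H1Real H :=
  Quot.lift (fun W => Quot.mk _ W.2.exists_isCocycleOf.choose) fun W W' ⟨F⟩ =>
    Quot.sound (cohomologous_of_iso W.2.exists_isCocycleOf.choose_spec
      W'.2.exists_isCocycleOf.choose_spec F)

/-- The chosen cocycle and `c` both come from `W`, so the identity of `W` relates them. This makes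
the class computable from any real family. -/
lemma IsoClass.toH1Real_eq (W : LocallyCosetSpace H) {c : Σ C : RealCover, RealCocycle H C}
    (hc : IsCocycleOf W.1 c) : IsoClass.toH1Real H (Quot.mk _ W) = Quot.mk _ c :=
  Quot.sound (cohomologous_of_iso W.2.exists_isCocycleOf.choose_spec hc
    (HomogeneousSpace.Iso.refl W.1))

variable (H) in
/-- The isomorphism class of homogeneous spaces with a given cohomology class. -/
def H1Real.toIsoClass : H1Real H → IsoClass H :=
  Quot.lift (fun c => Quot.mk _ ⟨c.2.space, c.2.locallyIsoCoset_space⟩) fun c c' h =>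
    Quot.sound (nonempty_iso_of_cohomologous c.2.isCocycleOf_space c'.2.isCocycleOf_space h)

/-- Obtained geometrically: `c` is a cocycle of its own space, compared with itself through the
identity. -/
lemma Cohomologous.refl (c : Σ C : RealCover, RealCocycle H C) : Cohomologous c c :=
  cohomologous_of_iso c.2.isCocycleOf_space c.2.isCocycleOf_space (HomogeneousSpace.Iso.refl _)

lemma H1Real.toIsoClass_eq (W : LocallyCosetSpace H) {c : Σ C : RealCover, RealCocycle H C}
    (hc : IsCocycleOf W.1 c) : H1Real.toIsoClass H (Quot.mk _ c) = Quot.mk _ W :=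
  Quot.sound (nonempty_iso_of_cohomologous c.2.isCocycleOf_space hc (Cohomologous.refl c))

variable (H) in
/-- The bijection between isomorphism classes of homogeneous spaces which are locally isomorphic to
`G/H` and real cohomology classes. -/
def isoClassEquivH1Real : IsoClass H ≃ H1Real H where
  toFun := IsoClass.toH1Real H
  invFun := H1Real.toIsoClass H
  left_inv := by
    rintro ⟨W⟩
    exact H1Real.toIsoClass_eq W W.2.exists_isCocycleOf.choose_spec
  right_inv := by
    rintro ⟨c⟩
    exact IsoClass.toH1Real_eq ⟨c.2.space, c.2.locallyIsoCoset_space⟩ c.2.isCocycleOf_space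

end Twistor

end

theorem mainTheorem5 (G : Twistor.TwistorGroup.{u}) (H : Twistor.ClosedTwistorSubgroup G) :
    ∃ Φ : Twistor.IsoClass H ≃ Twistor.H1Real H,
      ∀ (W : Twistor.LocallyCosetSpace H) (C : Twistor.RealCover)
        (h : ∀ i, Twistor.LocalIso H W.1 (C.U i)), Twistor.IsRealFamily h →
        ∃ c : Twistor.RealCocycle H C,
          (∀ i j, ∀ x ∈ C.U i ∩ C.U j, c.s i j x = Twistor.transition h i j x) ∧
          Φ (Quot.mk _ W) = Twistor.H1Real.mk c := by
  refine ⟨Twistor.isoClassEquivH1Real H, fun W C h hr => ⟨hr.cocycle, fun _ _ _ _ => rfl, ?_⟩⟩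
  exact Twistor.IsoClass.toH1Real_eq W (c := ⟨C, hr.cocycle⟩) ⟨h, hr, fun _ _ _ _ => rfl⟩
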